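/- Let $D,E,h>0$ be constants and let $\Omega\subset\mathbb{R}^2$ be a nonempty connected open set. For smooth $f,p:\Omega\to\mathbb{R}$ (shape of the shell middle-surface and transversal load) put $b_{\alpha\beta}=f_{,\alpha\beta}$ and consider Marguerre's equations for $(w,\Phi)$, $$D\,\delta^{\alpha\beta}\delta^{\mu\nu}w_{,\alpha\beta\mu\nu}-e^{\alpha\mu}e^{\beta\nu}w_{,\alpha\beta}\Phi_{,\mu\nu}-e^{\alpha\mu}e^{\beta\nu}b_{\alpha\beta}\Phi_{,\mu\nu}=p,$$ $$\tfrac1{Eh}\,\delta^{\alpha\beta}\delta^{\mu\nu}\Phi_{,\alpha\beta\mu\nu}+\tfrac12e^{\alpha\mu}e^{\beta\nu}w_{,\alpha\beta}w_{,\mu\nu}+e^{\alpha\mu}e^{\beta\nu}b_{\alpha\beta}w_{,\mu\nu}=0,$$ where Greek indices run over $1,2$ and are summed when repeated, a comma denotes partial differentiation, $\delta$ is the Kronecker delta and $e^{11}=e^{22}=0$, $e^{12}=-e^{21}=1$. The system admits a point transformation (of open subsets of $\Omega\times\mathbb{R}^2\subset\mathbb{R}^4$, with coordinates $(x^1,x^2,w,\Phi)$)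 if the induced action on 4-jets maps the manifold in the jet space defined by the two equations into itself, and it admits a local one-parameter group of point transformations if it admits each of its transformations. It admits a vector field $X=\xi^\mu\partial_{x^\mu}+\eta\,\partial_w+\varphi\,\partial_\Phi$ if the fourth prolongation of $X$ annihilates both equations on that manifold. The explicit determining equations on $\Omega$ are, for functions $\xi^1,\xi^2,\varphi$ and a smooth function $\eta$ of $(x^1,x^2)$: $\xi^1=C_1x^1+C_2x^2+C_3$, $\xi^2=-C_2x^1+C_1x^2+C_4$, $\varphi=B_1x^1+B_2x^2+B_3$ for some real constants $C_i,B_i$, and $$b_{\alpha\mu}\xi^\mu_{,\beta}+b_{\beta\mu}\xi^\mu_{,\alpha}+\xi^\mu b_{\alpha\beta,\mu}=-\eta_{,\alpha\beta},\quad e^{\alpha\mu}e^{\beta\nu}b_{\alpha\beta}\eta_{,\mu\nu}=0,\quad D\,\delta^{\alpha\beta}\delta^{\mu\nu}\eta_{,\alpha\beta\mu\nu}=2p\,\xi^\mu_{,\mu}+\xi^\mu p_{,\mu}.$$ Let $L_0$ be the span of $\partial_w,\ x^1\partial_w,\ x^2\partial_w,\ \partial_\Phi,\ x^1\partial_\Phi,\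 x^2\partial_\Phi$ and let $G_0$ be the group of transformations of $\mathbb{R}^4$ generated by the flows of the fields in $L_0$. Say that a local one-parameter group is contained in $G_0$ if its generator lies in $L_0$ and each of its transformations is a restriction of an element of $G_0$. Then: 1. The six fields are linearly independent (on $\Omega\times\mathbb{R}^2$), and $G_0$ is a 6-parameter group: $c\in\mathbb{R}^6\mapsto\big[(x,w,\Phi)\mapsto(x,\;w+c_1+c_2x^1+c_3x^2,\;\Phi+c_4+c_5x^1+c_6x^2)\big]$ is an isomorphism of $(\mathbb{R}^6,+)$ onto $G_0$. 2. For all smooth $f,p$ on $\Omega$: the system admits every transformation of $G_0$, and every such transformation maps smooth functions $(w,\Phi)$ to functions $(w',\Phi')$ such that, on every open subset of $\Omega$, one pair is a smooth solution if and only if the other is; the system admits every local one-parameter group contained in $G_0$ and every vector field in $L_0$; and $\xi^\mu=0$, $\eta=A_1x^1+A_2x^2+A_3$, $\varphi=B_1x^1+B_2x^2+B_3$ solves the determining equations for all real $A_i,B_i$. 3. For $f=\sin x^1\sin x^2$ and any smooth $p$ on $\Omega$ there is nothing else: on any connected open $M\subset\Omega\times\mathbb{R}^2$, every smooth local one-parameter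 group of point transformations admitted by the system is contained in $G_0$, and every smooth vector field on $M$ admitted by the system is the restriction of an element of $L_0$; and every solution of the determining equations on $\Omega$ is of the form given in 2. 4. Hence $G_0$ is the largest group admitted for all arbitrary elements: a local one-parameter group of point transformations on a connected open $M\subset\Omega\times\mathbb{R}^2$ is admitted for all smooth $f,p$ on $\Omega$ if and only if it is contained in $G_0$. -/

import Mathlib

open Set Filter Topology
open scoped ContDiff

namespace Marguerre

noncomputable section

/-- The plane of independent variables `x = (x¹, x²)` (indices `0, 1` in Lean). -/
abbrev Plane := Fin 2 → ℝ

/-- The space `ℝ⁴` of independent and dependent variables, with points `(x, w, Φ)`. -/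
abbrev Space := Plane × ℝ × ℝ

/-- Partial derivative `g_{,α}`. -/
def pd (α : Fin 2) (g : Plane → ℝ) : Plane → ℝ := fun x => fderiv ℝ g x (Pi.single α 1)

/-- Iterated partial derivative `g_{,J}` along a list of directions. -/
def pdL : List (Fin 2) → (Plane → ℝ) → (Plane → ℝ)
  | [], g => g
  | α :: J, g => pd α (pdL J g)

/-- Kronecker delta. -/
def delta (α β : Fin 2) : ℝ := if α = β then 1 else 0

/-- Alternating symbol `e^{αβ}`. -/
def alt (α β : Fin 2) : ℝ := (!![0, 1; -1, 0] : Matrix (Fin 2) (Fin 2) ℝ) α β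

/-- The contraction `δ^{αβ} δ^{μν} a_{αβμν}`; the fourfold index is given as a list. -/
def deltaContr (a : List (Fin 2) → ℝ) : ℝ :=
  ∑ α, ∑ β, ∑ μ, ∑ ν, delta α β * delta μ ν * a [α, β, μ, ν]

/-- The contraction `e^{αμ} e^{βν} a_{αβ} c_{μν}`. -/
def altContr (a c : Fin 2 → Fin 2 → ℝ) : ℝ :=
  ∑ α, ∑ β, ∑ μ, ∑ ν, alt α μ * alt β ν * a α β * c μ ν

/-- The second derivatives `g_{,αβ}` at `x`. -/
def hess (g : Plane → ℝ) (x : Plane) (α β : Fin 2) : ℝ := pdL [α, β] g x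

/-- The data entering Marguerre's equations: bending rigidity `D`, Young's modulus `E`,
thickness `h`, shape `f` of the middle surface, transversal load `p`. -/
structure Equations where
  D : ℝ
  E : ℝ
  h : ℝ
  f : Plane → ℝ
  p : Plane → ℝ

namespace Equations

variable (S : Equations)

/-- The curvature tensor `b_{αβ} = f_{,αβ}` of a shallow shell. -/
def b (x : Plane) (α β : Fin 2) : ℝ := hess S.f x α β

/-- Left-hand side minus right-hand side of the first equation. -/
def eq1 (w Φ : Plane → ℝ) (x : Plane) : ℝ :=
  S.D * deltaContr (fun J => pdL J w x) - altContr (hess w x) (hess Φ x)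
    - altContr (S.b x) (hess Φ x) - S.p x

/-- Left-hand side of the second equation. -/
def eq2 (w Φ : Plane → ℝ) (x : Plane) : ℝ :=
  1 / (S.E * S.h) * deltaContr (fun J => pdL J Φ x)
    + 1 / 2 * altContr (hess w x) (hess w x) + altContr (S.b x) (hess w x)

/-- Marguerre's equations hold for `(w, Φ)` at the point `x`. This depends only on the 4-jet
of `(w, Φ)` at `x`: it says that this jet lies on the manifold in the jet space that the system
defines. -/
def SatisfiedAt (w Φ : Plane → ℝ) (x : Plane) : Prop := S.eq1 w Φ x = 0 ∧ S.eq2 w Φ x = 0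

/-- Smooth solutions on `U`. -/
def IsSolutionOn (U : Set Plane) (w Φ : Plane → ℝ) : Prop :=
  ContDiffOn ℝ ∞ w U ∧ ContDiffOn ℝ ∞ Φ U ∧ ∀ x ∈ U, S.SatisfiedAt w Φ x

end Equations

/-! ### Groups of point transformations -/

/-- Near `x₀`, the point transformation `T` carries the graph of `(w, Φ)` onto the graph of
`(w', Φ')`; here `x ↦ χ x` is the induced map of the base points, and the transformed graph is
again transversal to the fibres. -/
def TransformsTo (T : Space → Space) (w Φ : Plane → ℝ) (x₀ : Plane) (w' Φ' : Plane → ℝ) : Prop :=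
  let χ : Plane → Plane := fun x => (T (x, w x, Φ x)).1
  (fderiv ℝ χ x₀).IsInvertible ∧
    ∀ᶠ x in 𝓝 x₀, T (x, w x, Φ x) = (χ x, w' (χ x), Φ' (χ x))

/-- The action of `T` on 4-jets with base point in `U ⊆ ℝ⁴` maps the manifold in the jet space
defined by the system into itself. (Jets are represented by germs of smooth functions.) -/
def Equations.InvariantUnder (S : Equations) (T : Space → Space) (U : Set Space) : Prop :=
  ∀ (x₀ : Plane) (w Φ w' Φ' : Plane → ℝ), (x₀, w x₀, Φ x₀) ∈ U →
    ContDiffAt ℝ ∞ w x₀ → ContDiffAt ℝ ∞ Φ x₀ →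
    ContDiffAt ℝ ∞ w' (T (x₀, w x₀, Φ x₀)).1 → ContDiffAt ℝ ∞ Φ' (T (x₀, w x₀, Φ x₀)).1 →
    TransformsTo T w Φ x₀ w' Φ' →
    S.SatisfiedAt w Φ x₀ → S.SatisfiedAt w' Φ' (T (x₀, w x₀, Φ x₀)).1

/-- A local one-parameter Lie group of local point transformations acting on `M ⊆ ℝ⁴`. -/
structure LocalGroup (M : Set Space) where
  /-- the pairs `(t, z)` for which the transformation with parameter `t` is defined at `z` -/
  dom : Set (ℝ × Space)
  map : ℝ → Space → Space
  isOpen_dom : IsOpen dom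
  mem_of_mem_dom : ∀ t z, (t, z) ∈ dom → z ∈ M
  zero_mem : ∀ z ∈ M, ((0 : ℝ), z) ∈ dom
  ordConnected : ∀ z, {t : ℝ | (t, z) ∈ dom}.OrdConnected
  contDiffOn : ContDiffOn ℝ ∞ (fun q : ℝ × Space => map q.1 q.2) dom
  map_mem : ∀ t z, (t, z) ∈ dom → map t z ∈ M
  map_zero : ∀ z ∈ M, map 0 z = z
  map_add : ∀ s t z, (s, z) ∈ dom → (t, map s z) ∈ dom → (s + t, z) ∈ dom →
    map t (map s z) = map (s + t) z
  neg_mem : ∀ t z, (t, z) ∈ dom → (-t, map t z) ∈ dom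

/-- The infinitesimal generator of a local one-parameter group. -/
def LocalGroup.generator {M : Set Space} (G : LocalGroup M) : Space → Space :=
  fun z => deriv (fun t => G.map t z) 0

/-- The system admits the local one-parameter group `G`. -/
def Equations.AdmitsGroup (S : Equations) {M : Set Space} (G : LocalGroup M) : Prop :=
  ∀ t, S.InvariantUnder (G.map t) {z | (t, z) ∈ G.dom}

/-! ### Vector fields and the infinitesimal criterion -/

section Prolongation

/-- A vector field `X = ξ^μ ∂_{x^μ} + η ∂_w + φ ∂_Φ` has value `X z = (ξ z, η z, φ z)`.
This is `ξ^μ` along the section `(w, Φ)`. -/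
def xiAlong (X : Space → Space) (w Φ : Plane → ℝ) (μ : Fin 2) (x : Plane) : ℝ :=
  (X (x, w x, Φ x)).1 μ

/-- The coefficient `η^J = D_J(η - ξ^μ w_{,μ}) + ξ^μ w_{,Jμ}` of `∂/∂w_{,J}` in the prolongation
of `X`, evaluated on the jet of `(w, Φ)` at `x`. -/
def prW (X : Space → Space) (w Φ : Plane → ℝ) (x : Plane) (J : List (Fin 2)) : ℝ :=
  pdL J (fun y => (X (y, w y, Φ y)).2.1 - ∑ μ, xiAlong X w Φ μ y * pd μ w y) x
    + ∑ μ, xiAlong X w Φ μ x * pdL J (pd μ w) x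

/-- The coefficient `φ^J = D_J(φ - ξ^μ Φ_{,μ}) + ξ^μ Φ_{,Jμ}` of `∂/∂Φ_{,J}` in the prolongation
of `X`, evaluated on the jet of `(w, Φ)` at `x`. -/
def prΦ (X : Space → Space) (w Φ : Plane → ℝ) (x : Plane) (J : List (Fin 2)) : ℝ :=
  pdL J (fun y => (X (y, w y, Φ y)).2.2 - ∑ μ, xiAlong X w Φ μ y * pd μ Φ y) x
    + ∑ μ, xiAlong X w Φ μ x * pdL J (pd μ Φ) x

/-- `ξ^λ b_{αβ,λ}` along the section `(w, Φ)`. -/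
def Equations.xib (S : Equations) (X : Space → Space) (w Φ : Plane → ℝ) (x : Plane)
    (α β : Fin 2) : ℝ :=
  ∑ l, xiAlong X w Φ l x * pd l (fun y => S.b y α β) x

/-- The fourth prolongation of `X` applied to the first equation, on the jet of `(w, Φ)`. -/
def Equations.prEq1 (S : Equations) (X : Space → Space) (w Φ : Plane → ℝ) (x : Plane) : ℝ :=
  S.D * deltaContr (prW X w Φ x)
    - (altContr (fun α β => prW X w Φ x [α, β]) (hess Φ x)
        + altContr (hess w x) (fun μ ν => prΦ X w Φ x [μ, ν]))
    - (altContr (S.xib X w Φ x) (hess Φ x)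
        + altContr (S.b x) (fun μ ν => prΦ X w Φ x [μ, ν]))
    - ∑ l, xiAlong X w Φ l x * pd l S.p x

/-- The fourth prolongation of `X` applied to the second equation, on the jet of `(w, Φ)`. -/
def Equations.prEq2 (S : Equations) (X : Space → Space) (w Φ : Plane → ℝ) (x : Plane) : ℝ :=
  1 / (S.E * S.h) * deltaContr (prΦ X w Φ x)
    + 1 / 2 * (altContr (fun α β => prW X w Φ x [α, β]) (hess w x)
        + altContr (hess w x) (fun μ ν => prW X w Φ x [μ, ν]))
    + (altContr (S.xib X w Φ x) (hess w x)
        + altContr (S.b x) (fun μ ν => prW X w Φ x [μ, ν]))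

end Prolongation

/-- The infinitesimal criterion of invariance: on `M`, the prolongation of `X` annihilates the
system at every jet that satisfies the system. -/
def Equations.AdmitsField (S : Equations) (X : Space → Space) (M : Set Space) : Prop :=
  ∀ (x : Plane) (w Φ : Plane → ℝ), (x, w x, Φ x) ∈ M →
    ContDiffAt ℝ ∞ w x → ContDiffAt ℝ ∞ Φ x → S.SatisfiedAt w Φ x →
    S.prEq1 X w Φ x = 0 ∧ S.prEq2 X w Φ x = 0

/-- The system of determining equations in its explicit form, on `Ω`. -/
structure Equations.DeterminingSystem (S : Equations) (Ω : Set Plane)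
    (ξ : Fin 2 → Plane → ℝ) (η φ : Plane → ℝ) : Prop where
  xi : ∃ C₁ C₂ C₃ C₄ : ℝ, ∀ x ∈ Ω,
    ξ 0 x = C₁ * x 0 + C₂ * x 1 + C₃ ∧ ξ 1 x = -C₂ * x 0 + C₁ * x 1 + C₄
  eta : ContDiffOn ℝ ∞ η Ω
  phi : ∃ B₁ B₂ B₃ : ℝ, ∀ x ∈ Ω, φ x = B₁ * x 0 + B₂ * x 1 + B₃
  curvature : ∀ x ∈ Ω, ∀ α β : Fin 2,
    ∑ μ, (S.b x α μ * pd β (ξ μ) x + S.b x β μ * pd α (ξ μ) x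
      + ξ μ x * pd μ (fun y => S.b y α β) x) = -hess η x α β
  compat : ∀ x ∈ Ω, altContr (S.b x) (hess η x) = 0
  load : ∀ x ∈ Ω, S.D * deltaContr (fun J => pdL J η x)
    = 2 * S.p x * ∑ μ, pd μ (ξ μ) x + ∑ μ, ξ μ x * pd μ S.p x

/-! ### The kernel -/

/-- The vector fields `∂_w, x¹∂_w, x²∂_w, ∂_Φ, x¹∂_Φ, x²∂_Φ`. -/
def kernelField : Fin 6 → Space → Space :=
  ![fun _ => (0, 1, 0), fun z => (0, z.1 0, 0), fun z => (0, z.1 1, 0),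
    fun _ => (0, 0, 1), fun z => (0, 0, z.1 0), fun z => (0, 0, z.1 1)]

/-- `L₀`: all linear combinations of the six fields. -/
def kernelAlgebra : Submodule ℝ (Space → Space) := Submodule.span ℝ (range kernelField)

/-- `T` is the transformation at parameter value `1` of the flow of `X`. -/
def IsTimeOneMap (X : Space → Space) (T : Space → Space) : Prop :=
  ∀ z, ∃ γ : ℝ → Space, γ 0 = z ∧ (∀ t, HasDerivAt γ (X (γ t)) t) ∧ γ 1 = T z

/-- `G₀`: the group of transformations of `ℝ⁴` generated by the vector fields in `L₀`. -/
def kernelGroup : Subgroup (Equiv.Perm Space) :=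
  Subgroup.closure {T | ∃ X ∈ kernelAlgebra, IsTimeOneMap X T}

/-- A local one-parameter group is contained in `G₀`: its generator is in `L₀`, and each of its
transformations is the restriction of a transformation in `G₀`. -/
def LocalGroup.InKernel {M : Set Space} (G : LocalGroup M) : Prop :=
  (∃ X ∈ kernelAlgebra, EqOn G.generator X M) ∧
    ∀ t, ∃ T ∈ kernelGroup, ∀ z, (t, z) ∈ G.dom → G.map t z = T z

end

end Marguerre

/-! The fields of `L₀` add affine functions of `x` to `w` and `Φ`. The system sees `w` and `Φ` only
through derivatives of order two and four, so everything generated by `L₀` is admitted whatever `f`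
and `p` are. The content is the converse for f = sin x¹ sin x². Below, [a, c] stands for `altContr a
c`, Δ² for the bilaplacian, and c for the dilation coefficient ξ^1_{,1}.

A group is first replaced by its generator: transporting a section by the flow and differentiating
the equations along the moving base point yields the infinitesimal criterion
(`LocalGroup.admitsOnSmooth_generator`). It is then split by the order of the derivatives in a jet.

Adding to an admissible jet terms of order three or four with zero bilaplacian keeps it admissible,
so the resulting change of the prolongation has zero bilaplacian part (`prCoeffVar_eq_zero`).
Quartic perturbations give the Cauchy–Riemann equations for ξ along every section. The gradients of
the section being arbitrary, ξ depends on x only. Cubic perturbations show that η and φ are affine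
in (w, Φ) with η_{w,α} = φ_{Φ,α} = c_{,α}, and that η_Φ and φ_w do not depend on x.

The rest is polynomial in second derivatives. In terms of U = w + f the square is completed: the
brackets of the two equations become [U, Φ] and ½[U, U] − ½[b, b]. Choosing the Hessians of U and Φ
freely and eliminating the fourth derivatives gives `Admissible.test_conditions`. Its quadratic part
forces η_w = η_Φ = φ_w = φ_Φ = 0 (`Admissible.vertical_eq_zero`); hence c is locally constant and ξ
has zero second derivatives. Its linear part says that η + ξ^μ f_{,μ} and φ have zero Hessian in x.
The constant term of the second equation, with Δ²φ = 0, leaves 2c[b, b] + ξ^μ[b_{,μ}, b] = 0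
(`Admissible.xi_condition`).

For the chosen surface [b, b] = −(cos 2x¹ + cos 2x²), so the condition reads ξ¹ sin 2x¹ + ξ² sin 2x²
= 2c(cos 2x¹ + cos 2x²). Repeated differentiation kills the rotation, then the dilation, then ξ
(`similarity_eq_zero`). The explicit determining equations imply the same relation. With ξ = 0, η
and φ are affine in x, so the generator lies in `L₀`; its integral curves are straight lines and the
group acts by elements of `G₀`. -/

namespace Marguerre

/-! ### Calculus of directional derivatives of germs. -/

section DirectionalDerivatives

variable {E F : Type*} [NormedAddCommGroup E] [NormedSpace ℝ E]
  [NormedAddCommGroup F] [NormedSpace ℝ F]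

/-- The directional derivative `∂_v F` of a scalar function. -/
noncomputable def dd (v : E) (F : E → ℝ) : E → ℝ := fun z => fderiv ℝ F z v

/-- Smoothness at a point. -/
abbrev SmoothAt (F : E → ℝ) (z : E) : Prop := ContDiffAt ℝ ∞ F z

lemma SmoothAt.eventually_contDiffAt {F : E → ℝ} {z : E} (hF : SmoothAt F z) (n : ℕ) :
    ∀ᶠ y in 𝓝 z, ContDiffAt ℝ n F y :=
  (hF.of_le (by exact_mod_cast le_top)).eventually (by simp)

lemma SmoothAt.differentiableAt {F : E → ℝ} {z : E} (hF : SmoothAt F z) :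
    DifferentiableAt ℝ F z :=
  ContDiffAt.differentiableAt hF (by simp)

lemma SmoothAt.eventually_differentiableAt {F : E → ℝ} {z : E} (hF : SmoothAt F z) :
    ∀ᶠ y in 𝓝 z, DifferentiableAt ℝ F y :=
  (hF.eventually_contDiffAt 1).mono fun _ h => h.differentiableAt (by simp)

lemma SmoothAt.dd {F : E → ℝ} {z : E} (hF : SmoothAt F z) (v : E) : SmoothAt (dd v F) z :=
  (ContDiffAt.fderiv_right hF (m := ∞) (by simp)).clm_apply contDiffAt_const

lemma dd_congr {F G : E → ℝ} {z : E} (h : F =ᶠ[𝓝 z] G) (v : E) : dd v F =ᶠ[𝓝 z] dd v G :=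
  (h.fderiv (𝕜 := ℝ)).mono fun y hy => by simp [dd, hy]

/-- The rules of calculus are stated as equalities near `z`, not only at `z`, so that they can be
differentiated again. -/
lemma dd_add {F G : E → ℝ} {z : E} (hF : SmoothAt F z) (hG : SmoothAt G z) (v : E) :
    dd v (fun y => F y + G y) =ᶠ[𝓝 z] fun y => dd v F y + dd v G y := by
  filter_upwards [hF.eventually_differentiableAt, hG.eventually_differentiableAt] with y h1 h2
  simp [dd, fderiv_fun_add h1 h2]

lemma dd_sub {F G : E → ℝ} {z : E} (hF : SmoothAt F z) (hG : SmoothAt G z) (v : E) :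
    dd v (fun y => F y - G y) =ᶠ[𝓝 z] fun y => dd v F y - dd v G y := by
  filter_upwards [hF.eventually_differentiableAt, hG.eventually_differentiableAt] with y h1 h2
  simp [dd, fderiv_fun_sub h1 h2]

lemma dd_mul {F G : E → ℝ} {z : E} (hF : SmoothAt F z) (hG : SmoothAt G z) (v : E) :
    dd v (fun y => F y * G y) =ᶠ[𝓝 z] fun y => dd v F y * G y + F y * dd v G y := by
  filter_upwards [hF.eventually_differentiableAt, hG.eventually_differentiableAt] with y h1 h2
  simp [dd, fderiv_fun_mul h1 h2]
  ring

lemma dd_const (c : ℝ) (v : E) : dd v (fun _ : E => c) = fun _ => 0 := by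
  ext y; simp [dd]

lemma dd_const_mul (c : ℝ) {F : E → ℝ} {z : E} (hF : SmoothAt F z) (v : E) :
    dd v (fun y => c * F y) =ᶠ[𝓝 z] fun y => c * dd v F y := by
  filter_upwards [hF.eventually_differentiableAt] with y h1
  simp [dd, fderiv_const_mul h1]

lemma dd_comm {F : E → ℝ} {z : E} (hF : SmoothAt F z) (u v : E) :
    dd u (dd v F) =ᶠ[𝓝 z] dd v (dd u F) := by
  filter_upwards [hF.eventually_contDiffAt 2] with y hy
  have hs := ContDiffAt.isSymmSndFDerivAt hy (by simp)
  have hd : DifferentiableAt ℝ (fderiv ℝ F) y :=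
    (hy.fderiv_right (m := 1) (by norm_num)).differentiableAt (by simp)
  have key : ∀ a b : E, dd a (dd b F) y = fderiv ℝ (fderiv ℝ F) y a b := fun a b => by
    unfold dd
    rw [fderiv_clm_apply hd (differentiableAt_const b)]
    simp
  rw [key, key]
  exact hs u v

/-- Iterated directional derivatives. -/
noncomputable def ddL : List E → (E → ℝ) → (E → ℝ)
  | [], F => F
  | v :: J, F => dd v (ddL J F)

lemma SmoothAt.ddL {F : E → ℝ} {z : E} (hF : SmoothAt F z) : ∀ J : List E, SmoothAt (ddL J F) z
  | [] => hF
  | v :: J => (SmoothAt.ddL hF J).dd v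

lemma ddL_congr {F G : E → ℝ} {z : E} (h : F =ᶠ[𝓝 z] G) :
    ∀ J : List E, ddL J F =ᶠ[𝓝 z] ddL J G
  | [] => h
  | v :: J => dd_congr (ddL_congr h J) v

lemma ddL_dd {F : E → ℝ} {z : E} (hF : SmoothAt F z) (v : E) :
    ∀ J : List E, ddL J (dd v F) =ᶠ[𝓝 z] dd v (ddL J F)
  | [] => EventuallyEq.rfl
  | u :: J => (dd_congr (ddL_dd hF v J) u).trans (dd_comm (hF.ddL J) u v)

lemma ddL_add {F G : E → ℝ} {z : E} (hF : SmoothAt F z) (hG : SmoothAt G z) :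
    ∀ J : List E, ddL J (fun y => F y + G y) =ᶠ[𝓝 z] fun y => ddL J F y + ddL J G y
  | [] => EventuallyEq.rfl
  | v :: J => (dd_congr (ddL_add hF hG J) v).trans (dd_add (hF.ddL J) (hG.ddL J) v)

lemma ddL_sub {F G : E → ℝ} {z : E} (hF : SmoothAt F z) (hG : SmoothAt G z) :
    ∀ J : List E, ddL J (fun y => F y - G y) =ᶠ[𝓝 z] fun y => ddL J F y - ddL J G y
  | [] => EventuallyEq.rfl
  | v :: J => (dd_congr (ddL_sub hF hG J) v).trans (dd_sub (hF.ddL J) (hG.ddL J) v)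

lemma ddL_const_mul (c : ℝ) {F : E → ℝ} {z : E} (hF : SmoothAt F z) :
    ∀ J : List E, ddL J (fun y => c * F y) =ᶠ[𝓝 z] fun y => c * ddL J F y
  | [] => EventuallyEq.rfl
  | v :: J => (dd_congr (ddL_const_mul c hF J) v).trans (dd_const_mul c (hF.ddL J) v)

end DirectionalDerivatives

/-- The coordinate directions of the plane. -/
noncomputable abbrev ex (α : Fin 2) : Plane := Pi.single α 1

lemma pd_eq_dd (α : Fin 2) (g : Plane → ℝ) : pd α g = dd (ex α) g := rfl

lemma pdL_eq_ddL (g : Plane → ℝ) : ∀ J, pdL J g = ddL (J.map ex) g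
  | [] => rfl
  | α :: J => by simp only [pdL, List.map_cons, ddL, pdL_eq_ddL g J, pd_eq_dd]

/-! ### Partial derivatives in the plane and Leibniz rules. -/

section Plane

variable {g k : Plane → ℝ} {x : Plane}

lemma SmoothAt.pd (hg : SmoothAt g x) (α : Fin 2) : SmoothAt (pd α g) x := hg.dd _

lemma SmoothAt.pdL (hg : SmoothAt g x) (J : List (Fin 2)) : SmoothAt (pdL J g) x := by
  rw [pdL_eq_ddL]; exact hg.ddL _

lemma pd_congr (h : g =ᶠ[𝓝 x] k) (α : Fin 2) : pd α g =ᶠ[𝓝 x] pd α k := dd_congr h _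

lemma pdL_congr (h : g =ᶠ[𝓝 x] k) (J : List (Fin 2)) : pdL J g =ᶠ[𝓝 x] pdL J k := by
  simp only [pdL_eq_ddL]; exact ddL_congr h _

lemma pdL_add (hg : SmoothAt g x) (hk : SmoothAt k x) (J : List (Fin 2)) :
    pdL J (fun y => g y + k y) =ᶠ[𝓝 x] fun y => pdL J g y + pdL J k y := by
  simp only [pdL_eq_ddL]; exact ddL_add hg hk _

lemma pdL_sub (hg : SmoothAt g x) (hk : SmoothAt k x) (J : List (Fin 2)) :
    pdL J (fun y => g y - k y) =ᶠ[𝓝 x] fun y => pdL J g y - pdL J k y := by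
  simp only [pdL_eq_ddL]; exact ddL_sub hg hk _

lemma pdL_const_mul (c : ℝ) (hg : SmoothAt g x) (J : List (Fin 2)) :
    pdL J (fun y => c * g y) =ᶠ[𝓝 x] fun y => c * pdL J g y := by
  simp only [pdL_eq_ddL]; exact ddL_const_mul c hg _

lemma pd_pdL (hg : SmoothAt g x) (α : Fin 2) (J : List (Fin 2)) :
    pdL J (pd α g) =ᶠ[𝓝 x] pd α (pdL J g) := by
  simp only [pdL_eq_ddL, pd_eq_dd]; exact ddL_dd hg _ _

lemma pdL_append (I J : List (Fin 2)) (g : Plane → ℝ) : pdL (I ++ J) g = pdL I (pdL J g) := by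
  induction I with
  | nil => rfl
  | cons α I ih => simp [pdL, ih]

lemma pd_const (c : ℝ) (α : Fin 2) : pd α (fun _ => c) = fun _ => 0 := dd_const c _

lemma pdL_mul_two (hg : SmoothAt g x) (hk : SmoothAt k x) (a b : Fin 2) :
    pdL [a, b] (fun y => g y * k y) =ᶠ[𝓝 x] fun y =>
      (pdL [a, b] g y * k y + pdL [b] g y * pdL [a] k y) +
      (pdL [a] g y * pdL [b] k y + g y * pdL [a, b] k y) := by
  refine (pd_congr (dd_mul hg hk (ex b)) a).trans ?_
  refine (dd_add ((hg.pd b).mul hk) (hg.mul (hk.pd b)) _).trans ?_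
  exact (dd_mul (hg.pd b) hk (ex a)).add (dd_mul hg (hk.pd b) (ex a))

/-- The Leibniz rule for `∂_a ∂_a ∂_b ∂_b`. -/
lemma pdL_mul_four (hg : SmoothAt g x) (hk : SmoothAt k x) (a b : Fin 2) :
    pdL [a, a, b, b] (fun y => g y * k y) x =
      pdL [a, a, b, b] g x * k x + 2 * (pdL [a, b, b] g x * pdL [a] k x)
        + pdL [b, b] g x * pdL [a, a] k x
      + 2 * (pdL [a, a, b] g x * pdL [b] k x + 2 * (pdL [a, b] g x * pdL [a, b] k x)
        + pdL [b] g x * pdL [a, a, b] k x)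
      + (pdL [a, a] g x * pdL [b, b] k x + 2 * (pdL [a] g x * pdL [a, b, b] k x)
        + g x * pdL [a, a, b, b] k x) := by
  have h1 := pdL_congr (pdL_mul_two hg hk b b) [a, a]
  rw [← pdL_append] at h1
  have s1 := (hg.pdL [b, b]).mul hk
  have s2 := (hg.pdL [b]).mul (hk.pdL [b])
  have s3 := hg.mul (hk.pdL [b, b])
  have h2 := (pdL_add (s1.add s2) (s2.add s3) [a, a]).trans
    ((pdL_add s1 s2 [a, a]).add (pdL_add s2 s3 [a, a]))
  have e1 := (pdL_mul_two (hg.pdL [b, b]) hk a a).eq_of_nhds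
  have e2 := (pdL_mul_two (hg.pdL [b]) (hk.pdL [b]) a a).eq_of_nhds
  have e3 := (pdL_mul_two hg (hk.pdL [b, b]) a a).eq_of_nhds
  have h3 := (h1.trans h2).eq_of_nhds
  simp only [Pi.add_apply] at h3
  simp only [← pdL_append, List.cons_append, List.nil_append] at h3 e1 e2 e3
  linear_combination h3 + e1 + 2 * e2 + e3

end Plane

/-! ### Vanishing order -/

/-- The smooth function `g` vanishes to order `n` at `x`. -/
def Flat (x : Plane) : ℕ → (Plane → ℝ) → Prop
  | 0, g => SmoothAt g x
  | n + 1, g => SmoothAt g x ∧ g x = 0 ∧ ∀ α, Flat x n (pd α g)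

namespace Flat

variable {x : Plane} {g k : Plane → ℝ} {m n : ℕ}

lemma smoothAt : ∀ {n : ℕ} {g : Plane → ℝ}, Flat x n g → SmoothAt g x
  | 0, _, h => h
  | _ + 1, _, h => h.1

lemma apply_eq (h : Flat x (n + 1) g) : g x = 0 := h.2.1

lemma pd (h : Flat x (n + 1) g) (α : Fin 2) : Flat x n (pd α g) := h.2.2 α

lemma of_succ : ∀ {n : ℕ} {g : Plane → ℝ}, Flat x (n + 1) g → Flat x n g
  | 0, _, h => h.1
  | _ + 1, _, h => ⟨h.1, h.2.1, fun α => of_succ (h.2.2 α)⟩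

lemma mono (h : Flat x n g) (hmn : m ≤ n) : Flat x m g := by
  induction hmn with
  | refl => exact h
  | step _ ih => exact ih h.of_succ

lemma congr (h : Flat x n g) (e : k =ᶠ[𝓝 x] g) : Flat x n k := by
  induction n generalizing g k with
  | zero => exact ContDiffAt.congr_of_eventuallyEq h e
  | succ n ih =>
    exact ⟨h.1.congr_of_eventuallyEq e, e.eq_of_nhds.trans h.2.1,
      fun α => ih (h.2.2 α) (pd_congr e α)⟩

lemma add (hg : Flat x n g) (hk : Flat x n k) : Flat x n (fun y => g y + k y) := by
  induction n generalizing g k with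
  | zero => exact ContDiffAt.add hg hk
  | succ n ih =>
    exact ⟨hg.1.add hk.1, by simp [hg.2.1, hk.2.1],
      fun α => (ih (hg.2.2 α) (hk.2.2 α)).congr (dd_add hg.1 hk.1 _)⟩

/-- Each differentiation costs one order in one factor only. A factor of order zero loses nothing,
since its derivative is again smooth; this is why the induction runs on `N` and not on `m + n`. -/
lemma mul_of_le {N : ℕ} (hN : N ≤ m + n) (hg : Flat x m g) (hk : Flat x n k) :
    Flat x N (fun y => g y * k y) := by
  induction N generalizing g k m n with
  | zero => exact ContDiffAt.mul hg.smoothAt hk.smoothAt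
  | succ N ih =>
    refine ⟨hg.smoothAt.mul hk.smoothAt, ?_, fun α => ?_⟩
    · rcases m with _ | m
      · rcases n with _ | n
        · omega
        · simp [hk.apply_eq]
      · simp [hg.apply_eq]
    · refine Flat.congr (Flat.add (g := fun y => Marguerre.pd α g y * k y)
        (k := fun y => g y * Marguerre.pd α k y) ?_ ?_) (dd_mul hg.smoothAt hk.smoothAt _)
      · rcases m with _ | m
        · exact ih (m := 0) (n := n) (by omega) (hg.smoothAt.pd α) hk
        · exact ih (by omega) (hg.pd α) hk
      · rcases n with _ | n
        · exact ih (m := m) (n := 0) (by omega) hg (hk.smoothAt.pd α)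
        · exact ih (by omega) hg (hk.pd α)

lemma mul (hg : Flat x m g) (hk : Flat x n k) : Flat x (m + n) (fun y => g y * k y) :=
  mul_of_le le_rfl hg hk

lemma mul_smoothAt (hg : Flat x m g) (hk : SmoothAt k x) : Flat x m (fun y => g y * k y) :=
  mul_of_le (n := 0) le_rfl hg hk

lemma smoothAt_mul (hg : SmoothAt g x) (hk : Flat x n k) : Flat x n (fun y => g y * k y) :=
  mul_of_le (m := 0) (by omega) hg hk

lemma pdL_eq_zero (h : Flat x n g) (J : List (Fin 2)) (hJ : J.length < n) : pdL J g x = 0 := by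
  have key : ∀ (J : List (Fin 2)) (n : ℕ), Flat x (n + J.length) g → Flat x n (pdL J g) := by
    intro J
    induction J with
    | nil => intro n h; exact h
    | cons α J ih =>
      intro n h
      exact (ih (n + 1) (by convert h using 1; simp; ring)).pd α
  exact (key J 1 (h.mono (by omega))).apply_eq

end Flat

/-! ### Functions along a section -/

/-- The section `x ↦ (x, w x, Φ x)`. -/
def sec (w Φ : Plane → ℝ) (x : Plane) : Space := (x, w x, Φ x)

/-- The direction `∂_{x^α}` in `ℝ⁴`. -/
noncomputable abbrev eX (α : Fin 2) : Space := (Pi.single α 1, 0, 0)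

/-- The direction `∂_w`. -/
abbrev eW : Space := (0, 1, 0)

/-- The direction `∂_Φ`. -/
abbrev eP : Space := (0, 0, 1)

lemma contDiffAt_sec {w Φ : Plane → ℝ} {x : Plane} (hw : SmoothAt w x) (hΦ : SmoothAt Φ x) :
    ContDiffAt ℝ ∞ (sec w Φ) x :=
  contDiffAt_id.prodMk (ContDiffAt.prodMk hw hΦ)

lemma SmoothAt.sec {F : Space → ℝ} {w Φ : Plane → ℝ} {x : Plane} (hF : SmoothAt F (sec w Φ x))
    (hw : SmoothAt w x) (hΦ : SmoothAt Φ x) : SmoothAt (fun y => F (sec w Φ y)) x :=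
  ContDiffAt.comp x hF (contDiffAt_sec hw hΦ)

lemma eventually_sec {w Φ : Plane → ℝ} {x : Plane} (hw : SmoothAt w x) (hΦ : SmoothAt Φ x)
    {p : Space → Prop} (hp : ∀ᶠ z in 𝓝 (sec w Φ x), p z) : ∀ᶠ y in 𝓝 x, p (sec w Φ y) :=
  (contDiffAt_sec hw hΦ).continuousAt.eventually hp

/-- The total derivative `D_α F = F_{,α} + w_{,α} F_w + Φ_{,α} F_Φ`. -/
lemma pd_sec {F : Space → ℝ} {w Φ : Plane → ℝ} {x : Plane} (hF : SmoothAt F (sec w Φ x))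
    (hw : SmoothAt w x) (hΦ : SmoothAt Φ x) (α : Fin 2) :
    pd α (fun y => F (sec w Φ y)) =ᶠ[𝓝 x] fun y =>
      dd (eX α) F (sec w Φ y) + pd α w y * dd eW F (sec w Φ y)
        + pd α Φ y * dd eP F (sec w Φ y) := by
  filter_upwards [hw.eventually_differentiableAt, hΦ.eventually_differentiableAt,
    eventually_sec hw hΦ hF.eventually_differentiableAt] with y h1 h2 h3
  have hs : HasFDerivAt (sec w Φ)
      ((ContinuousLinearMap.id ℝ Plane).prod ((fderiv ℝ w y).prod (fderiv ℝ Φ y))) y :=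
    (hasFDerivAt_id y).prodMk (h1.hasFDerivAt.prodMk h2.hasFDerivAt)
  have hc : HasFDerivAt (fun y => F (sec w Φ y)) _ y := h3.hasFDerivAt.comp y hs
  have hv : ∀ v : Plane, ∀ a b : ℝ, ((v, a, b) : Space) = (v, 0, 0) + (a • eW + b • eP) := by
    intro v a b; simp
  simp only [pd, hc.fderiv, dd, ContinuousLinearMap.comp_apply, ContinuousLinearMap.prod_apply,
    ContinuousLinearMap.id_apply]
  rw [hv, map_add, map_add, map_smul, map_smul]
  simp only [smul_eq_mul]
  ring

section Perturbation

variable {x : Plane} {w Φ u : Plane → ℝ} {a b : ℝ} {n : ℕ}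

lemma sec_add_eq (hu : u x = 0) :
    sec (fun y => w y + a * u y) (fun y => Φ y + b * u y) x = sec w Φ x := by
  simp [sec, hu]

/-- Perturbing a section by a function that vanishes to order `n` changes functions along it
to order `n`. -/
lemma flat_sec_sub (hw : SmoothAt w x) (hΦ : SmoothAt Φ x) (hu : Flat x n u) (hux : u x = 0)
    {F : Space → ℝ} (hF : SmoothAt F (sec w Φ x)) :
    Flat x n (fun y => F (sec (fun y => w y + a * u y) (fun y => Φ y + b * u y) y)
      - F (sec w Φ y)) := by
  have hu0 := hu.smoothAt
  have hw' : SmoothAt (fun y => w y + a * u y) x := hw.add (contDiffAt_const.mul hu0)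
  have hΦ' : SmoothAt (fun y => Φ y + b * u y) x := hΦ.add (contDiffAt_const.mul hu0)
  induction n generalizing F with
  | zero =>
    refine ContDiffAt.sub (SmoothAt.sec ?_ hw' hΦ') (hF.sec hw hΦ)
    rwa [sec_add_eq hux]
  | succ n ih =>
    have hF' := hF
    rw [← sec_add_eq (a := a) (b := b) hux] at hF'
    refine ⟨(hF'.sec hw' hΦ').sub (hF.sec hw hΦ), by simp only [sec_add_eq hux, sub_self], fun α => ?_⟩
    have h1 := pd_sec hF' hw' hΦ' α
    have h2 := pd_sec hF hw hΦ α
    have ha : pd α (fun y => w y + a * u y) =ᶠ[𝓝 x] fun y => pd α w y + a * pd α u y :=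
      (dd_add hw (contDiffAt_const.mul hu0) _).trans
        (EventuallyEq.rfl.add (dd_const_mul a hu0 _))
    have hb : pd α (fun y => Φ y + b * u y) =ᶠ[𝓝 x] fun y => pd α Φ y + b * pd α u y :=
      (dd_add hΦ (contDiffAt_const.mul hu0) _).trans
        (EventuallyEq.rfl.add (dd_const_mul b hu0 _))
    have ih' := fun {F : Space → ℝ} (hF : SmoothAt F (sec w Φ x)) => ih hu.of_succ hF
    -- By the chain rule the derivative of the difference consists of differences of derivatives of
    -- `F` along the two sections, and one further term with the factor `∂_α u`, which vanishes to
    -- order `n`.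
    have key := ((ih' (hF.dd (eX α))).add (Flat.smoothAt_mul (hw.pd α) (ih' (hF.dd eW)))).add
      ((Flat.smoothAt_mul (hΦ.pd α) (ih' (hF.dd eP))).add
        (Flat.mul_smoothAt (hu.pd α) (k := fun y =>
          a * dd eW F (sec (fun y => w y + a * u y) (fun y => Φ y + b * u y) y)
          + b * dd eP F (sec (fun y => w y + a * u y) (fun y => Φ y + b * u y) y))
          ((contDiffAt_const.mul ((hF'.dd eW).sec hw' hΦ')).add
            (contDiffAt_const.mul ((hF'.dd eP).sec hw' hΦ')))))
    refine key.congr ((dd_sub (hF'.sec hw' hΦ') (hF.sec hw hΦ) (ex α)).trans ?_)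
    filter_upwards [h1, h2, ha, hb] with y h1 h2 ha hb
    rw [pd_eq_dd] at h1 h2
    rw [h1, h2, ha, hb]
    ring

/-- First-order Taylor expansion along a section. -/
lemma flat_sec_taylor (hw : SmoothAt w x) (hΦ : SmoothAt Φ x) (hu : Flat x (n + 1) u)
    {F : Space → ℝ} (hF : SmoothAt F (sec w Φ x)) {N : ℕ} (hN : N ≤ 2 * (n + 1)) :
    Flat x N (fun y => F (sec (fun y => w y + a * u y) (fun y => Φ y + b * u y) y)
      - F (sec w Φ y) - u y * (a * dd eW F (sec w Φ y) + b * dd eP F (sec w Φ y))) := by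
  have hu0 := hu.smoothAt
  have hux := hu.apply_eq
  have hw' : SmoothAt (fun y => w y + a * u y) x := hw.add (contDiffAt_const.mul hu0)
  have hΦ' : SmoothAt (fun y => Φ y + b * u y) x := hΦ.add (contDiffAt_const.mul hu0)
  have hE : ∀ {F : Space → ℝ}, SmoothAt F (sec w Φ x) →
      SmoothAt (fun y => F (sec (fun y => w y + a * u y) (fun y => Φ y + b * u y) y)
      - F (sec w Φ y) - u y * (a * dd eW F (sec w Φ y) + b * dd eP F (sec w Φ y))) x := by
    intro F hF
    refine ((SmoothAt.sec ?_ hw' hΦ').sub (hF.sec hw hΦ)).sub (hu0.mul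
      ((contDiffAt_const.mul ((hF.dd eW).sec hw hΦ)).add
        (contDiffAt_const.mul ((hF.dd eP).sec hw hΦ))))
    rwa [sec_add_eq hux]
  induction N generalizing F with
  | zero => exact hE hF
  | succ N ih =>
    have hF' := hF
    rw [← sec_add_eq (a := a) (b := b) hux] at hF'
    refine ⟨hE hF, by simp only [sec_add_eq hux, hux]; ring, fun α => ?_⟩
    have h1 := pd_sec hF' hw' hΦ' α
    have h2 := pd_sec hF hw hΦ α
    have ha : pd α (fun y => w y + a * u y) =ᶠ[𝓝 x] fun y => pd α w y + a * pd α u y :=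
      (dd_add hw (contDiffAt_const.mul hu0) _).trans
        (EventuallyEq.rfl.add (dd_const_mul a hu0 _))
    have hb : pd α (fun y => Φ y + b * u y) =ᶠ[𝓝 x] fun y => pd α Φ y + b * pd α u y :=
      (dd_add hΦ (contDiffAt_const.mul hu0) _).trans
        (EventuallyEq.rfl.add (dd_const_mul b hu0 _))
    have hWs := (hF.dd eW).sec hw hΦ
    have hPs := (hF.dd eP).sec hw hΦ
    have hds := (contDiffAt_const (c := a)).mul hWs |>.add ((contDiffAt_const (c := b)).mul hPs)
    have hd := (dd_mul hu0 hds (ex α)).trans (EventuallyEq.rfl.add (EventuallyEq.rfl.mul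
      ((dd_add (contDiffAt_const.mul hWs) (contDiffAt_const.mul hPs) (ex α)).trans
      ((dd_const_mul a hWs _).add (dd_const_mul b hPs _)))))
    have hWa := pd_sec (hF.dd eW) hw hΦ α
    have hPa := pd_sec (hF.dd eP) hw hΦ α
    have c1 := eventually_sec hw hΦ (dd_comm hF (eX α) eW)
    have c2 := eventually_sec hw hΦ (dd_comm hF (eX α) eP)
    have c3 := eventually_sec hw hΦ (dd_comm hF eW eP)
    have ih' := fun {F : Space → ℝ} (hF : SmoothAt F (sec w Φ x)) => ih hF (by omega)
    -- Differentiating the remainder reproduces remainders for the derivatives of `F`, plus `∂_α u`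
    -- (order `n`) times a difference along the two sections (order `n + 1`). The total order `2n +
    -- 1` suffices for `N`.
    have key := ((ih' (hF.dd (eX α))).add (Flat.smoothAt_mul (hw.pd α) (ih' (hF.dd eW)))).add
      ((Flat.smoothAt_mul (hΦ.pd α) (ih' (hF.dd eP))).add
        (Flat.mul_of_le (N := N) (by omega) (hu.pd α)
          ((Flat.smoothAt_mul (contDiffAt_const (c := a))
              (flat_sec_sub (a := a) (b := b) hw hΦ hu hux (hF.dd eW))).add
            (Flat.smoothAt_mul (contDiffAt_const (c := b))
              (flat_sec_sub (a := a) (b := b) hw hΦ hu hux (hF.dd eP))))))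
    refine key.congr ((dd_sub ((hF'.sec hw' hΦ').sub (hF.sec hw hΦ)) (hu0.mul hds) (ex α)).trans
      (((dd_sub (hF'.sec hw' hΦ') (hF.sec hw hΦ) (ex α)).sub hd).trans ?_))
    filter_upwards [h1, h2, ha, hb, hWa, hPa, c1, c2, c3] with y h1 h2 ha hb hWa hPa c1 c2 c3
    simp only [pd_eq_dd] at h1 h2 ha hb hWa hPa ⊢
    simp only [Pi.add_apply, Pi.mul_apply, Pi.sub_apply]
    rw [h1, h2, ha, hb, hWa, hPa, c1, c2, c3]
    ring

end Perturbation

/-! ### Polynomial test functions -/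

open MvPolynomial in
/-- The polynomial `P` in `y - x`, as a function of `y`. -/
noncomputable def ev (x : Plane) (P : MvPolynomial (Fin 2) ℝ) : Plane → ℝ :=
  fun y => eval (fun i => y i - x i) P

section Polynomials

open MvPolynomial

variable (x : Plane)

lemma contDiff_ev (P : MvPolynomial (Fin 2) ℝ) : ContDiff ℝ ∞ (ev x P) := by
  unfold ev
  induction P using MvPolynomial.induction_on with
  | C a => simpa using contDiff_const
  | add P Q hP hQ => simpa using hP.add hQ
  | mul_X P i hP => simpa using hP.mul ((contDiff_apply ℝ ℝ i).sub contDiff_const)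

lemma smoothAt_ev (P : MvPolynomial (Fin 2) ℝ) (y : Plane) : SmoothAt (ev x P) y :=
  (contDiff_ev x P).contDiffAt

@[simp] lemma pd_ev (P : MvPolynomial (Fin 2) ℝ) (α : Fin 2) :
    pd α (ev x P) = ev x (pderiv α P) := by
  ext y
  induction P using MvPolynomial.induction_on with
  | C a =>
    have e : ev x (C a) = fun _ => a := by ext; simp [ev]
    rw [e, pd_const]
    simp [ev]
  | add P Q hP hQ =>
    have h := (dd_add (smoothAt_ev x P y) (smoothAt_ev x Q y) (ex α)).eq_of_nhds
    have e : ev x (P + Q) = fun y => ev x P y + ev x Q y := by ext; simp [ev]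
    rw [pd_eq_dd, e, h, ← pd_eq_dd, ← pd_eq_dd, hP, hQ]
    simp [ev]
  | mul_X P i hP =>
    have h := (dd_mul (smoothAt_ev x P y) (smoothAt_ev x (X i) y) (ex α)).eq_of_nhds
    have e : ev x (P * X i) = fun y => ev x P y * ev x (X i) y := by ext; simp [ev]
    have hX : dd (ex α) (ev x (X i)) y = ev x (pderiv α (X i)) y := by
      have h1 : HasFDerivAt (fun y : Plane => y i - x i)
          (ContinuousLinearMap.proj (R := ℝ) (φ := fun _ : Fin 2 => ℝ) i) y :=
        (hasFDerivAt_apply i y).sub_const _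
      have h2 : ev x (X i) = fun y => y i - x i := by ext; simp [ev]
      rw [h2, dd, h1.fderiv]
      simp [ev, pderiv_X, Pi.single_apply, apply_ite]
    rw [pd_eq_dd, e, h, ← pd_eq_dd, hP, hX]
    simp [ev]
    ring

lemma flat_ev {P : MvPolynomial (Fin 2) ℝ} {n : ℕ} (hP : P.IsHomogeneous n) :
    Flat x n (ev x P) := by
  induction n generalizing P with
  | zero => exact smoothAt_ev x P x
  | succ n ih =>
    refine ⟨smoothAt_ev x P x, ?_, fun α => ?_⟩
    · have : coeff 0 P = 0 := hP.coeff_eq_zero (by simp)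
      rw [← constantCoeff_eq, ← MvPolynomial.eval_zero] at this
      simpa [ev] using this
    · rw [pd_ev]
      exact ih hP.pderiv

end Polynomials

/-! ### Perturbation of jets and of the prolongation -/

lemma deltaContr_eq (a : List (Fin 2) → ℝ) :
    deltaContr a = a [0, 0, 0, 0] + a [0, 0, 1, 1] + (a [1, 1, 0, 0] + a [1, 1, 1, 1]) := by
  simp [deltaContr, delta, Fin.sum_univ_two]

lemma altContr_eq (a c : Fin 2 → Fin 2 → ℝ) :
    altContr a c = a 0 0 * c 1 1 + a 1 1 * c 0 0 - a 0 1 * c 1 0 - a 1 0 * c 0 1 := by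
  simp [altContr, alt, Fin.sum_univ_two]
  ring

lemma pdL_add_const_mul {w u : Plane → ℝ} {x : Plane} (hw : SmoothAt w x) (hu : SmoothAt u x)
    (a : ℝ) (J : List (Fin 2)) :
    pdL J (fun y => w y + a * u y) x = pdL J w x + a * pdL J u x := by
  rw [(pdL_add hw (contDiffAt_const.mul hu) J).eq_of_nhds,
    (pdL_const_mul a hu J).eq_of_nhds]

lemma SmoothAt.add_const_mul {w u : Plane → ℝ} {x : Plane} (hw : SmoothAt w x)
    (hu : SmoothAt u x) (a : ℝ) : SmoothAt (fun y => w y + a * u y) x :=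
  hw.add (contDiffAt_const.mul hu)

section Perturbation

variable {x : Plane} {w Φ u : Plane → ℝ} (hw : SmoothAt w x) (hΦ : SmoothAt Φ x)
  (hu : Flat x 3 u) (a b : ℝ)

include hw hu in
lemma hess_perturb : hess (fun y => w y + a * u y) x = hess w x := by
  ext α β
  simp [hess, pdL_add_const_mul hw hu.smoothAt, hu.pdL_eq_zero [α, β] (by simp)]

-- The nonlinear terms involve second derivatives only, and these do not feel a perturbation of
-- order three; the fourth derivatives enter linearly.
include hw hΦ hu in
lemma Equations.eq1_perturb (S : Equations) :
    S.eq1 (fun y => w y + a * u y) (fun y => Φ y + b * u y) x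
      = S.eq1 w Φ x + S.D * a * deltaContr (fun J => pdL J u x) := by
  simp only [Equations.eq1, hess_perturb hw hu, hess_perturb hΦ hu,
    pdL_add_const_mul hw hu.smoothAt, deltaContr_eq]
  ring

include hw hΦ hu in
lemma Equations.eq2_perturb (S : Equations) :
    S.eq2 (fun y => w y + a * u y) (fun y => Φ y + b * u y) x
      = S.eq2 w Φ x + 1 / (S.E * S.h) * b * deltaContr (fun J => pdL J u x) := by
  simp only [Equations.eq2, hess_perturb hw hu,
    pdL_add_const_mul hΦ hu.smoothAt, deltaContr_eq]
  ring

/-- The coefficient of the prolongation of `ξ^μ ∂_{x^μ} + H ∂_v` in the direction `∂/∂v_{,J}`. -/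
noncomputable def prCoeff (H : Space → ℝ) (ξ : Fin 2 → Space → ℝ) (v w Φ : Plane → ℝ) (x : Plane)
    (J : List (Fin 2)) : ℝ :=
  pdL J (fun y => H (sec w Φ y) - ∑ μ, ξ μ (sec w Φ y) * pd μ v y) x
    + ∑ μ, ξ μ (sec w Φ x) * pdL J (pd μ v) x

/-- The derivative of the characteristic `H - ξ^μ v_{,μ}` along the direction `a ∂_w + b ∂_Φ`. -/
noncomputable def charDeriv (H : Space → ℝ) (ξ : Fin 2 → Space → ℝ) (v w Φ : Plane → ℝ) (a b : ℝ)
    (y : Plane) : ℝ :=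
  (a * dd eW H (sec w Φ y) + b * dd eP H (sec w Φ y))
    - ∑ μ, (a * dd eW (ξ μ) (sec w Φ y) + b * dd eP (ξ μ) (sec w Φ y)) * pd μ v y

/-- The change of `prCoeff` under a perturbation of the section. -/
noncomputable def prCoeffVar (H : Space → ℝ) (ξ : Fin 2 → Space → ℝ) (v w Φ u : Plane → ℝ)
    (a b k : ℝ) (x : Plane) (J : List (Fin 2)) : ℝ :=
  pdL J (fun y => u y * charDeriv H ξ v w Φ a b y) x
    - k * ∑ μ, (pdL J (fun y => ξ μ (sec w Φ y) * pd μ u y) x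
      - ξ μ (sec w Φ x) * pdL J (pd μ u) x)

variable {H : Space → ℝ} {ξ : Fin 2 → Space → ℝ} {v : Plane → ℝ}
  (hH : SmoothAt H (sec w Φ x)) (hξ : ∀ μ, SmoothAt (ξ μ) (sec w Φ x)) (hv : SmoothAt v x)

include hw hΦ hH hξ hv in
lemma smoothAt_charDeriv : SmoothAt (charDeriv H ξ v w Φ a b) x := by
  have h : ∀ {F : Space → ℝ}, SmoothAt F (sec w Φ x) →
      SmoothAt (fun y => a * dd eW F (sec w Φ y) + b * dd eP F (sec w Φ y)) x := fun hF =>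
    (contDiffAt_const.mul ((hF.dd eW).sec hw hΦ)).add
      (contDiffAt_const.mul ((hF.dd eP).sec hw hΦ))
  exact (h hH).sub (ContDiffAt.sum fun μ _ => (h (hξ μ)).mul (hv.pd μ))

-- The characteristic is expanded to first order in `u`. Everything beyond first order vanishes to
-- order five at `x`, hence is invisible to at most four derivatives.
include hw hΦ hu hH hξ hv in
lemma prCoeff_perturb (k : ℝ) (J : List (Fin 2)) (hJ : J.length ≤ 4) :
    prCoeff H ξ (fun y => v y + k * u y) (fun y => w y + a * u y) (fun y => Φ y + b * u y) x J
      = prCoeff H ξ v w Φ x J + prCoeffVar H ξ v w Φ u a b k x J := by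
  have hu0 := hu.smoothAt
  have hux := hu.apply_eq
  have hw' := hw.add_const_mul hu0 a
  have hΦ' := hΦ.add_const_mul hu0 b
  have hv' := hv.add_const_mul hu0 k
  have hz := sec_add_eq (w := w) (Φ := Φ) (a := a) (b := b) hux
  have hs : ∀ {F : Space → ℝ}, SmoothAt F (sec w Φ x) → SmoothAt (fun y =>
      F (sec (fun y => w y + a * u y) (fun y => Φ y + b * u y) y)) x := fun hF =>
    SmoothAt.sec (by rwa [hz]) hw' hΦ'
  have hpd : ∀ μ, pd μ (fun y => v y + k * u y) =ᶠ[𝓝 x] fun y => pd μ v y + k * pd μ u y :=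
    fun μ => (dd_add hv (contDiffAt_const.mul hu0) _).trans
        (EventuallyEq.rfl.add (dd_const_mul k hu0 _))
  -- A perturbation of order three leaves a Taylor remainder of order six, of which five are needed.
  have tay := fun {F : Space → ℝ} (hF : SmoothAt F (sec w Φ x)) =>
    flat_sec_taylor (a := a) (b := b) hw hΦ (n := 2) hu hF (N := 5) (by norm_num)
  have hdd := fun {F : Space → ℝ} (hF : SmoothAt F (sec w Φ x)) =>
    (contDiffAt_const (c := a)).mul ((hF.dd eW).sec hw hΦ) |>.add
      ((contDiffAt_const (c := b)).mul ((hF.dd eP).sec hw hΦ))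
  -- The part of `ξ^μ v_{,μ}` beyond first order: the Taylor remainder of `ξ^μ`, and the product `u
  -- · u_{,μ}`, of order 3 + 2.
  have hμ : ∀ μ, Flat x 5 (fun y =>
      (ξ μ (sec (fun y => w y + a * u y) (fun y => Φ y + b * u y) y) - ξ μ (sec w Φ y)
        - u y * (a * dd eW (ξ μ) (sec w Φ y) + b * dd eP (ξ μ) (sec w Φ y)))
          * (pd μ v y + k * pd μ u y)
      + (u y * pd μ u y) * (k * (a * dd eW (ξ μ) (sec w Φ y) + b * dd eP (ξ μ) (sec w Φ y)))) :=
    fun μ => ((tay (hξ μ)).mul_smoothAt ((hv.pd μ).add_const_mul (hu0.pd μ) k)).add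
      ((hu.mul (hu.pd μ)).mul_smoothAt (contDiffAt_const.mul (hdd (hξ μ))))
  have hflat := (tay hH).add (((hμ 0).add (hμ 1)).smoothAt_mul (contDiffAt_const (c := (-1 : ℝ))))
  obtain ⟨R, hRe, hR⟩ : ∃ R, _ = R ∧ Flat x 5 R := ⟨_, rfl, hflat⟩
  set A : Plane → ℝ := fun y => H (sec w Φ y) - ∑ μ, ξ μ (sec w Φ y) * pd μ v y with hA
  have hAs : SmoothAt A x :=
    (hH.sec hw hΦ).sub (ContDiffAt.sum fun μ _ => ((hξ μ).sec hw hΦ).mul (hv.pd μ))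
  have hB : SmoothAt (fun y => u y * charDeriv H ξ v w Φ a b y) x :=
    hu0.mul (smoothAt_charDeriv hw hΦ a b hH hξ hv)
  have hC : ∀ μ, SmoothAt (fun y => ξ μ (sec w Φ y) * pd μ u y) x := fun μ =>
    ((hξ μ).sec hw hΦ).mul (hu0.pd μ)
  have e : (fun y => H (sec (fun y => w y + a * u y) (fun y => Φ y + b * u y) y)
      - ∑ μ, ξ μ (sec (fun y => w y + a * u y) (fun y => Φ y + b * u y) y)
        * pd μ (fun y => v y + k * u y) y) =ᶠ[𝓝 x] fun y => (((A y +
        1 * (u y * charDeriv H ξ v w Φ a b y)) + (-k) * (ξ 0 (sec w Φ y) * pd 0 u y)) +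
        (-k) * (ξ 1 (sec w Φ y) * pd 1 u y)) + 1 * R y := by
    filter_upwards [hpd 0, hpd 1] with y h0 h1
    simp only [← hRe, hA, charDeriv, Fin.sum_univ_two, h0, h1]
    ring
  have s1 := hAs.add_const_mul hB 1
  have s2 := s1.add_const_mul (hC 0) (-k)
  have s3 := s2.add_const_mul (hC 1) (-k)
  have e' := (pdL_congr e J).eq_of_nhds
  rw [pdL_add_const_mul s3 hR.smoothAt, pdL_add_const_mul s2 (hC 1), pdL_add_const_mul s1 (hC 0),
    pdL_add_const_mul hAs hB, hR.pdL_eq_zero J (by omega)] at e'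
  have h2 : ∀ μ, pdL J (pd μ (fun y => v y + k * u y)) x
      = pdL J (pd μ v) x + k * pdL J (pd μ u) x := fun μ => by
    rw [(pdL_congr (hpd μ) J).eq_of_nhds, pdL_add_const_mul (hv.pd μ) (hu0.pd μ)]
  have hA' : prCoeff H ξ v w Φ x J
      = pdL J A x + ∑ μ, ξ μ (sec w Φ x) * pdL J (pd μ v) x := rfl
  rw [hA', prCoeff, prCoeffVar, e']
  simp only [hz, h2, Fin.sum_univ_two]
  ring

-- Two derivatives do not exhaust the order three of `u`, and the undifferentiated `ξ^μ` is
-- subtracted. So only the bilaplacian terms of the criterion change.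
include hw hΦ hu hH hξ hv in
lemma prCoeffVar_two (k : ℝ) (α β : Fin 2) : prCoeffVar H ξ v w Φ u a b k x [α, β] = 0 := by
  have h1 := (hu.mul_smoothAt (smoothAt_charDeriv hw hΦ a b hH hξ hv)).pdL_eq_zero [α, β]
    (by simp)
  have h2 : ∀ μ, pdL [α, β] (fun y => ξ μ (sec w Φ y) * pd μ u y) x
      = ξ μ (sec w Φ x) * pdL [α, β] (pd μ u) x := fun μ => by
    have h := fun J hJ => (hu.pd μ).pdL_eq_zero J hJ
    rw [(pdL_mul_two ((hξ μ).sec hw hΦ) (hu.smoothAt.pd μ) α β).eq_of_nhds,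
      h [α] (by simp), h [β] (by simp), (hu.pd μ).apply_eq]
    ring
  simp [prCoeffVar, h1, h2]

end Perturbation

section Admitted

variable {S : Equations} {X : Space → Space} {M : Set Space}

/-- The infinitesimal criterion, tested on globally smooth sections only. -/
def Equations.AdmitsOnSmooth (S : Equations) (X : Space → Space) (M : Set Space) : Prop :=
  ∀ (x : Plane) (w Φ : Plane → ℝ), ContDiff ℝ ∞ w → ContDiff ℝ ∞ Φ → sec w Φ x ∈ M →
    S.SatisfiedAt w Φ x → S.prEq1 X w Φ x = 0 ∧ S.prEq2 X w Φ x = 0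

lemma Equations.AdmitsField.admitsOnSmooth (h : S.AdmitsField X M) : S.AdmitsOnSmooth X M :=
  fun x w Φ hw hΦ hM hs => h x w Φ hM hw.contDiffAt hΦ.contDiffAt hs

/-- The component `ξ^μ` of a vector field. -/
def xiC (X : Space → Space) (μ : Fin 2) (z : Space) : ℝ := (X z).1 μ

/-- The component `η` of a vector field. -/
def etaC (X : Space → Space) (z : Space) : ℝ := (X z).2.1

/-- The component `φ` of a vector field. -/
def phiC (X : Space → Space) (z : Space) : ℝ := (X z).2.2

lemma prW_eq (w Φ : Plane → ℝ) (x : Plane) :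
    prW X w Φ x = prCoeff (etaC X) (xiC X) w w Φ x := rfl

lemma prΦ_eq (w Φ : Plane → ℝ) (x : Plane) :
    prΦ X w Φ x = prCoeff (phiC X) (xiC X) Φ w Φ x := rfl

lemma smoothAt_xiC {z : Space} (hX : ContDiffAt ℝ ∞ X z) (μ : Fin 2) : SmoothAt (xiC X μ) z :=
  contDiffAt_pi.1 (contDiffAt_fst.comp z hX) μ

lemma smoothAt_etaC {z : Space} (hX : ContDiffAt ℝ ∞ X z) : SmoothAt (etaC X) z :=
  contDiffAt_fst.comp z (contDiffAt_snd.comp z hX)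

lemma smoothAt_phiC {z : Space} (hX : ContDiffAt ℝ ∞ X z) : SmoothAt (phiC X) z :=
  contDiffAt_snd.comp z (contDiffAt_snd.comp z hX)

/-- Perturbing an admissible jet by terms of order three and higher isolates the part of the
infinitesimal criterion that is linear in the higher derivatives. -/
lemma prCoeffVar_eq_zero (hS : S.AdmitsOnSmooth X M) (hD : S.D ≠ 0) (hE : S.E * S.h ≠ 0)
    {x : Plane} {w Φ u : Plane → ℝ} (hw : ContDiff ℝ ∞ w) (hΦ : ContDiff ℝ ∞ Φ)
    (hz : sec w Φ x ∈ M) (hX : ContDiffAt ℝ ∞ X (sec w Φ x)) (hsat : S.SatisfiedAt w Φ x)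
    (hu : ContDiff ℝ ∞ u) (hu3 : Flat x 3 u) (hu4 : deltaContr (fun J => pdL J u x) = 0)
    (a b : ℝ) :
    deltaContr (prCoeffVar (etaC X) (xiC X) w w Φ u a b a x) = 0 ∧
      deltaContr (prCoeffVar (phiC X) (xiC X) Φ w Φ u a b b x) = 0 := by
  have hw0 : SmoothAt w x := hw.contDiffAt
  have hΦ0 : SmoothAt Φ x := hΦ.contDiffAt
  have hxi := smoothAt_xiC hX
  have heq := sec_add_eq (w := w) (Φ := Φ) (a := a) (b := b) hu3.apply_eq
  obtain ⟨h1, h2⟩ := hS x w Φ hw hΦ hz hsat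
  obtain ⟨h1', h2'⟩ := hS x (fun y => w y + a * u y) (fun y => Φ y + b * u y)
    (hw.add (contDiff_const.mul hu)) (hΦ.add (contDiff_const.mul hu)) (by rwa [heq])
    ⟨by rw [S.eq1_perturb hw0 hΦ0 hu3, hsat.1, hu4]; ring,
      by rw [S.eq2_perturb hw0 hΦ0 hu3, hsat.2, hu4]; ring⟩
  have hW : ∀ J : List (Fin 2), J.length ≤ 4 →
      prW X (fun y => w y + a * u y) (fun y => Φ y + b * u y) x J
        = prW X w Φ x J + prCoeffVar (etaC X) (xiC X) w w Φ u a b a x J := fun J hJ =>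
    prCoeff_perturb hw0 hΦ0 hu3 a b (smoothAt_etaC hX) hxi hw0 a J hJ
  have hP : ∀ J : List (Fin 2), J.length ≤ 4 →
      prΦ X (fun y => w y + a * u y) (fun y => Φ y + b * u y) x J
        = prΦ X w Φ x J + prCoeffVar (phiC X) (xiC X) Φ w Φ u a b b x J := fun J hJ =>
    prCoeff_perturb hw0 hΦ0 hu3 a b (smoothAt_phiC hX) hxi hΦ0 b J hJ
  have hW2 : ∀ α β, prW X (fun y => w y + a * u y) (fun y => Φ y + b * u y) x [α, β]
      = prW X w Φ x [α, β] := fun α β => by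
    rw [hW _ (by simp), prCoeffVar_two hw0 hΦ0 hu3 a b (smoothAt_etaC hX) hxi hw0 a, add_zero]
  have hP2 : ∀ α β, prΦ X (fun y => w y + a * u y) (fun y => Φ y + b * u y) x [α, β]
      = prΦ X w Φ x [α, β] := fun α β => by
    rw [hP _ (by simp), prCoeffVar_two hw0 hΦ0 hu3 a b (smoothAt_phiC hX) hxi hΦ0 b, add_zero]
  have hxa : ∀ μ, xiAlong X (fun y => w y + a * u y) (fun y => Φ y + b * u y) μ x
      = xiAlong X w Φ μ x := fun μ =>
    congrArg (fun z => (X z).1 μ) heq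
  have hxb : S.xib X (fun y => w y + a * u y) (fun y => Φ y + b * u y) x
      = S.xib X w Φ x := by
    ext α β
    simp only [Equations.xib, hxa]
  have hδ : ∀ c d e : List (Fin 2) → ℝ, (∀ J : List (Fin 2), J.length ≤ 4 → c J = d J + e J) →
      deltaContr c = deltaContr d + deltaContr e := by
    intro c d e h
    simp only [deltaContr_eq, h _ (by simp : [_, _, _, _].length ≤ 4)]
    ring
  simp only [Equations.prEq1, hess_perturb hw0 hu3, hess_perturb hΦ0 hu3, hW2, hP2, hxb, hxa,
    hδ _ _ _ hW] at h1'
  simp only [Equations.prEq2, hess_perturb hw0 hu3, hW2, hxb,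
    hδ _ _ _ hP] at h2'
  simp only [Equations.prEq1] at h1
  simp only [Equations.prEq2] at h2
  constructor
  · exact (mul_eq_zero.1 (by linear_combination h1' - h1)).resolve_left hD
  · exact (mul_eq_zero.1 (by linear_combination h2' - h2)).resolve_left (one_div_ne_zero hE)

/-- Every 3-jet extends to a jet that satisfies the system. -/
lemma exists_satisfiedAt (hD : S.D ≠ 0) (hE : S.E * S.h ≠ 0) {x : Plane} {w Φ q : Plane → ℝ}
    (hw : ContDiff ℝ ∞ w) (hΦ : ContDiff ℝ ∞ Φ) (hq : Flat x 3 q)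
    (hq4 : deltaContr (fun J => pdL J q x) = 1) :
    ∃ a b : ℝ, S.SatisfiedAt (fun y => w y + a * q y) (fun y => Φ y + b * q y) x := by
  -- Each equation is linear in its own bilaplacian, with a nonzero coefficient, and `q` changes
  -- nothing else in it.
  refine ⟨-S.eq1 w Φ x / S.D, -S.eq2 w Φ x * (S.E * S.h), ?_, ?_⟩
  · rw [S.eq1_perturb hw.contDiffAt hΦ.contDiffAt hq, hq4]
    field_simp; ring
  · rw [S.eq2_perturb hw.contDiffAt hΦ.contDiffAt hq, hq4, one_div]
    linear_combination (-S.eq2 w Φ x) * mul_inv_cancel₀ hE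

end Admitted

open MvPolynomial in
/-- A quartic with `δ^{αβ} δ^{μν} q_{,αβμν} = 1`. -/
noncomputable def quartic (x : Plane) : Plane → ℝ := ev x (C (1 / 24) * X 0 ^ 4)

lemma flat_quartic (x : Plane) : Flat x 4 (quartic x) :=
  flat_ev x ((MvPolynomial.isHomogeneous_X_pow _ _).C_mul _)

lemma deltaContr_quartic (x : Plane) : deltaContr (fun J => pdL J (quartic x) x) = 1 := by
  simp [deltaContr_eq, quartic, pdL, MvPolynomial.pderiv_X, ev, map_ofNat]
  norm_num

open MvPolynomial in
lemma pderiv_ofNat (i : Fin 2) (n : ℕ) [n.AtLeastTwo] :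
    pderiv i (ofNat(n) : MvPolynomial (Fin 2) ℝ) = 0 := by
  rw [← map_ofNat (C (σ := Fin 2) (R := ℝ)) n, pderiv_C]

/-! ### What quartic and cubic perturbations reveal. -/

section Splitting

variable {H : Space → ℝ} {ξ : Fin 2 → Space → ℝ} {v w Φ u : Plane → ℝ} {x : Plane}

open MvPolynomial in
lemma ev_self (x : Plane) (P : MvPolynomial (Fin 2) ℝ) : ev x P x = constantCoeff P := by
  simp [ev]

-- For a quartic `u` with zero bilaplacian, only `4 ξ^μ_{,α} ∂_α ∂_μ Δu` survives at `x`. The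
-- Hessian of `Δu` is a multiple of diag(1, −1) for the first quartic and purely off-diagonal for
-- the second.
open MvPolynomial in
lemma cauchyRiemann_of_prCoeffVar (hw : SmoothAt w x) (hΦ : SmoothAt Φ x)
    (a b : ℝ) (hH : SmoothAt H (sec w Φ x)) (hξ : ∀ μ, SmoothAt (ξ μ) (sec w Φ x))
    (hv : SmoothAt v x)
    (h1 : deltaContr (prCoeffVar H ξ v w Φ (ev x (X 0 ^ 4 - X 1 ^ 4)) a b 1 x) = 0)
    (h2 : deltaContr (prCoeffVar H ξ v w Φ (ev x (X 0 ^ 3 * X 1 + X 0 * X 1 ^ 3)) a b 1 x) = 0) :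
    pd 0 (fun y => ξ 0 (sec w Φ y)) x = pd 1 (fun y => ξ 1 (sec w Φ y)) x ∧
      pd 0 (fun y => ξ 1 (sec w Φ y)) x = - pd 1 (fun y => ξ 0 (sec w Φ y)) x := by
  have e1 := fun P => pdL_mul_four (smoothAt_ev x P x) (smoothAt_charDeriv hw hΦ a b hH hξ hv)
  have e2 := fun μ P => pdL_mul_four ((hξ μ).sec hw hΦ) (smoothAt_ev x P x)
  simp only [deltaContr_eq, prCoeffVar, Fin.sum_univ_two, pd_ev, e1, e2] at h1 h2
  simp [pdL, ev_self, pderiv_X, pderiv_ofNat, map_ofNat] at h1 h2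
  constructor <;> linarith

-- For a cubic, the product of `u` with the characteristic derivative χ contributes `4 ∇Δu · ∇χ`,
-- and the products `ξ^μ u_{,μ}` contribute the second derivatives of ξ. A pure cube selects one
-- coordinate direction.
open MvPolynomial in
lemma cubic_of_prCoeffVar (hw : SmoothAt w x) (hΦ : SmoothAt Φ x)
    (a b k : ℝ) (hH : SmoothAt H (sec w Φ x)) (hξ : ∀ μ, SmoothAt (ξ μ) (sec w Φ x))
    (hv : SmoothAt v x)
    (h1 : deltaContr (prCoeffVar H ξ v w Φ (ev x (X 0 ^ 3)) a b k x) = 0)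
    (h2 : deltaContr (prCoeffVar H ξ v w Φ (ev x (X 1 ^ 3)) a b k x) = 0) :
    2 * pd 0 (charDeriv H ξ v w Φ a b) x = k * (3 * pdL [0, 0] (fun y => ξ 0 (sec w Φ y)) x
        + pdL [1, 1] (fun y => ξ 0 (sec w Φ y)) x) ∧
      2 * pd 1 (charDeriv H ξ v w Φ a b) x = k * (3 * pdL [1, 1] (fun y => ξ 1 (sec w Φ y)) x
        + pdL [0, 0] (fun y => ξ 1 (sec w Φ y)) x) := by
  have e1 := fun P => pdL_mul_four (smoothAt_ev x P x) (smoothAt_charDeriv hw hΦ a b hH hξ hv)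
  have e2 := fun μ P => pdL_mul_four ((hξ μ).sec hw hΦ) (smoothAt_ev x P x)
  simp only [deltaContr_eq, prCoeffVar, Fin.sum_univ_two, pd_ev, e1, e2] at h1 h2
  simp [pdL, ev_self, pderiv_X, pderiv_ofNat, map_ofNat] at h1 h2
  simp only [pdL]
  constructor <;> linarith

end Splitting

/-! ### Determining equations from the highest derivatives. -/

section Determining

variable {S : Equations} {X : Space → Space} {M : Set Space}

lemma dd_eqOn {E : Type*} [NormedAddCommGroup E] [NormedSpace ℝ E] {M : Set E} (hM : IsOpen M)
    {F G : E → ℝ} (h : ∀ z ∈ M, F z = G z) (v : E) : ∀ z ∈ M, dd v F z = dd v G z := fun _ hz =>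
  (dd_congr (Filter.eventually_of_mem (hM.mem_nhds hz) h) v).eq_of_nhds

lemma dd_eq_zero_of_eqOn {E : Type*} [NormedAddCommGroup E] [NormedSpace ℝ E] {M : Set E}
    (hM : IsOpen M) {F : E → ℝ} (h : ∀ z ∈ M, F z = 0) (v : E) : ∀ z ∈ M, dd v F z = 0 :=
  fun z hz => by rw [dd_eqOn hM h v z hz, dd_const]

/-- A section with prescribed 1-jet whose 4-jet satisfies the system. -/
lemma exists_section (hD : S.D ≠ 0) (hE : S.E * S.h ≠ 0) (z : Space) (p q : Fin 2 → ℝ) :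
    ∃ w Φ : Plane → ℝ, ContDiff ℝ ∞ w ∧ ContDiff ℝ ∞ Φ ∧ sec w Φ z.1 = z ∧
      (∀ μ, pd μ w z.1 = p μ) ∧ (∀ μ, pd μ Φ z.1 = q μ) ∧ S.SatisfiedAt w Φ z.1 := by
  -- A linear polynomial carries the 1-jet; multiples of the quartic then adjust fourth derivatives
  -- without touching it.
  let P : ℝ → (Fin 2 → ℝ) → MvPolynomial (Fin 2) ℝ := fun c p =>
    MvPolynomial.C c + MvPolynomial.C (p 0) * MvPolynomial.X 0
      + MvPolynomial.C (p 1) * MvPolynomial.X 1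
  have hP : ∀ c p μ, pd μ (ev z.1 (P c p)) z.1 = p μ := by
    intro c p μ
    fin_cases μ <;> simp [P, ev_self, MvPolynomial.pderiv_X]
  have hq := flat_quartic z.1
  have hqd : ContDiff ℝ ∞ (quartic z.1) := contDiff_ev _ _
  obtain ⟨a, b, hab⟩ := exists_satisfiedAt (S := S) hD hE (contDiff_ev z.1 (P z.2.1 p))
    (contDiff_ev z.1 (P z.2.2 q)) hq.of_succ (deltaContr_quartic z.1)
  have h1 : ∀ c p a μ, pd μ (fun y => ev z.1 (P c p) y + a * quartic z.1 y) z.1 = p μ := by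
    intro c p a μ
    have := pdL_add_const_mul (smoothAt_ev z.1 (P c p) z.1) hq.smoothAt a [μ]
    simp only [pdL] at this
    rw [this, hP, (hq.pd μ).apply_eq, mul_zero, add_zero]
  refine ⟨_, _, (contDiff_ev _ _).add (contDiff_const.mul hqd),
    (contDiff_ev _ _).add (contDiff_const.mul hqd), ?_, h1 _ _ _, h1 _ _ _, hab⟩
  simp [sec, ev_self, P, hq.apply_eq]

/-- The assumptions on a vector field under which the determining equations are derived. -/
structure Admissible (S : Equations) (X : Space → Space) (M : Set Space) : Prop where
  isOpen : IsOpen M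
  D_ne_zero : S.D ≠ 0
  Eh_ne_zero : S.E * S.h ≠ 0
  contDiffOn : ContDiffOn ℝ ∞ X M
  admits : S.AdmitsOnSmooth X M

namespace Admissible

variable (h : Admissible S X M)
include h

lemma contDiffAt {z : Space} (hz : z ∈ M) : ContDiffAt ℝ ∞ X z :=
  h.contDiffOn.contDiffAt (h.isOpen.mem_nhds hz)

lemma xi {z : Space} (hz : z ∈ M) (μ : Fin 2) : SmoothAt (xiC X μ) z :=
  smoothAt_xiC (h.contDiffAt hz) μ

lemma eta {z : Space} (hz : z ∈ M) : SmoothAt (etaC X) z := smoothAt_etaC (h.contDiffAt hz)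

lemma phi {z : Space} (hz : z ∈ M) : SmoothAt (phiC X) z := smoothAt_phiC (h.contDiffAt hz)

open MvPolynomial in
/-- The Cauchy–Riemann equations hold along every section. -/
lemma totalDeriv_xi {z : Space} (hz : z ∈ M) (p q : Fin 2 → ℝ) :
    dd (eX 0) (xiC X 0) z + p 0 * dd eW (xiC X 0) z + q 0 * dd eP (xiC X 0) z
      = dd (eX 1) (xiC X 1) z + p 1 * dd eW (xiC X 1) z + q 1 * dd eP (xiC X 1) z ∧
    dd (eX 0) (xiC X 1) z + p 0 * dd eW (xiC X 1) z + q 0 * dd eP (xiC X 1) z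
      = -(dd (eX 1) (xiC X 0) z + p 1 * dd eW (xiC X 0) z + q 1 * dd eP (xiC X 0) z) := by
  obtain ⟨w, Φ, hw, hΦ, rfl', hp, hq, hsat⟩ := exists_section h.D_ne_zero h.Eh_ne_zero z p q
  have hz' : sec w Φ z.1 ∈ M := by rwa [rfl']
  have hw0 : SmoothAt w z.1 := hw.contDiffAt
  have hΦ0 : SmoothAt Φ z.1 := hΦ.contDiffAt
  have hh1 : (MvPolynomial.X 0 ^ 4 - MvPolynomial.X 1 ^ 4 : MvPolynomial (Fin 2) ℝ).IsHomogeneous 4 :=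
    (isHomogeneous_X_pow _ _).sub (isHomogeneous_X_pow _ _)
  have hh2 : (MvPolynomial.X 0 ^ 3 * MvPolynomial.X 1 + MvPolynomial.X 0 * MvPolynomial.X 1 ^ 3 :
      MvPolynomial (Fin 2) ℝ).IsHomogeneous 4 :=
    ((isHomogeneous_X_pow _ _).mul (isHomogeneous_X ℝ _)).add
      ((isHomogeneous_X ℝ _).mul (isHomogeneous_X_pow _ _))
  -- Only `w` is perturbed (`a = 1`, `b = 0`), and the first equation suffices.
  have key := cauchyRiemann_of_prCoeffVar hw0 hΦ0 1 0 (h.eta hz') (h.xi hz') hw0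
    (prCoeffVar_eq_zero h.admits h.D_ne_zero h.Eh_ne_zero hw hΦ hz' (h.contDiffAt hz') hsat
      (contDiff_ev _ _) (flat_ev _ hh1).of_succ
      (by simp [deltaContr_eq, pdL, ev_self, pderiv_X, pderiv_ofNat, map_ofNat]) 1 0).1
    (prCoeffVar_eq_zero h.admits h.D_ne_zero h.Eh_ne_zero hw hΦ hz' (h.contDiffAt hz') hsat
      (contDiff_ev _ _) (flat_ev _ hh2).of_succ
      (by simp [deltaContr_eq, pdL, ev_self, pderiv_X, pderiv_ofNat]) 1 0).1
  have hpd := fun μ α => (pd_sec (h.xi hz' μ) hw0 hΦ0 α).eq_of_nhds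
  simpa only [hpd, hp, hq, rfl'] using key

/-- The Cauchy–Riemann equations hold for every gradient of `w`; comparing the gradients (0, 0) and
(1, 0) isolates the coefficients of that gradient. -/
lemma dd_eW_xi (μ : Fin 2) : ∀ z ∈ M, dd eW (xiC X μ) z = 0 := by
  intro z hz
  have h0 := h.totalDeriv_xi hz 0 0
  have h1 := h.totalDeriv_xi hz ![1, 0] 0
  simp at h0 h1
  fin_cases μ
  · change dd eW (xiC X 0) z = 0; linarith
  · change dd eW (xiC X 1) z = 0; linarith

lemma dd_eP_xi (μ : Fin 2) : ∀ z ∈ M, dd eP (xiC X μ) z = 0 := by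
  intro z hz
  have h0 := h.totalDeriv_xi hz 0 0
  have h1 := h.totalDeriv_xi hz 0 ![1, 0]
  simp at h0 h1
  fin_cases μ
  · change dd eP (xiC X 0) z = 0; linarith
  · change dd eP (xiC X 1) z = 0; linarith

lemma cauchyRiemann : ∀ z ∈ M, dd (eX 0) (xiC X 0) z = dd (eX 1) (xiC X 1) z ∧
    dd (eX 0) (xiC X 1) z = -dd (eX 1) (xiC X 0) z := by
  intro z hz
  simpa using h.totalDeriv_xi hz 0 0

/-- The function `ξ^1_{,1}` does not depend on `w` and `Φ`. -/
lemma dd_dilation {e : Space} (he : ∀ μ, ∀ z ∈ M, dd e (xiC X μ) z = 0) (μ α : Fin 2) :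
    ∀ z ∈ M, dd e (dd (eX α) (xiC X μ)) z = 0 := fun z hz => by
  rw [(dd_comm (h.xi hz μ) e (eX α)).eq_of_nhds]
  exact dd_eq_zero_of_eqOn h.isOpen (he μ) _ z hz

lemma pd_xi {w Φ : Plane → ℝ} {x : Plane} (hw : SmoothAt w x) (hΦ : SmoothAt Φ x)
    (hz : sec w Φ x ∈ M) (μ α : Fin 2) :
    pd α (fun y => xiC X μ (sec w Φ y)) =ᶠ[𝓝 x] fun y => dd (eX α) (xiC X μ) (sec w Φ y) := by
  filter_upwards [pd_sec (h.xi hz μ) hw hΦ α,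
    eventually_sec hw hΦ (h.isOpen.mem_nhds hz)] with y h1 h2
  rw [h1, h.dd_eW_xi μ _ h2, h.dd_eP_xi μ _ h2]
  ring

lemma pdL_xi {w Φ : Plane → ℝ} {x : Plane} (hw : SmoothAt w x) (hΦ : SmoothAt Φ x)
    (hz : sec w Φ x ∈ M) (μ α β : Fin 2) :
    pdL [β, α] (fun y => xiC X μ (sec w Φ y)) x = dd (eX β) (dd (eX α) (xiC X μ)) (sec w Φ x) := by
  have h1 := (pd_congr (h.pd_xi hw hΦ hz μ α) β).eq_of_nhds
  have h2 := (pd_sec ((h.xi hz μ).dd (eX α)) hw hΦ β).eq_of_nhds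
  simp only [pdL]
  rw [h1, h2, h.dd_dilation h.dd_eW_xi μ α _ hz, h.dd_dilation h.dd_eP_xi μ α _ hz]
  ring

/-- The components `ξ^μ` are harmonic. -/
lemma xi_harmonic : ∀ z ∈ M,
    dd (eX 1) (dd (eX 1) (xiC X 0)) z = -dd (eX 0) (dd (eX 0) (xiC X 0)) z ∧
    dd (eX 0) (dd (eX 0) (xiC X 1)) z = -dd (eX 1) (dd (eX 0) (xiC X 0)) z ∧
    dd (eX 1) (dd (eX 1) (xiC X 1)) z = dd (eX 1) (dd (eX 0) (xiC X 0)) z := by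
  intro z hz
  have hc := h.cauchyRiemann
  have neg : ∀ {F : Space → ℝ}, SmoothAt F z → ∀ v : Space,
      dd v (fun z => -F z) z = -dd v F z := fun hF v => by simp [dd]
  have e1 : ∀ z ∈ M, dd (eX 1) (xiC X 0) z = -dd (eX 0) (xiC X 1) z := fun z hz => by
    rw [(hc z hz).2]; ring
  refine ⟨?_, ?_, ?_⟩
  · rw [dd_eqOn h.isOpen e1 _ z hz, neg ((h.xi hz 1).dd _),
      (dd_comm (h.xi hz 1) (eX 1) (eX 0)).eq_of_nhds,
      dd_eqOn h.isOpen (fun z hz => (hc z hz).1) _ z hz]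
  · rw [dd_eqOn h.isOpen (fun z hz => (hc z hz).2) _ z hz, neg ((h.xi hz 0).dd _),
      (dd_comm (h.xi hz 0) (eX 0) (eX 1)).eq_of_nhds]
  · rw [dd_eqOn h.isOpen (fun z hz => (hc z hz).1) _ z hz]

/-- As ξ does not depend on `w` and `Φ`, the vertical derivative of the characteristic loses its
terms in `v_{,μ}`, and one total derivative of `H_w` and `H_Φ` remains. -/
lemma pd_charDeriv {H : Space → ℝ} (hH : ∀ z ∈ M, SmoothAt H z) {v w Φ : Plane → ℝ} {x : Plane}
    (hw : SmoothAt w x) (hΦ : SmoothAt Φ x) (hz : sec w Φ x ∈ M) (a b : ℝ) (α : Fin 2) :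
    pd α (charDeriv H (xiC X) v w Φ a b) x =
      a * (dd (eX α) (dd eW H) (sec w Φ x) + pd α w x * dd eW (dd eW H) (sec w Φ x)
        + pd α Φ x * dd eP (dd eW H) (sec w Φ x)) +
      b * (dd (eX α) (dd eP H) (sec w Φ x) + pd α w x * dd eW (dd eP H) (sec w Φ x)
        + pd α Φ x * dd eP (dd eP H) (sec w Φ x)) := by
  have h0 : charDeriv H (xiC X) v w Φ a b =ᶠ[𝓝 x] fun y =>
      a * dd eW H (sec w Φ y) + b * dd eP H (sec w Φ y) := by
    filter_upwards [eventually_sec hw hΦ (h.isOpen.mem_nhds hz)] with y hy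
    simp [charDeriv, h.dd_eW_xi _ _ hy, h.dd_eP_xi _ _ hy]
  have hWs := ((hH _ hz).dd eW).sec hw hΦ
  have hPs := ((hH _ hz).dd eP).sec hw hΦ
  have h1 := (dd_add (contDiffAt_const.mul hWs) (contDiffAt_const.mul hPs) (ex α)).trans
      ((dd_const_mul a hWs _).add (dd_const_mul b hPs _))
  rw [(pd_congr h0 α).eq_of_nhds, pd_eq_dd, h1.eq_of_nhds]
  simp only [Pi.add_apply, ← pd_eq_dd]
  rw [(pd_sec ((hH _ hz).dd eW) hw hΦ α).eq_of_nhds,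
    (pd_sec ((hH _ hz).dd eP) hw hΦ α).eq_of_nhds]

open MvPolynomial in
/-- The consequences of the terms that are linear in the third derivatives. -/
lemma cubic {z : Space} (hz : z ∈ M) (p q : Fin 2 → ℝ) (a b : ℝ) (α : Fin 2) :
    a * (dd (eX α) (dd eW (etaC X)) z + p α * dd eW (dd eW (etaC X)) z
        + q α * dd eP (dd eW (etaC X)) z) +
      b * (dd (eX α) (dd eP (etaC X)) z + p α * dd eW (dd eP (etaC X)) z
        + q α * dd eP (dd eP (etaC X)) z) = a * dd (eX α) (dd (eX 0) (xiC X 0)) z ∧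
    a * (dd (eX α) (dd eW (phiC X)) z + p α * dd eW (dd eW (phiC X)) z
        + q α * dd eP (dd eW (phiC X)) z) +
      b * (dd (eX α) (dd eP (phiC X)) z + p α * dd eW (dd eP (phiC X)) z
        + q α * dd eP (dd eP (phiC X)) z) = b * dd (eX α) (dd (eX 0) (xiC X 0)) z := by
  obtain ⟨w, Φ, hw, hΦ, rfl', hp, hq, hsat⟩ := exists_section h.D_ne_zero h.Eh_ne_zero z p q
  have hz' : sec w Φ z.1 ∈ M := by rwa [rfl']
  have hw0 : SmoothAt w z.1 := hw.contDiffAt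
  have hΦ0 : SmoothAt Φ z.1 := hΦ.contDiffAt
  have hvar := fun i : Fin 2 =>
    prCoeffVar_eq_zero h.admits h.D_ne_zero h.Eh_ne_zero hw hΦ hz' (h.contDiffAt hz') hsat
      (contDiff_ev _ _) (flat_ev _ (isHomogeneous_X_pow (R := ℝ) i 3))
      (by fin_cases i <;>
        simp [deltaContr_eq, pdL, ev_self, pderiv_X, pderiv_ofNat]) a b
  have k1 := cubic_of_prCoeffVar hw0 hΦ0 a b a (h.eta hz') (h.xi hz') hw0 (hvar 0).1 (hvar 1).1
  have k2 := cubic_of_prCoeffVar hw0 hΦ0 a b b (h.phi hz') (h.xi hz') hΦ0 (hvar 0).2 (hvar 1).2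
  simp only [h.pd_charDeriv (fun z hz => h.eta hz) hw0 hΦ0 hz',
    h.pd_charDeriv (fun z hz => h.phi hz) hw0 hΦ0 hz', h.pdL_xi hw0 hΦ0 hz', hp, hq, rfl',
    h.xi_harmonic z hz] at k1 k2
  obtain ⟨k10, k11⟩ := k1
  obtain ⟨k20, k21⟩ := k2
  constructor <;> fin_cases α <;> simp only [Fin.zero_eta, Fin.mk_one] <;> linarith

/-- The identity `cubic` holds for all `p`, `q`, `a`, `b`; its coefficients are read off at zero and
unit values. -/
lemma dd_dd_eta : ∀ z ∈ M,
    (∀ α, dd (eX α) (dd eW (etaC X)) z = dd (eX α) (dd (eX 0) (xiC X 0)) z) ∧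
    dd eW (dd eW (etaC X)) z = 0 ∧ dd eP (dd eW (etaC X)) z = 0 ∧
    (∀ α, dd (eX α) (dd eP (etaC X)) z = 0) ∧ dd eW (dd eP (etaC X)) z = 0 ∧
    dd eP (dd eP (etaC X)) z = 0 := by
  intro z hz
  have k := fun p q a b α => (h.cubic hz p q a b α).1
  have h1 := fun α => k 0 0 1 0 α
  have h2 := fun α => k 0 0 0 1 α
  have h3 := k ![1, 0] 0 1 0 0
  have h4 := k 0 ![1, 0] 1 0 0
  have h5 := k ![1, 0] 0 0 1 0
  have h6 := k 0 ![1, 0] 0 1 0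
  simp at h1 h2 h3 h4 h5 h6
  refine ⟨Fin.forall_fin_two.2 h1, ?_, ?_, Fin.forall_fin_two.2 h2, ?_, ?_⟩ <;>
    linarith [h1.1, h2.1]

lemma dd_dd_phi : ∀ z ∈ M,
    (∀ α, dd (eX α) (dd eP (phiC X)) z = dd (eX α) (dd (eX 0) (xiC X 0)) z) ∧
    dd eW (dd eP (phiC X)) z = 0 ∧ dd eP (dd eP (phiC X)) z = 0 ∧
    (∀ α, dd (eX α) (dd eW (phiC X)) z = 0) ∧ dd eW (dd eW (phiC X)) z = 0 ∧
    dd eP (dd eW (phiC X)) z = 0 := by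
  intro z hz
  have k := fun p q a b α => (h.cubic hz p q a b α).2
  have h1 := fun α => k 0 0 1 0 α
  have h2 := fun α => k 0 0 0 1 α
  have h3 := k ![1, 0] 0 1 0 0
  have h4 := k 0 ![1, 0] 1 0 0
  have h5 := k ![1, 0] 0 0 1 0
  have h6 := k 0 ![1, 0] 0 1 0
  simp at h1 h2 h3 h4 h5 h6
  refine ⟨Fin.forall_fin_two.2 h2, ?_, ?_, Fin.forall_fin_two.2 h1, ?_, ?_⟩ <;>
    linarith [h1.1, h2.1]

end Admissible

end Determining

/-! ### Integration along segments. -/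

section Segments

variable {E : Type*} [NormedAddCommGroup E] [NormedSpace ℝ E] {M : Set E} {F : E → ℝ}

lemma hasDerivAt_line {z e : E} {t : ℝ} (hF : DifferentiableAt ℝ F (z + t • e)) :
    HasDerivAt (fun t : ℝ => F (z + t • e)) (dd e F (z + t • e)) t := by
  have h1 : HasDerivAt (fun t : ℝ => z + t • e) e t := by
    simpa using ((hasDerivAt_id t).smul_const e).const_add z
  exact hF.hasFDerivAt.comp_hasDerivAt t h1

lemma eq_of_dd_eq_zero (hF : ∀ z ∈ M, DifferentiableAt ℝ F z) {z e : E}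
    (hd : ∀ z ∈ M, dd e F z = 0) (hs : ∀ t ∈ Icc (0 : ℝ) 1, z + t • e ∈ M) :
    F (z + e) = F z := by
  have h := constant_of_has_deriv_right_zero (f := fun t : ℝ => F (z + t • e)) (a := 0) (b := 1)
    (fun t ht => (hasDerivAt_line (hF _ (hs t ht))).continuousAt.continuousWithinAt)
    (fun t ht => by
      have := hasDerivAt_line (hF _ (hs t ⟨ht.1, ht.2.le⟩))
      rw [hd _ (hs t ⟨ht.1, ht.2.le⟩)] at this
      exact this.hasDerivWithinAt) 1 (by simp)
  simpa using h

lemma eq_add_of_dd_dd_eq_zero (hF : ∀ z ∈ M, SmoothAt F z) {z e : E}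
    (hd : ∀ z ∈ M, dd e (dd e F) z = 0) (hs : ∀ t ∈ Icc (0 : ℝ) 1, z + t • e ∈ M) :
    F (z + e) = F z + dd e F z := by
  have h1 : ∀ t ∈ Icc (0 : ℝ) 1, dd e F (z + t • e) = dd e F z := by
    intro t ht
    refine eq_of_dd_eq_zero (M := M) (fun z hz => ((hF z hz).dd e).differentiableAt) ?_ ?_
    · intro z hz
      have := hd z hz
      simp only [dd, map_smul, smul_eq_mul] at this ⊢
      rw [this, mul_zero]
    · intro s hs'
      rw [smul_smul]
      exact hs _ ⟨mul_nonneg hs'.1 ht.1, mul_le_one₀ hs'.2 ht.1 ht.2⟩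
  have hder : ∀ t ∈ Icc (0 : ℝ) 1,
      HasDerivAt (fun t : ℝ => F (z + t • e) - t * dd e F z) 0 t := by
    intro t ht
    have h2 := hasDerivAt_line (hF _ (hs t ht)).differentiableAt
    rw [h1 t ht] at h2
    simpa using h2.fun_sub ((hasDerivAt_id' t).mul_const (dd e F z))
  have h := constant_of_has_deriv_right_zero (a := 0) (b := 1)
    (fun t ht => (hder t ht).continuousAt.continuousWithinAt)
    (fun t ht => (hder t ⟨ht.1, ht.2.le⟩).hasDerivWithinAt) 1 (by simp)
  simp at h
  linarith

end Segments

/-! ### Splitting with respect to the second derivatives -/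

/-- In the maximum norm of the product, replacing the fibre coordinates by those of the centre stays
in the ball, and the ball is convex. -/
lemma exists_ball_segment {M : Set Space} (hM : IsOpen M) {z₀ : Space} (hz₀ : z₀ ∈ M) :
    ∃ N ∈ 𝓝 z₀, ∀ z ∈ N, ∀ t ∈ Icc (0 : ℝ) 1,
      (z.1, z₀.2) + t • ((0, z.2 - z₀.2) : Space) ∈ M := by
  obtain ⟨r, hr, hball⟩ := Metric.isOpen_iff.1 hM z₀ hz₀
  refine ⟨Metric.ball z₀ r, Metric.ball_mem_nhds _ hr, fun z hz t ht => hball ?_⟩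
  have h1 : (z.1, z₀.2) ∈ Metric.ball z₀ r := by
    rw [Metric.mem_ball, Prod.dist_eq] at hz ⊢
    exact max_lt (max_lt_iff.1 hz).1 (by simpa using hr)
  have := (convex_ball z₀ r).add_smul_sub_mem h1 hz ht
  convert this using 2
  ext <;> simp

lemma dd_vertical {F : Space → ℝ} (a b : ℝ) : dd ((0, a, b) : Space) F =
    fun z => a * dd eW F z + b * dd eP F z := by
  have hv : ((0, a, b) : Space) = a • eW + b • eP := by simp
  ext z
  rw [dd, hv, map_add, map_smul, map_smul]
  rfl

/-- The fibres of `M` over the plane need not be connected, so independence of (w, Φ) is obtained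
only locally, along vertical segments. -/
lemma eventually_eq_of_vertical {M : Set Space} (hM : IsOpen M) {F : Space → ℝ}
    (hF : ∀ z ∈ M, SmoothAt F z) (hW : ∀ z ∈ M, dd eW F z = 0) (hP : ∀ z ∈ M, dd eP F z = 0)
    {z₀ : Space} (hz₀ : z₀ ∈ M) : ∀ᶠ z in 𝓝 z₀, F z = F (z.1, z₀.2) := by
  obtain ⟨N, hN, hseg⟩ := exists_ball_segment hM hz₀
  filter_upwards [hN] with z hz
  have h := eq_of_dd_eq_zero (fun z hz => (hF z hz).differentiableAt) (z := (z.1, z₀.2))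
    (e := ((0, z.2 - z₀.2) : Space)) (fun y hy => by
      have := congrFun (dd_vertical (F := F) (z.2.1 - z₀.2.1) (z.2.2 - z₀.2.2)) y
      simp only [hW y hy, hP y hy, mul_zero, add_zero] at this
      exact this) (hseg z hz)
  simpa using h

lemma eventually_eq_affine_of_vertical {M : Set Space} (hM : IsOpen M) {F : Space → ℝ}
    (hF : ∀ z ∈ M, SmoothAt F z)
    (hd : ∀ z ∈ M, dd eW (dd eW F) z = 0 ∧ dd eP (dd eW F) z = 0 ∧ dd eW (dd eP F) z = 0 ∧
      dd eP (dd eP F) z = 0)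
    {z₀ : Space} (hz₀ : z₀ ∈ M) : ∀ᶠ z in 𝓝 z₀, F z = F (z.1, z₀.2)
      + (z.2.1 - z₀.2.1) * dd eW F (z.1, z₀.2) + (z.2.2 - z₀.2.2) * dd eP F (z.1, z₀.2) := by
  obtain ⟨N, hN, hseg⟩ := exists_ball_segment hM hz₀
  filter_upwards [hN] with z hz
  have h := eq_add_of_dd_dd_eq_zero hF (z := (z.1, z₀.2))
    (e := ((0, z.2.1 - z₀.2.1, z.2.2 - z₀.2.2) : Space)) (fun y hy => by
      set a := z.2.1 - z₀.2.1
      set b := z.2.2 - z₀.2.2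
      obtain ⟨h1, h2, h3, h4⟩ := hd y hy
      rw [dd_vertical a b (F := F), dd_vertical a b]
      have hWs := (hF y hy).dd eW
      have hPs := (hF y hy).dd eP
      have key := fun v => ((dd_add (contDiffAt_const.mul hWs) (contDiffAt_const.mul hPs) v).trans
        ((dd_const_mul a hWs v).add (dd_const_mul b hPs v))).eq_of_nhds
      simp only [key, Pi.add_apply, h1, h2, h3, h4]
      ring) (hseg z hz)
  rw [dd_vertical] at h
  simp only [Prod.mk_add_mk, add_zero] at h
  rw [← add_assoc] at h
  convert h using 2
  ext <;> simp

section TestSections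

open MvPolynomial

/-- A polynomial with Hessian `(h₀, h₁; h₁, h₂)` and bilaplacian `l`. -/
noncomputable def testPoly (h₀ h₁ h₂ l : ℝ) : MvPolynomial (Fin 2) ℝ :=
  C (h₀ / 2) * X 0 ^ 2 + C h₁ * (X 0 * X 1) + C (h₂ / 2) * X 1 ^ 2 + C (l / 24) * X 0 ^ 4

/-- The form of a characteristic that is affine in the dependent variables. -/
noncomputable def affChar (G A B : Plane → ℝ) (ξ : Fin 2 → Plane → ℝ) (U V T : Plane → ℝ) :
    Plane → ℝ := fun y => G y + A y * U y + B y * V y - ∑ μ, ξ μ y * pd μ T y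

variable {G A B U V T : Plane → ℝ} {ξ : Fin 2 → Plane → ℝ} {x : Plane}

lemma pdL_affChar (hG : SmoothAt G x) (hA : SmoothAt A x) (hB : SmoothAt B x)
    (hU : SmoothAt U x) (hV : SmoothAt V x) (hT : SmoothAt T x) (hξ : ∀ μ, SmoothAt (ξ μ) x)
    (J : List (Fin 2)) :
    pdL J (affChar G A B ξ U V T) x = pdL J G x + pdL J (fun y => A y * U y) x
      + pdL J (fun y => B y * V y) x - (pdL J (fun y => ξ 0 y * pd 0 T y) x
      + pdL J (fun y => ξ 1 y * pd 1 T y) x) := by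
  have h0 := (hξ 0).mul (hT.pd 0)
  have h1 := (hξ 1).mul (hT.pd 1)
  have e := (pdL_sub ((hG.add (hA.mul hU)).add (hB.mul hV)) (h0.add h1) J).eq_of_nhds
  have e1 := (pdL_add (hG.add (hA.mul hU)) (hB.mul hV) J).eq_of_nhds
  have e2 := (pdL_add hG (hA.mul hU) J).eq_of_nhds
  have e3 := (pdL_add h0 h1 J).eq_of_nhds
  unfold affChar
  simp only [Fin.sum_univ_two]
  rw [e, e1, e2, e3]

/-- The part of the bilaplacian of `A U` that is linear in the Hessian of `U`. -/
noncomputable def linA (A : Plane → ℝ) (x : Plane) (h₀ h₁ h₂ : ℝ) : ℝ :=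
  2 * (pdL [0, 0] A x + pdL [1, 1] A x) * (h₀ + h₂)
    + 4 * (pdL [0, 0] A x * h₀ + (pdL [0, 1] A x + pdL [1, 0] A x) * h₁ + pdL [1, 1] A x * h₂)

/-- The part of the bilaplacian of `ξ^μ T_{,μ}` that is linear in the Hessian of `T`. -/
noncomputable def linX (ξ : Fin 2 → Plane → ℝ) (x : Plane) (h₀ h₁ h₂ : ℝ) : ℝ :=
  4 * (pdL [0, 0, 0] (ξ 0) x * h₀ + pdL [1, 1, 1] (ξ 0) x * h₁)
    + 2 * ((pdL [0, 1, 1] (ξ 0) x + pdL [1, 1, 0] (ξ 0) x) * h₀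
      + (pdL [1, 0, 0] (ξ 0) x + pdL [0, 0, 1] (ξ 0) x) * h₁)
    + (4 * (pdL [0, 0, 0] (ξ 1) x * h₁ + pdL [1, 1, 1] (ξ 1) x * h₂)
    + 2 * ((pdL [0, 1, 1] (ξ 1) x + pdL [1, 1, 0] (ξ 1) x) * h₁
      + (pdL [1, 0, 0] (ξ 1) x + pdL [0, 0, 1] (ξ 1) x) * h₂))

variable (h₀ h₁ h₂ l k₀ k₁ k₂ m t₀ t₁ t₂ n : ℝ)

/-- At `x` the test polynomials have zero value, gradient and third derivatives, so only products
with their Hessians and fourth derivatives survive. The quartic term is a power of the first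
coordinate alone, whence the single first derivative `pdL [0] (ξ 0)` in front of `n`. -/
lemma deltaContr_affChar (hG : SmoothAt G x) (hA : SmoothAt A x) (hB : SmoothAt B x)
    (hξ : ∀ μ, SmoothAt (ξ μ) x) :
    deltaContr (fun J => pdL J (affChar G A B ξ (ev x (testPoly h₀ h₁ h₂ l))
      (ev x (testPoly k₀ k₁ k₂ m)) (ev x (testPoly t₀ t₁ t₂ n))) x
      + ∑ μ, ξ μ x * pdL J (pd μ (ev x (testPoly t₀ t₁ t₂ n))) x) =
    deltaContr (fun J => pdL J G x) + A x * l + B x * m + linA A x h₀ h₁ h₂ + linA B x k₀ k₁ k₂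
      - 4 * pdL [0] (ξ 0) x * n - linX ξ x t₀ t₁ t₂ := by
  have e1 := fun P => pdL_mul_four hA (smoothAt_ev x P x)
  have e2 := fun P => pdL_mul_four hB (smoothAt_ev x P x)
  have e3 := fun μ P => pdL_mul_four (hξ μ) (smoothAt_ev x P x)
  simp only [deltaContr_eq, pdL_affChar hG hA hB (smoothAt_ev x _ x) (smoothAt_ev x _ x)
    (smoothAt_ev x _ x) hξ, pd_ev, e1, e2, e3, Fin.sum_univ_two]
  simp [pdL, testPoly, ev_self, pderiv_X, pderiv_ofNat, map_ofNat, linA, linX]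
  ring

lemma hess_affChar (hG : SmoothAt G x) (hA : SmoothAt A x) (hB : SmoothAt B x)
    (hξ : ∀ μ, SmoothAt (ξ μ) x) (α β : Fin 2) :
    pdL [α, β] (affChar G A B ξ (ev x (testPoly h₀ h₁ h₂ l))
      (ev x (testPoly k₀ k₁ k₂ m)) (ev x (testPoly t₀ t₁ t₂ n))) x
      + ∑ μ, ξ μ x * pdL [α, β] (pd μ (ev x (testPoly t₀ t₁ t₂ n))) x =
    (!![pdL [0, 0] G x + A x * h₀ + B x * k₀ - 2 * (pdL [0] (ξ 0) x * t₀ + pdL [0] (ξ 1) x * t₁),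
      pdL [0, 1] G x + A x * h₁ + B x * k₁ - (pdL [0] (ξ 0) x * t₁ + pdL [0] (ξ 1) x * t₂
        + pdL [1] (ξ 0) x * t₀ + pdL [1] (ξ 1) x * t₁);
      pdL [1, 0] G x + A x * h₁ + B x * k₁ - (pdL [0] (ξ 0) x * t₁ + pdL [0] (ξ 1) x * t₂
        + pdL [1] (ξ 0) x * t₀ + pdL [1] (ξ 1) x * t₁),
      pdL [1, 1] G x + A x * h₂ + B x * k₂ - 2 * (pdL [1] (ξ 0) x * t₁ + pdL [1] (ξ 1) x * t₂)] :
      Matrix (Fin 2) (Fin 2) ℝ) α β := by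
  have e1 := fun P a b => (pdL_mul_two hA (smoothAt_ev x P x) a b).eq_of_nhds
  have e2 := fun P a b => (pdL_mul_two hB (smoothAt_ev x P x) a b).eq_of_nhds
  have e3 := fun μ P a b => (pdL_mul_two (hξ μ) (smoothAt_ev x P x) a b).eq_of_nhds
  simp only [pdL_affChar hG hA hB (smoothAt_ev x _ x) (smoothAt_ev x _ x)
    (smoothAt_ev x _ x) hξ, pd_ev, e1, e2, e3, Fin.sum_univ_two]
  fin_cases α <;> fin_cases β <;>
  · simp [pdL, testPoly, ev_self, pderiv_X, pderiv_ofNat, map_ofNat]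
    ring

end TestSections

lemma pd_add_const (g : Plane → ℝ) (c : ℝ) (α : Fin 2) : pd α (fun y => g y + c) = pd α g := by
  ext y
  simp [pd, fderiv_add_const]

lemma pdL_add_const (g : Plane → ℝ) (c : ℝ) (J : List (Fin 2)) (α : Fin 2) :
    pdL (J ++ [α]) (fun y => g y + c) = pdL (J ++ [α]) g := by
  rw [pdL_append, pdL_append]
  simp only [pdL, pd_add_const]

lemma hess_add_const (g : Plane → ℝ) (c : ℝ) (x : Plane) :
    hess (fun y => g y + c) x = hess g x := by
  ext α β
  exact congrFun (pdL_add_const g c [α] β) x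

section TestSections

variable {S : Equations} {X : Space → Space} {M : Set Space}

/-- The sections used to split the determining equations with respect to the second
derivatives. -/
noncomputable def testW (S : Equations) (z₀ : Space) (P : MvPolynomial (Fin 2) ℝ) :
    Plane → ℝ := fun y => ev z₀.1 P y - S.f y + (S.f z₀.1 + z₀.2.1)

/-- See `testW`. -/
noncomputable def testΦ (z₀ : Space) (P : MvPolynomial (Fin 2) ℝ) : Plane → ℝ :=
  fun y => ev z₀.1 P y + z₀.2.2

lemma contDiff_testW (hf : ContDiff ℝ ∞ S.f) (z₀ : Space) (P : MvPolynomial (Fin 2) ℝ) :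
    ContDiff ℝ ∞ (testW S z₀ P) :=
  ((contDiff_ev _ _).sub hf).add contDiff_const

lemma contDiff_testΦ (z₀ : Space) (P : MvPolynomial (Fin 2) ℝ) : ContDiff ℝ ∞ (testΦ z₀ P) :=
  (contDiff_ev _ _).add contDiff_const

lemma ev_testPoly (x : Plane) (h₀ h₁ h₂ l : ℝ) : ev x (testPoly h₀ h₁ h₂ l) x = 0 := by
  simp [testPoly, ev_self]

lemma sec_test (z₀ : Space) (h₀ h₁ h₂ l k₀ k₁ k₂ m : ℝ) :
    sec (testW S z₀ (testPoly h₀ h₁ h₂ l)) (testΦ z₀ (testPoly k₀ k₁ k₂ m)) z₀.1 = z₀ := by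
  simp [sec, testW, testΦ, ev_testPoly]

/-- The symmetric form with components `h₀, h₁, h₂`. -/
noncomputable def symForm (h₀ h₁ h₂ : ℝ) : Fin 2 → Fin 2 → ℝ :=
  fun α β => (!![h₀, h₁; h₁, h₂] : Matrix (Fin 2) (Fin 2) ℝ) α β

lemma hess_testPoly (x : Plane) (h₀ h₁ h₂ l : ℝ) (α β : Fin 2) :
    hess (ev x (testPoly h₀ h₁ h₂ l)) x α β = symForm h₀ h₁ h₂ α β := by
  fin_cases α <;> fin_cases β <;>
  simp [symForm, hess, pdL, testPoly, ev_self, MvPolynomial.pderiv_X, pderiv_ofNat, map_ofNat]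

lemma deltaContr_testPoly (x : Plane) (h₀ h₁ h₂ l : ℝ) :
    deltaContr (fun J => pdL J (ev x (testPoly h₀ h₁ h₂ l)) x) = l := by
  simp [deltaContr_eq, pdL, testPoly, ev_self, MvPolynomial.pderiv_X, pderiv_ofNat, map_ofNat]
  ring

lemma deltaContr_congr {c d : List (Fin 2) → ℝ}
    (h : ∀ α β γ δ, c [α, β, γ, δ] = d [α, β, γ, δ]) : deltaContr c = deltaContr d := by
  simp only [deltaContr_eq, h]

lemma pdL_four_add_const (g : Plane → ℝ) (c : ℝ) (α β γ δ : Fin 2) :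
    pdL [α, β, γ, δ] (fun y => g y + c) = pdL [α, β, γ, δ] g := pdL_add_const g c [α, β, γ] δ

lemma hess_testW (hf : ContDiff ℝ ∞ S.f) (z₀ : Space) (P : MvPolynomial (Fin 2) ℝ) :
    hess (testW S z₀ P) z₀.1 = fun α β => hess (ev z₀.1 P) z₀.1 α β - S.b z₀.1 α β := by
  unfold testW
  rw [hess_add_const]
  ext α β
  exact (pdL_sub (smoothAt_ev _ _ _) hf.contDiffAt [α, β]).eq_of_nhds

lemma deltaContr_testW (hf : ContDiff ℝ ∞ S.f) (z₀ : Space) (P : MvPolynomial (Fin 2) ℝ) :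
    deltaContr (fun J => pdL J (testW S z₀ P) z₀.1) =
      deltaContr (fun J => pdL J (ev z₀.1 P) z₀.1) - deltaContr (fun J => pdL J S.f z₀.1) := by
  have h := fun J => (pdL_sub (smoothAt_ev z₀.1 P z₀.1) hf.contDiffAt J).eq_of_nhds
  unfold testW
  simp only [deltaContr_eq, pdL_four_add_const, h]
  ring

lemma deltaContr_testΦ (z₀ : Space) (P : MvPolynomial (Fin 2) ℝ) :
    deltaContr (fun J => pdL J (testΦ z₀ P) z₀.1) =
      deltaContr (fun J => pdL J (ev z₀.1 P) z₀.1) := by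
  unfold testΦ
  simp only [deltaContr_eq, pdL_four_add_const]

/-- The component functions of a vector field on the horizontal slice through `z₀`. -/
def slice (F : Space → ℝ) (z₀ : Space) : Plane → ℝ := fun y => F (y, z₀.2)

lemma SmoothAt.slice {F : Space → ℝ} {z₀ : Space} (hF : SmoothAt F z₀) :
    SmoothAt (slice F z₀) z₀.1 :=
  SmoothAt.sec (w := fun _ => z₀.2.1) (Φ := fun _ => z₀.2.2) hF contDiffAt_const contDiffAt_const

lemma pd_slice {F : Space → ℝ} {z₀ : Space} (hF : SmoothAt F z₀) (α : Fin 2) :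
    pd α (slice F z₀) =ᶠ[𝓝 z₀.1] slice (dd (eX α) F) z₀ := by
  refine (pd_sec (w := fun _ => z₀.2.1) (Φ := fun _ => z₀.2.2) hF contDiffAt_const
    contDiffAt_const α).trans ?_
  simp only [pd_const]
  exact Eventually.of_forall fun y => by simp [Marguerre.slice, sec]

/-- The inhomogeneous part of the characteristic of `w + f` at the slice through `z₀`. -/
noncomputable def inhomW (S : Equations) (X : Space → Space) (z₀ : Space) : Plane → ℝ :=
  fun y => slice (etaC X) z₀ y - (S.f y - S.f z₀.1) * slice (dd eW (etaC X)) z₀ y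
    + ∑ μ, slice (xiC X μ) z₀ y * pd μ S.f y

/-- The inhomogeneous part of the characteristic of `Φ` at the slice through `z₀`. -/
noncomputable def inhomΦ (S : Equations) (X : Space → Space) (z₀ : Space) : Plane → ℝ :=
  fun y => slice (phiC X) z₀ y - (S.f y - S.f z₀.1) * slice (dd eW (phiC X)) z₀ y

namespace Admissible

variable (h : Admissible S X M) (hf : ContDiff ℝ ∞ S.f)

section

variable {z₀ : Space} (hz : z₀ ∈ M)
include h hf hz

lemma smoothAt_inhomW : SmoothAt (inhomW S X z₀) z₀.1 :=
  ((h.eta hz).slice.sub ((hf.contDiffAt.sub contDiffAt_const).mul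
    ((h.eta hz).dd eW).slice)).add
    (ContDiffAt.sum fun μ _ => (h.xi hz μ).slice.mul (SmoothAt.pd hf.contDiffAt μ))

lemma smoothAt_inhomΦ : SmoothAt (inhomΦ S X z₀) z₀.1 :=
  (h.phi hz).slice.sub ((hf.contDiffAt.sub contDiffAt_const).mul ((h.phi hz).dd eW).slice)

/-- Near `z₀`, η is affine in (w, Φ), ξ depends on `x` only, and w = U − f + const. Substitution
turns the characteristic into an `affChar`, with the contributions of `f` collected in `inhomW`. The
last sum is the effect of `f` on the term `ξ^μ w_{,Jμ}` of the prolongation. -/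
lemma prW_test (h₀ h₁ h₂ l k₀ k₁ k₂ m : ℝ) (J : List (Fin 2)) :
    prW X (testW S z₀ (testPoly h₀ h₁ h₂ l)) (testΦ z₀ (testPoly k₀ k₁ k₂ m)) z₀.1 J =
      (pdL J (affChar (inhomW S X z₀) (slice (dd eW (etaC X)) z₀) (slice (dd eP (etaC X)) z₀)
        (fun μ => slice (xiC X μ) z₀) (ev z₀.1 (testPoly h₀ h₁ h₂ l))
        (ev z₀.1 (testPoly k₀ k₁ k₂ m)) (ev z₀.1 (testPoly h₀ h₁ h₂ l))) z₀.1
      + ∑ μ, slice (xiC X μ) z₀ z₀.1 * pdL J (pd μ (ev z₀.1 (testPoly h₀ h₁ h₂ l))) z₀.1)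
      - ∑ μ, slice (xiC X μ) z₀ z₀.1 * pdL J (pd μ S.f) z₀.1 := by
  set U := ev z₀.1 (testPoly h₀ h₁ h₂ l) with hU
  set V := ev z₀.1 (testPoly k₀ k₁ k₂ m) with hV
  have hw : SmoothAt (testW S z₀ (testPoly h₀ h₁ h₂ l)) z₀.1 := (contDiff_testW hf _ _).contDiffAt
  have hΦ : SmoothAt (testΦ z₀ (testPoly k₀ k₁ k₂ m)) z₀.1 := (contDiff_testΦ _ _).contDiffAt
  have hs := sec_test (S := S) z₀ h₀ h₁ h₂ l k₀ k₁ k₂ m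
  have hpd : ∀ μ, pd μ (testW S z₀ (testPoly h₀ h₁ h₂ l)) =ᶠ[𝓝 z₀.1]
      fun y => pd μ U y - pd μ S.f y := fun μ => by
    unfold testW
    rw [pd_add_const]
    exact dd_sub (smoothAt_ev _ _ _) hf.contDiffAt _
  have heta := eventually_sec hw hΦ (p := fun z => _) (by
    rw [hs]
    exact eventually_eq_affine_of_vertical h.isOpen (fun z hz => h.eta hz)
      (fun z hz => ⟨(h.dd_dd_eta z hz).2.1, (h.dd_dd_eta z hz).2.2.1,
        (h.dd_dd_eta z hz).2.2.2.2.1, (h.dd_dd_eta z hz).2.2.2.2.2⟩) hz)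
  have hxi := fun μ => eventually_sec hw hΦ (p := fun z => _) (by
    rw [hs]
    exact eventually_eq_of_vertical h.isOpen (fun z hz => h.xi hz μ) (h.dd_eW_xi μ)
      (h.dd_eP_xi μ) hz)
  have hchar : (fun y => etaC X (sec (testW S z₀ (testPoly h₀ h₁ h₂ l))
      (testΦ z₀ (testPoly k₀ k₁ k₂ m)) y) - ∑ μ, xiC X μ (sec (testW S z₀ (testPoly h₀ h₁ h₂ l))
      (testΦ z₀ (testPoly k₀ k₁ k₂ m)) y) * pd μ (testW S z₀ (testPoly h₀ h₁ h₂ l)) y)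
      =ᶠ[𝓝 z₀.1] affChar (inhomW S X z₀) (slice (dd eW (etaC X)) z₀) (slice (dd eP (etaC X)) z₀)
        (fun μ => slice (xiC X μ) z₀) U V U := by
    filter_upwards [heta, hxi 0, hxi 1, hpd 0, hpd 1] with y h1 h2 h3 h4 h5
    simp only [Fin.sum_univ_two, h1, h2, h3, h4, h5, affChar, inhomW, slice]
    simp only [sec, testW, testΦ, hU, hV]
    ring
  have hpd2 : ∀ μ, pdL J (pd μ (testW S z₀ (testPoly h₀ h₁ h₂ l))) z₀.1
      = pdL J (pd μ U) z₀.1 - pdL J (pd μ S.f) z₀.1 := fun μ => by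
    rw [(pdL_congr (hpd μ) J).eq_of_nhds,
      (pdL_sub ((smoothAt_ev _ _ _).pd μ) (SmoothAt.pd hf.contDiffAt μ) J).eq_of_nhds]
  rw [prW_eq, prCoeff, (pdL_congr hchar J).eq_of_nhds]
  simp only [hs, hpd2, Fin.sum_univ_two, slice]
  ring

lemma prΦ_test (h₀ h₁ h₂ l k₀ k₁ k₂ m : ℝ) (J : List (Fin 2)) :
    prΦ X (testW S z₀ (testPoly h₀ h₁ h₂ l)) (testΦ z₀ (testPoly k₀ k₁ k₂ m)) z₀.1 J =
      pdL J (affChar (inhomΦ S X z₀) (slice (dd eW (phiC X)) z₀) (slice (dd eP (phiC X)) z₀)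
        (fun μ => slice (xiC X μ) z₀) (ev z₀.1 (testPoly h₀ h₁ h₂ l))
        (ev z₀.1 (testPoly k₀ k₁ k₂ m)) (ev z₀.1 (testPoly k₀ k₁ k₂ m))) z₀.1
      + ∑ μ, slice (xiC X μ) z₀ z₀.1 * pdL J (pd μ (ev z₀.1 (testPoly k₀ k₁ k₂ m))) z₀.1 := by
  set U := ev z₀.1 (testPoly h₀ h₁ h₂ l) with hU
  set V := ev z₀.1 (testPoly k₀ k₁ k₂ m) with hV
  have hw : SmoothAt (testW S z₀ (testPoly h₀ h₁ h₂ l)) z₀.1 := (contDiff_testW hf _ _).contDiffAt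
  have hΦ : SmoothAt (testΦ z₀ (testPoly k₀ k₁ k₂ m)) z₀.1 := (contDiff_testΦ _ _).contDiffAt
  have hs := sec_test (S := S) z₀ h₀ h₁ h₂ l k₀ k₁ k₂ m
  have hpd : ∀ μ, pd μ (testΦ z₀ (testPoly k₀ k₁ k₂ m)) = pd μ V := fun μ => by
    unfold testΦ
    rw [pd_add_const]
  have hphi := eventually_sec hw hΦ (p := fun z => _) (by
    rw [hs]
    exact eventually_eq_affine_of_vertical h.isOpen (fun z hz => h.phi hz)
      (fun z hz => ⟨(h.dd_dd_phi z hz).2.2.2.2.1, (h.dd_dd_phi z hz).2.2.2.2.2,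
        (h.dd_dd_phi z hz).2.1, (h.dd_dd_phi z hz).2.2.1⟩) hz)
  have hxi := fun μ => eventually_sec hw hΦ (p := fun z => _) (by
    rw [hs]
    exact eventually_eq_of_vertical h.isOpen (fun z hz => h.xi hz μ) (h.dd_eW_xi μ)
      (h.dd_eP_xi μ) hz)
  have hchar : (fun y => phiC X (sec (testW S z₀ (testPoly h₀ h₁ h₂ l))
      (testΦ z₀ (testPoly k₀ k₁ k₂ m)) y) - ∑ μ, xiC X μ (sec (testW S z₀ (testPoly h₀ h₁ h₂ l))
      (testΦ z₀ (testPoly k₀ k₁ k₂ m)) y) * pd μ (testΦ z₀ (testPoly k₀ k₁ k₂ m)) y)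
      =ᶠ[𝓝 z₀.1] affChar (inhomΦ S X z₀) (slice (dd eW (phiC X)) z₀) (slice (dd eP (phiC X)) z₀)
        (fun μ => slice (xiC X μ) z₀) U V V := by
    filter_upwards [hphi, hxi 0, hxi 1] with y h1 h2 h3
    simp only [Fin.sum_univ_two, h1, h2, h3, hpd, affChar, inhomΦ, slice]
    simp only [sec, testW, testΦ, hU, hV]
    ring
  rw [prΦ_eq, prCoeff, (pdL_congr hchar J).eq_of_nhds]
  simp only [hs, hpd, slice]

/-- The Hessian part of the prolongation on a test section, cf. `hess_affChar`. -/
noncomputable def hessForm (G : Plane → ℝ) (ξ : Fin 2 → Plane → ℝ) (x : Plane)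
    (a b h₀ h₁ h₂ k₀ k₁ k₂ t₀ t₁ t₂ : ℝ) : Fin 2 → Fin 2 → ℝ := fun α β =>
  (!![pdL [0, 0] G x + a * h₀ + b * k₀ - 2 * (pdL [0] (ξ 0) x * t₀ + pdL [0] (ξ 1) x * t₁),
    pdL [0, 1] G x + a * h₁ + b * k₁ - (pdL [0] (ξ 0) x * t₁ + pdL [0] (ξ 1) x * t₂
      + pdL [1] (ξ 0) x * t₀ + pdL [1] (ξ 1) x * t₁);
    pdL [1, 0] G x + a * h₁ + b * k₁ - (pdL [0] (ξ 0) x * t₁ + pdL [0] (ξ 1) x * t₂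
      + pdL [1] (ξ 0) x * t₀ + pdL [1] (ξ 1) x * t₁),
    pdL [1, 1] G x + a * h₂ + b * k₂ - 2 * (pdL [1] (ξ 0) x * t₁ + pdL [1] (ξ 1) x * t₂)] :
    Matrix (Fin 2) (Fin 2) ℝ) α β

/-- The determining equations on the test sections. -/
lemma test_conditions (h₀ h₁ h₂ l k₀ k₁ k₂ m : ℝ)
    (hl : S.D * l = h₀ * k₂ + h₂ * k₀ - 2 * h₁ * k₁
      + S.D * deltaContr (fun J => pdL J S.f z₀.1) + S.p z₀.1)
    (hm : 1 / (S.E * S.h) * m = 1 / 2 * altContr (S.b z₀.1) (S.b z₀.1) - (h₀ * h₂ - h₁ ^ 2)) :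
    (S.D * (deltaContr (fun J => pdL J (inhomW S X z₀) z₀.1) + dd eW (etaC X) z₀ * l
        + dd eP (etaC X) z₀ * m + linA (slice (dd eW (etaC X)) z₀) z₀.1 h₀ h₁ h₂
        + linA (slice (dd eP (etaC X)) z₀) z₀.1 k₀ k₁ k₂ - 4 * dd (eX 0) (xiC X 0) z₀ * l
        - linX (fun μ => slice (xiC X μ) z₀) z₀.1 h₀ h₁ h₂
        - ∑ μ, xiC X μ z₀ * deltaContr (fun J => pdL J (pd μ S.f) z₀.1))
      - altContr (hessForm (inhomW S X z₀) (fun μ => slice (xiC X μ) z₀) z₀.1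
          (dd eW (etaC X) z₀) (dd eP (etaC X) z₀) h₀ h₁ h₂ k₀ k₁ k₂ h₀ h₁ h₂)
          (symForm k₀ k₁ k₂)
      - altContr (symForm h₀ h₁ h₂) (hessForm (inhomΦ S X z₀) (fun μ => slice (xiC X μ) z₀) z₀.1
          (dd eW (phiC X) z₀) (dd eP (phiC X) z₀) h₀ h₁ h₂ k₀ k₁ k₂ k₀ k₁ k₂)
      - ∑ μ, xiC X μ z₀ * pd μ S.p z₀.1 = 0) ∧
    (1 / (S.E * S.h) * (deltaContr (fun J => pdL J (inhomΦ S X z₀) z₀.1) + dd eW (phiC X) z₀ * l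
        + dd eP (phiC X) z₀ * m + linA (slice (dd eW (phiC X)) z₀) z₀.1 h₀ h₁ h₂
        + linA (slice (dd eP (phiC X)) z₀) z₀.1 k₀ k₁ k₂ - 4 * dd (eX 0) (xiC X 0) z₀ * m
        - linX (fun μ => slice (xiC X μ) z₀) z₀.1 k₀ k₁ k₂)
      + altContr (hessForm (inhomW S X z₀) (fun μ => slice (xiC X μ) z₀) z₀.1
          (dd eW (etaC X) z₀) (dd eP (etaC X) z₀) h₀ h₁ h₂ k₀ k₁ k₂ h₀ h₁ h₂)
          (symForm h₀ h₁ h₂)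
      - ∑ μ, xiC X μ z₀ * altContr (fun α β => pd μ (fun y => S.b y α β) z₀.1) (S.b z₀.1)
        = 0) := by
  set w := testW S z₀ (testPoly h₀ h₁ h₂ l) with hwdef
  set Φ := testΦ z₀ (testPoly k₀ k₁ k₂ m) with hΦdef
  have hs : sec w Φ z₀.1 = z₀ := sec_test z₀ h₀ h₁ h₂ l k₀ k₁ k₂ m
  have hHw : hess w z₀.1 = fun α β => symForm h₀ h₁ h₂ α β - S.b z₀.1 α β := by
    rw [hwdef, hess_testW hf]
    simp only [hess_testPoly]
  have hHΦ : hess Φ z₀.1 = symForm k₀ k₁ k₂ := by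
    rw [hΦdef]
    unfold testΦ
    rw [hess_add_const]
    ext α β
    rw [hess_testPoly]
  have hδw : deltaContr (fun J => pdL J w z₀.1)
      = l - deltaContr (fun J => pdL J S.f z₀.1) := by
    rw [hwdef, deltaContr_testW hf, deltaContr_testPoly]
  have hδΦ : deltaContr (fun J => pdL J Φ z₀.1) = m := by
    rw [hΦdef, deltaContr_testΦ, deltaContr_testPoly]
  -- Completing the square: [w, Φ] + [b, Φ] = [U, Φ] and ½[w, w] + [b, w] = ½[U, U] − ½[b, b] with U
  -- = w + f. The assumptions `hl` and `hm` are exactly the resulting equations.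
  have hsat : S.SatisfiedAt w Φ z₀.1 := by
    constructor
    · simp only [Equations.eq1, hHw, hHΦ, hδw]
      simp only [altContr_eq, symForm, Matrix.of_apply, Matrix.cons_val', Matrix.cons_val_zero,
        Matrix.cons_val_one, Matrix.cons_val_fin_one]
      linear_combination hl
    · simp only [Equations.eq2, hHw, hδΦ]
      rw [hm]
      simp only [altContr_eq, symForm, Matrix.of_apply, Matrix.cons_val', Matrix.cons_val_zero,
        Matrix.cons_val_one, Matrix.cons_val_fin_one]
      ring
  obtain ⟨c1, c2⟩ := h.admits z₀.1 w Φ (contDiff_testW hf _ _) (contDiff_testΦ _ _)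
    (by rwa [hs]) hsat
  have hG := h.smoothAt_inhomW hf hz
  have hK := h.smoothAt_inhomΦ hf hz
  have hA := ((h.eta hz).dd eW).slice
  have hB := ((h.eta hz).dd eP).slice
  have hC := ((h.phi hz).dd eW).slice
  have hE := ((h.phi hz).dd eP).slice
  have hξ := fun μ => (h.xi hz μ).slice
  have hxa : ∀ μ, xiAlong X w Φ μ z₀.1 = xiC X μ z₀ := fun μ =>
    congrArg (fun z => (X z).1 μ) hs
  have hW : ∀ α β, prW X w Φ z₀.1 [α, β] = hessForm (inhomW S X z₀)
      (fun μ => slice (xiC X μ) z₀) z₀.1 (dd eW (etaC X) z₀) (dd eP (etaC X) z₀)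
      h₀ h₁ h₂ k₀ k₁ k₂ h₀ h₁ h₂ α β - S.xib X w Φ z₀.1 α β := by
    intro α β
    rw [h.prW_test hf hz, hess_affChar _ _ _ _ _ _ _ _ _ _ _ _ hG hA hB hξ]
    simp only [Equations.xib, hxa]
    congr 1
    refine Finset.sum_congr rfl fun μ _ => ?_
    rw [(pd_pdL hf.contDiffAt μ [α, β]).eq_of_nhds]
    rfl
  have hP : ∀ α β, prΦ X w Φ z₀.1 [α, β] = hessForm (inhomΦ S X z₀)
      (fun μ => slice (xiC X μ) z₀) z₀.1 (dd eW (phiC X) z₀) (dd eP (phiC X) z₀)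
      h₀ h₁ h₂ k₀ k₁ k₂ k₀ k₁ k₂ α β := by
    intro α β
    rw [h.prΦ_test hf hz, hess_affChar _ _ _ _ _ _ _ _ _ _ _ _ hK hC hE hξ]
    rfl
  have hξ0 : pdL [0] (slice (xiC X 0) z₀) z₀.1 = dd (eX 0) (xiC X 0) z₀ :=
    (pd_slice (h.xi hz 0) 0).eq_of_nhds
  have hW4 : deltaContr (prW X w Φ z₀.1) = deltaContr (fun J => pdL J (inhomW S X z₀) z₀.1)
      + dd eW (etaC X) z₀ * l
      + dd eP (etaC X) z₀ * m + linA (slice (dd eW (etaC X)) z₀) z₀.1 h₀ h₁ h₂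
      + linA (slice (dd eP (etaC X)) z₀) z₀.1 k₀ k₁ k₂ - 4 * dd (eX 0) (xiC X 0) z₀ * l
      - linX (fun μ => slice (xiC X μ) z₀) z₀.1 h₀ h₁ h₂
      - ∑ μ, xiC X μ z₀ * deltaContr (fun J => pdL J (pd μ S.f) z₀.1) := by
    have e := deltaContr_affChar h₀ h₁ h₂ l k₀ k₁ k₂ m h₀ h₁ h₂ l hG hA hB hξ
    rw [hξ0] at e
    change _ = _ + dd eW (etaC X) z₀ * l + dd eP (etaC X) z₀ * m + _ + _ - _ - _ at e
    rw [← e]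
    simp only [deltaContr_eq, Fin.sum_univ_two, h.prW_test hf hz, hwdef, hΦdef]
    simp only [slice]
    ring
  have hP4 : deltaContr (prΦ X w Φ z₀.1) = deltaContr (fun J => pdL J (inhomΦ S X z₀) z₀.1)
      + dd eW (phiC X) z₀ * l
      + dd eP (phiC X) z₀ * m + linA (slice (dd eW (phiC X)) z₀) z₀.1 h₀ h₁ h₂
      + linA (slice (dd eP (phiC X)) z₀) z₀.1 k₀ k₁ k₂ - 4 * dd (eX 0) (xiC X 0) z₀ * m
      - linX (fun μ => slice (xiC X μ) z₀) z₀.1 k₀ k₁ k₂ := by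
    have e := deltaContr_affChar h₀ h₁ h₂ l k₀ k₁ k₂ m k₀ k₁ k₂ m hK hC hE hξ
    rw [hξ0] at e
    change _ = _ + dd eW (phiC X) z₀ * l + dd eP (phiC X) z₀ * m + _ + _ - _ - _ at e
    rw [← e]
    refine deltaContr_congr fun α β γ δ => h.prΦ_test hf hz _ _ _ _ _ _ _ _ _
  simp only [Equations.prEq1, hHw, hHΦ, hW, hP, hW4, hxa] at c1
  simp only [Equations.prEq2, hHw, hW, hP4] at c2
  constructor
  · simp only [altContr_eq] at c1 ⊢
    linear_combination c1
  -- The terms with `ξ^μ b_{,μ}` that pair with the Hessian of U cancel; only their bracket with `b`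
  -- is left.
  · have hxib : altContr (S.xib X w Φ z₀.1) (S.b z₀.1) = ∑ μ, xiC X μ z₀ *
        altContr (fun α β => pd μ (fun y => S.b y α β) z₀.1) (S.b z₀.1) := by
      simp only [Equations.xib, hxa, altContr_eq, Fin.sum_univ_two]
      ring
    rw [← hxib]
    simp only [altContr_eq] at c2 ⊢
    linear_combination c2

end

end Admissible

end TestSections

variable {S : Equations} {X : Space → Space} {M : Set Space}

lemma linA_zero (x : Plane) {A : Plane → ℝ} (hA : ∀ α β, pdL [α, β] A x = 0) (h₀ h₁ h₂ : ℝ) :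
    linA A x h₀ h₁ h₂ = 0 := by
  simp [linA, hA]

lemma linX_zero (x : Plane) {ξ : Fin 2 → Plane → ℝ} (hξ : ∀ μ α β γ, pdL [α, β, γ] (ξ μ) x = 0)
    (h₀ h₁ h₂ : ℝ) : linX ξ x h₀ h₁ h₂ = 0 := by
  simp [linX, hξ]

lemma pdL_slice {F : Space → ℝ} {z₀ : Space} (hF : SmoothAt F z₀) (J : List (Fin 2)) :
    pdL J (slice F z₀) =ᶠ[𝓝 z₀.1] slice (ddL (J.map eX) F) z₀ := by
  induction J with
  | nil => rfl
  | cons α J ih => exact (pd_congr ih α).trans (pd_slice (hF.ddL _) α)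

namespace Admissible

variable (h : Admissible S X M) (hf : ContDiff ℝ ∞ S.f)
include h hf

/-- Once `l` and `m` are eliminated, the test conditions are quadratic polynomials in the two
prescribed Hessians `h`, `k`. Adding the values at opposite arguments and subtracting twice the
value at zero isolates the quadratic part; the contributions of `linA` and `linX`, being linear,
drop out. -/
lemma vertical_eq_zero : ∀ z ∈ M, dd eW (etaC X) z = 0 ∧ dd eP (etaC X) z = 0 ∧
    dd eW (phiC X) z = 0 ∧ dd eP (phiC X) z = 0 := by
  intro z hz
  have hD := h.D_ne_zero
  have hE := h.Eh_ne_zero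
  -- Reciprocals are introduced through polynomial identities, so that `linear_combination` needs no
  -- division.
  obtain ⟨i, hi⟩ : ∃ i, S.D * i = 1 := ⟨S.D⁻¹, mul_inv_cancel₀ hD⟩
  have T := fun h₀ h₁ h₂ l k₀ k₁ k₂ m => h.test_conditions hf hz h₀ h₁ h₂ l k₀ k₁ k₂ m
  obtain ⟨s, hs⟩ : ∃ s, s = S.E * S.h := ⟨_, rfl⟩
  obtain ⟨κ, hκ⟩ : ∃ κ, κ = 1 / (S.E * S.h) := ⟨_, rfl⟩
  have hκs : κ * s = 1 := by rw [hκ, hs, one_div, inv_mul_cancel₀ hE]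
  have hs0 : s ≠ 0 := hs ▸ hE
  rw [← hκ] at T
  have hξ1 : pdL [1] (slice (xiC X 1) z) z.1 = dd (eX 0) (xiC X 0) z := by
    rw [(h.cauchyRiemann z hz).1]
    exact (pd_slice (h.xi hz 1) 1).eq_of_nhds
  have hξ0 : pdL [0] (slice (xiC X 0) z) z.1 = dd (eX 0) (xiC X 0) z :=
    (pd_slice (h.xi hz 0) 0).eq_of_nhds
  simp only [hessForm, altContr_eq, symForm, linA, linX, hξ0, hξ1, Matrix.of_apply,
    Matrix.cons_val', Matrix.cons_val_zero, Matrix.cons_val_one, Matrix.cons_val_fin_one] at T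
  set R : ℝ := 1 / 2 * (S.b z.1 0 0 * S.b z.1 1 1 + S.b z.1 1 1 * S.b z.1 0 0
    - S.b z.1 0 1 * S.b z.1 1 0 - S.b z.1 1 0 * S.b z.1 0 1) with hR
  set P : ℝ := S.D * deltaContr (fun J => pdL J S.f z.1) + S.p z.1 with hP
  have T0 := T 0 0 0 (P * i) 0 0 0 (R * s)
    (by linear_combination P * hi) (by linear_combination R * hκs)
  -- The identity form has determinant one: placed in `k` it leaves `m` unchanged, placed in `h` it
  -- lowers `R` by one. Since the other form is zero, `l` is unaffected.
  have Tk := T 0 0 0 (P * i) 1 0 1 (R * s)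
    (by linear_combination P * hi) (by linear_combination R * hκs)
  have Tk' := T 0 0 0 (P * i) (-1) 0 (-1) (R * s)
    (by linear_combination P * hi) (by linear_combination R * hκs)
  have Th := T 1 0 1 (P * i) 0 0 0 ((R - 1) * s)
    (by linear_combination P * hi) (by linear_combination (R - 1) * hκs)
  have Th' := T (-1) 0 (-1) (P * i) 0 0 0 ((R - 1) * s)
    (by linear_combination P * hi) (by linear_combination (R - 1) * hκs)
  -- Two degenerate forms with mixed bracket one: `m` is unchanged and `l` is raised.
  have Thk := T 1 0 0 ((P + 1) * i) 0 0 1 (R * s)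
    (by linear_combination (P + 1) * hi) (by linear_combination R * hκs)
  have Thk' := T (-1) 0 0 ((P + 1) * i) 0 0 (-1) (R * s)
    (by linear_combination (P + 1) * hi) (by linear_combination R * hκs)
  have hB : dd eP (etaC X) z = 0 := by
    linear_combination (-1 / 4) * (Tk.1 + Tk'.1 - 2 * T0.1)
  have hC : dd eW (phiC X) z = 0 := by
    linear_combination (-1 / 4) * (Th.1 + Th'.1 - 2 * T0.1) - S.D * s / 2 * hB
  -- Here η_w and the dilation cancel: `η_w − 4c` from the bilaplacian meets `−(η_w − 2c) − (φ_Φ −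
  -- 2c)` from the two brackets, leaving `−φ_Φ`.
  have hEE : dd eP (phiC X) z = 0 := by
    linear_combination (-1 / 2) * (Thk.1 + Thk'.1 - 2 * T0.1)
      + (dd eW (etaC X) z - 4 * dd (eX 0) (xiC X 0) z) * hi
  have hA : dd eW (etaC X) z = 0 := by
    linear_combination (1 / 4) * (Th.2 + Th'.2 - 2 * T0.2)
      + (dd eP (phiC X) z - 4 * dd (eX 0) (xiC X 0) z) / 2 * hκs + 1 / 2 * hEE
  exact ⟨hA, hB, hC, hEE⟩

/-- The dilation coefficient `ξ^1_{,1}` is locally constant. -/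
lemma dd_dilation_eq_zero (α : Fin 2) : ∀ z ∈ M, dd (eX α) (dd (eX 0) (xiC X 0)) z = 0 :=
  fun z hz => by
    rw [← (h.dd_dd_eta z hz).1 α]
    exact dd_eq_zero_of_eqOn h.isOpen (fun z hz => (h.vertical_eq_zero hf z hz).1) _ z hz

/-- By the Cauchy–Riemann equations every second derivative of ξ is, up to sign, a first derivative
of the dilation coefficient. -/
lemma dd_dd_xi (μ α β : Fin 2) : ∀ z ∈ M, dd (eX α) (dd (eX β) (xiC X μ)) z = 0 := by
  intro z hz
  have h1 := h.xi_harmonic z hz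
  have h0 := fun α => h.dd_dilation_eq_zero hf α z hz
  have c0 : dd (eX 1) (dd (eX 0) (xiC X 0)) z = dd (eX 0) (dd (eX 1) (xiC X 0)) z :=
    (dd_comm (h.xi hz 0) (eX 1) (eX 0)).eq_of_nhds
  have c1 : dd (eX 1) (dd (eX 0) (xiC X 1)) z = dd (eX 0) (dd (eX 1) (xiC X 1)) z :=
    (dd_comm (h.xi hz 1) (eX 1) (eX 0)).eq_of_nhds
  have c2 := dd_eqOn h.isOpen (fun z hz => (h.cauchyRiemann z hz).1) (eX 0) z hz
  simp only [h0, neg_zero] at h1 c0 c2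
  fin_cases μ <;> fin_cases α <;> fin_cases β <;>
  simp only [Fin.zero_eta, Fin.mk_one, h0, h1, c1, ← c0, ← c2]

omit hf in
lemma eventually_slice {p : Space → Prop} (hp : ∀ z ∈ M, p z) {z : Space} (hz : z ∈ M) :
    ∀ᶠ y in 𝓝 z.1, p (y, z.2) := by
  have : ContinuousAt (fun y : Plane => (y, z.2)) z.1 := by fun_prop
  exact (this.eventually (h.isOpen.mem_nhds hz)).mono fun y hy => hp _ hy

omit hf in
lemma pdL_slice_eq_zero {F : Space → ℝ} (hF : ∀ z ∈ M, F z = 0) {z : Space} (hz : z ∈ M)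
    (J : List (Fin 2)) : pdL J (slice F z) z.1 = 0 := by
  have h1 : slice F z =ᶠ[𝓝 z.1] fun _ => 0 := h.eventually_slice hF hz
  rw [(pdL_congr h1 J).eq_of_nhds]
  have : ∀ J : List (Fin 2), pdL J (fun _ => (0 : ℝ)) = fun _ => 0 := by
    intro J
    induction J with
    | nil => rfl
    | cons α J ih => rw [pdL, ih, pd_const]
  rw [this]

/-- The conditions that remain when the derivatives with respect to `w` and `Φ` vanish. -/
lemma slice_conditions : ∀ z ∈ M, (∀ α β, dd (eX α) (dd (eX β) (phiC X)) z = 0) ∧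
    (∀ α β, pdL [α, β] (fun y => slice (etaC X) z y
      + ∑ μ, slice (xiC X μ) z y * pd μ S.f y) z.1 = 0) ∧
    1 / (S.E * S.h) * deltaContr (fun J => pdL J (slice (phiC X) z) z.1)
      = 2 * dd (eX 0) (xiC X 0) z * altContr (S.b z.1) (S.b z.1)
        + ∑ μ, xiC X μ z * altContr (fun α β => pd μ (fun y => S.b y α β) z.1) (S.b z.1) := by
  intro z hz
  have hD := h.D_ne_zero
  have hE := h.Eh_ne_zero
  have hv := h.vertical_eq_zero hf
  have hG : inhomW S X z =ᶠ[𝓝 z.1] fun y => slice (etaC X) z y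
      + ∑ μ, slice (xiC X μ) z y * pd μ S.f y := by
    filter_upwards [h.eventually_slice (fun z hz => (hv z hz).1) hz] with y hy
    simp [inhomW, slice, hy]
  have hK : inhomΦ S X z =ᶠ[𝓝 z.1] slice (phiC X) z := by
    filter_upwards [h.eventually_slice (fun z hz => (hv z hz).2.2.1) hz] with y hy
    simp [inhomΦ, slice, hy]
  have T := fun h₀ h₁ h₂ l k₀ k₁ k₂ m => h.test_conditions hf hz h₀ h₁ h₂ l k₀ k₁ k₂ m
  obtain ⟨i, hi⟩ : ∃ i, S.D * i = 1 := ⟨S.D⁻¹, mul_inv_cancel₀ hD⟩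
  have hκs : 1 / (S.E * S.h) * (S.E * S.h) = 1 := by
    rw [one_div, inv_mul_cancel₀ hE]
  have hξ1 : pdL [1] (slice (xiC X 1) z) z.1 = dd (eX 0) (xiC X 0) z := by
    rw [(h.cauchyRiemann z hz).1]
    exact (pd_slice (h.xi hz 1) 1).eq_of_nhds
  have hξ0 : pdL [0] (slice (xiC X 0) z) z.1 = dd (eX 0) (xiC X 0) z :=
    (pd_slice (h.xi hz 0) 0).eq_of_nhds
  have hξ10 : pdL [0] (slice (xiC X 1) z) z.1 = -pdL [1] (slice (xiC X 0) z) z.1 := by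
    rw [(pdL_slice (h.xi hz 1) [0]).eq_of_nhds, (pdL_slice (h.xi hz 0) [1]).eq_of_nhds]
    exact (h.cauchyRiemann z hz).2
  have hX : ∀ a b c, linX (fun μ => slice (xiC X μ) z) z.1 a b c = 0 :=
    linX_zero z.1 fun μ α β γ => by
      have e := (pdL_slice (h.xi hz μ) [β, γ])
      have e1 := (pd_congr e α).eq_of_nhds
      simp only [pdL] at e1 ⊢
      rw [e1]
      exact h.pdL_slice_eq_zero (h.dd_dd_xi hf μ β γ) hz [α]
  have hA1 := linA_zero z.1 fun α β =>
    h.pdL_slice_eq_zero (fun z hz => (hv z hz).1) hz [α, β]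
  have hA2 := linA_zero z.1 fun α β =>
    h.pdL_slice_eq_zero (fun z hz => (hv z hz).2.1) hz [α, β]
  have hA3 := linA_zero z.1 fun α β =>
    h.pdL_slice_eq_zero (fun z hz => (hv z hz).2.2.1) hz [α, β]
  have hA4 := linA_zero z.1 fun α β =>
    h.pdL_slice_eq_zero (fun z hz => (hv z hz).2.2.2) hz [α, β]
  obtain ⟨v1, v2, v3, v4⟩ := hv z hz
  simp only [hX, hA1, hA2, hA3, hA4, v1, v2, v3, v4] at T
  have eG := fun J => (pdL_congr hG J).eq_of_nhds
  have eK := fun J => (pdL_congr hK J).eq_of_nhds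
  simp only [eG, eK] at T
  have hGs : SmoothAt (fun y => slice (etaC X) z y
      + ∑ μ, slice (xiC X μ) z y * pd μ S.f y) z.1 :=
    (h.smoothAt_inhomW hf hz).congr_of_eventuallyEq hG.symm
  set G : Plane → ℝ := fun y => slice (etaC X) z y + ∑ μ, slice (xiC X μ) z y * pd μ S.f y
    with hGdef
  set R : ℝ := 1 / 2 * altContr (S.b z.1) (S.b z.1) with hR
  set P : ℝ := S.D * deltaContr (fun J => pdL J S.f z.1) + S.p z.1 with hP
  have comm : ∀ {g : Plane → ℝ}, SmoothAt g z.1 → pdL [0, 1] g z.1 = pdL [1, 0] g z.1 :=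
    fun hg => (dd_comm hg (ex 0) (ex 1)).eq_of_nhds
  have cG := comm hGs
  have cK := comm (h.phi hz).slice
  -- Now one form is zero in each test, so the first equation is affine in the other. Differences
  -- from `T0` give the Hessians of `G` and of φ. The form (0, 1, 0) has determinant −1, hence `R +
  -- 1` in `H1`.
  have T0 := T 0 0 0 (P * i) 0 0 0 (R * (S.E * S.h))
    (by linear_combination P * hi) (by linear_combination R * hκs)
  have K0 := T 0 0 0 (P * i) 1 0 0 (R * (S.E * S.h))
    (by linear_combination P * hi) (by linear_combination R * hκs)
  have K1 := T 0 0 0 (P * i) 0 1 0 (R * (S.E * S.h))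
    (by linear_combination P * hi) (by linear_combination R * hκs)
  have K2 := T 0 0 0 (P * i) 0 0 1 (R * (S.E * S.h))
    (by linear_combination P * hi) (by linear_combination R * hκs)
  have H0 := T 1 0 0 (P * i) 0 0 0 (R * (S.E * S.h))
    (by linear_combination P * hi) (by linear_combination R * hκs)
  have H1 := T 0 1 0 (P * i) 0 0 0 ((R + 1) * (S.E * S.h))
    (by linear_combination P * hi) (by linear_combination (R + 1) * hκs)
  have H2 := T 0 0 1 (P * i) 0 0 0 (R * (S.E * S.h))
    (by linear_combination P * hi) (by linear_combination R * hκs)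
  simp only [altContr_eq (symForm _ _ _), altContr_eq _ (symForm _ _ _), hessForm,
    eG, eK, hξ0, hξ1, hξ10, symForm, Matrix.of_apply,
    Matrix.cons_val', Matrix.cons_val_zero, Matrix.cons_val_one, Matrix.cons_val_fin_one]
    at T0 K0 K1 K2 H0 H1 H2
  have g11 : pdL [1, 1] G z.1 = 0 := by linear_combination T0.1 - K0.1
  have g00 : pdL [0, 0] G z.1 = 0 := by linear_combination T0.1 - K2.1
  have g01 : pdL [0, 1] G z.1 = 0 := by linear_combination (K1.1 - T0.1 + cG) / 2
  have k11 : pdL [1, 1] (slice (phiC X) z) z.1 = 0 := by linear_combination T0.1 - H0.1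
  have k00 : pdL [0, 0] (slice (phiC X) z) z.1 = 0 := by linear_combination T0.1 - H2.1
  have k01 : pdL [0, 1] (slice (phiC X) z) z.1 = 0 := by
    linear_combination (H1.1 - T0.1 + cK) / 2
  have hsl := fun α β => (pdL_slice (h.phi hz) [α, β]).eq_of_nhds
  refine ⟨fun α β => (hsl α β).symm.trans ?_, fun α β => ?_, ?_⟩
  · fin_cases α <;> fin_cases β
    exacts [k00, k01, cK ▸ k01, k11]
  · fin_cases α <;> fin_cases β
    exacts [g00, g01, cG ▸ g01, g11]
  · linear_combination T0.2 + 4 * dd (eX 0) (xiC X 0) z * R * hκs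

/-- The compatibility condition on the base point transformation. -/
lemma xi_condition : ∀ z ∈ M, 2 * dd (eX 0) (xiC X 0) z * altContr (S.b z.1) (S.b z.1)
    + ∑ μ, xiC X μ z * altContr (fun α β => pd μ (fun y => S.b y α β) z.1) (S.b z.1) = 0 := by
  intro z hz
  rw [← (h.slice_conditions hf z hz).2.2, mul_eq_zero]
  right
  have : ∀ a b c d, pdL [a, b, c, d] (slice (phiC X) z) z.1 = 0 := fun a b c d => by
    have e := pdL_slice (h.phi hz) [c, d]
    have e1 := (pdL_congr e [a, b]).eq_of_nhds
    rw [← pdL_append] at e1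
    exact e1.trans (h.pdL_slice_eq_zero (fun z hz => (h.slice_conditions hf z hz).1 c d) hz [a, b])
  simp [deltaContr_eq, this]

end Admissible

/-! ### Rigidity of the surface sin x¹ sin x². -/

lemma pd_eq_of_hasDerivAt {g : Plane → ℝ} {x : Plane} {α : Fin 2} {d : ℝ}
    (hg : DifferentiableAt ℝ g x) (hd : HasDerivAt (fun s : ℝ => g (x + s • ex α)) d 0) :
    pd α g x = d :=
  HasDerivAt.unique (hg.hasFDerivAt.hasLineDerivAt (ex α)) hd

lemma hasDerivAt_pd {g : Plane → ℝ} {x : Plane} (hg : DifferentiableAt ℝ g x) (α : Fin 2) :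
    HasDerivAt (fun s : ℝ => g (x + s • ex α)) (pd α g x) 0 :=
  hg.hasFDerivAt.hasLineDerivAt (ex α)

/-- Serves to differentiate a relation that holds on an open set: the derivative computed term by
term must be zero. -/
lemma hasDerivAt_eq_zero_of_forall {U : Set Plane} (hU : IsOpen U) {g : Plane → ℝ}
    (hg : ∀ y ∈ U, g y = 0) {x : Plane} (hx : x ∈ U) {α : Fin 2} {d : ℝ}
    (hd : HasDerivAt (fun s : ℝ => g (x + s • ex α)) d 0) : d = 0 := by
  refine hd.unique ((hasDerivAt_const (0 : ℝ) (0 : ℝ)).congr_of_eventuallyEq ?_)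
  have : ContinuousAt (fun s : ℝ => x + s • ex α) 0 := by fun_prop
  exact (this.eventually (hU.mem_nhds (by simpa using hx))).mono fun s hs => hg _ hs

lemma hasDerivAt_coord (x : Plane) (α β : Fin 2) :
    HasDerivAt (fun s : ℝ => (x + s • ex α) β) (delta α β) 0 := by
  have : HasDerivAt (fun s : ℝ => x β + s * delta α β) (delta α β) 0 := by
    simpa using ((hasDerivAt_id (0 : ℝ)).mul_const (delta α β)).const_add (x β)
  convert this using 2 with s
  simp [ex, delta, Pi.single_apply, eq_comm]

lemma hasDerivAt_sin_coord (x : Plane) (k : ℝ) (α β : Fin 2) :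
    HasDerivAt (fun s : ℝ => Real.sin (k * (x + s • ex α) β))
      (k * delta α β * Real.cos (k * x β)) 0 := by
  have := (((hasDerivAt_coord x α β).const_mul k).sin)
  simp only [zero_smul, add_zero] at this
  convert this using 1
  ring

lemma hasDerivAt_cos_coord (x : Plane) (k : ℝ) (α β : Fin 2) :
    HasDerivAt (fun s : ℝ => Real.cos (k * (x + s • ex α) β))
      (-(k * delta α β * Real.sin (k * x β))) 0 := by
  have := (((hasDerivAt_coord x α β).const_mul k).cos)
  simp only [zero_smul, add_zero] at this
  convert this using 1
  ring

/-- An infinitesimal similarity of the plane that multiplies `cos 2x + cos 2y` by its dilation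
coefficient vanishes. -/
lemma similarity_eq_zero {U : Set Plane} (hU : IsOpen U) {ξ : Fin 2 → Plane → ℝ} {c r : Plane → ℝ}
    (hξ : ∀ y ∈ U, ∀ μ, DifferentiableAt ℝ (ξ μ) y) (hc : ∀ y ∈ U, DifferentiableAt ℝ c y)
    (hr : ∀ y ∈ U, DifferentiableAt ℝ r y)
    (h00 : ∀ y ∈ U, pd 0 (ξ 0) y = c y) (h11 : ∀ y ∈ U, pd 1 (ξ 1) y = c y)
    (h10 : ∀ y ∈ U, pd 1 (ξ 0) y = r y) (h01 : ∀ y ∈ U, pd 0 (ξ 1) y = -r y)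
    (hdc : ∀ y ∈ U, ∀ α, pd α c y = 0) (hdr : ∀ y ∈ U, ∀ α, pd α r y = 0)
    (hN : ∀ y ∈ U, ξ 0 y * Real.sin (2 * y 0) + ξ 1 y * Real.sin (2 * y 1)
      - 2 * c y * (Real.cos (2 * y 0) + Real.cos (2 * y 1)) = 0) :
    ∀ y ∈ U, ∀ μ, ξ μ y = 0 := by
  have dξ : ∀ y ∈ U, ∀ μ α, HasDerivAt (fun s : ℝ => ξ μ (y + s • ex α)) (pd α (ξ μ) y) 0 :=
    fun y hy μ α => hasDerivAt_pd (hξ y hy μ) α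
  have dc : ∀ y ∈ U, ∀ α, HasDerivAt (fun s : ℝ => c (y + s • ex α)) 0 0 :=
    fun y hy α => hdc y hy α ▸ hasDerivAt_pd (hc y hy) α
  have dr : ∀ y ∈ U, ∀ α, HasDerivAt (fun s : ℝ => r (y + s • ex α)) 0 0 :=
    fun y hy α => hdr y hy α ▸ hasDerivAt_pd (hr y hy) α
  have dS := fun y : Plane => hasDerivAt_sin_coord y 2
  have dC := fun y : Plane => hasDerivAt_cos_coord y 2
  -- First derivatives of the relation `hN`. Differentiating `N0` in the other direction leaves the
  -- rotation alone, and two further derivatives give its products with sin 2x¹ and cos 2x¹.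
  have N0 : ∀ y ∈ U, 5 * c y * Real.sin (2 * y 0) + 2 * ξ 0 y * Real.cos (2 * y 0)
      - r y * Real.sin (2 * y 1) = 0 := fun y hy => by
    have := hasDerivAt_eq_zero_of_forall hU hN hy
      ((((dξ y hy 0 0).mul (dS y 0 0)).add ((dξ y hy 1 0).mul (dS y 0 1))).sub
        (((dc y hy 0).const_mul 2).mul ((dC y 0 0).add (dC y 0 1))))
    simp [h00 y hy, h01 y hy, delta] at this
    linear_combination this
  have N1 : ∀ y ∈ U, 5 * c y * Real.sin (2 * y 1) + 2 * ξ 1 y * Real.cos (2 * y 1)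
      + r y * Real.sin (2 * y 0) = 0 := fun y hy => by
    have := hasDerivAt_eq_zero_of_forall hU hN hy
      ((((dξ y hy 0 1).mul (dS y 1 0)).add ((dξ y hy 1 1).mul (dS y 1 1))).sub
        (((dc y hy 1).const_mul 2).mul ((dC y 1 0).add (dC y 1 1))))
    simp [h10 y hy, h11 y hy, delta] at this
    linear_combination this
  have N01 : ∀ y ∈ U, r y * (Real.cos (2 * y 0) - Real.cos (2 * y 1)) = 0 := fun y hy => by
    have := hasDerivAt_eq_zero_of_forall hU N0 hy
      (((((dc y hy 1).const_mul 5).mul (dS y 1 0)).add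
        (((dξ y hy 0 1).const_mul 2).mul (dC y 1 0))).sub ((dr y hy 1).mul (dS y 1 1)))
    simp [h10 y hy, delta] at this
    linear_combination this / 2
  have N010 : ∀ y ∈ U, r y * Real.sin (2 * y 0) = 0 := fun y hy => by
    have := hasDerivAt_eq_zero_of_forall hU N01 hy
      ((dr y hy 0).mul ((dC y 0 0).sub (dC y 0 1)))
    simp [delta] at this
    rcases this with h | h <;> simp [h]
  have N0100 : ∀ y ∈ U, r y * Real.cos (2 * y 0) = 0 := fun y hy => by
    have := hasDerivAt_eq_zero_of_forall hU N010 hy ((dr y hy 0).mul (dS y 0 0))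
    simp [delta] at this
    rcases this with h | h <;> simp [h]
  have r0 : ∀ y ∈ U, r y = 0 := fun y hy => by
    linear_combination Real.sin (2 * y 0) * N010 y hy + Real.cos (2 * y 0) * N0100 y hy
      - r y * Real.sin_sq_add_cos_sq (2 * y 0)
  have N00 : ∀ y ∈ U, 12 * c y * Real.cos (2 * y 0) - 4 * ξ 0 y * Real.sin (2 * y 0) = 0 :=
    fun y hy => by
    have := hasDerivAt_eq_zero_of_forall hU N0 hy
      (((((dc y hy 0).const_mul 5).mul (dS y 0 0)).add
        (((dξ y hy 0 0).const_mul 2).mul (dC y 0 0))).sub ((dr y hy 0).mul (dS y 0 1)))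
    simp [h00 y hy, delta] at this
    linear_combination this
  have N11 : ∀ y ∈ U, 12 * c y * Real.cos (2 * y 1) - 4 * ξ 1 y * Real.sin (2 * y 1) = 0 :=
    fun y hy => by
    have := hasDerivAt_eq_zero_of_forall hU N1 hy
      (((((dc y hy 1).const_mul 5).mul (dS y 1 1)).add
        (((dξ y hy 1 1).const_mul 2).mul (dC y 1 1))).add ((dr y hy 1).mul (dS y 1 0)))
    simp [h11 y hy, delta] at this
    linear_combination this
  intro y hy
  have c0 : c y = 0 := by
    -- `N0` and its derivative `N00` combine to eliminate `ξ 0`: 10 sin² + 12 cos² = 10 + 2 cos² is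
    -- positive.
    have h1 : c y * (10 + 2 * Real.cos (2 * y 0) ^ 2) = 0 := by
      linear_combination 2 * Real.sin (2 * y 0) * N0 y hy + Real.cos (2 * y 0) * N00 y hy
        + 2 * Real.sin (2 * y 0) * Real.sin (2 * y 1) * r0 y hy
        - 10 * c y * Real.sin_sq_add_cos_sq (2 * y 0)
    exact (mul_eq_zero.1 h1).resolve_right (by positivity)
  have e0 := N0 y hy
  have e1 := N1 y hy
  have e00 := N00 y hy
  have e11 := N11 y hy
  simp only [c0, r0 y hy] at e0 e1 e00 e11
  intro μ
  fin_cases μ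
  · change ξ 0 y = 0
    linear_combination Real.cos (2 * y 0) / 2 * e0 - Real.sin (2 * y 0) / 4 * e00
      - ξ 0 y * Real.sin_sq_add_cos_sq (2 * y 0)
  · change ξ 1 y = 0
    linear_combination Real.cos (2 * y 1) / 2 * e1 - Real.sin (2 * y 1) / 4 * e11
      - ξ 1 y * Real.sin_sq_add_cos_sq (2 * y 1)

/-- The surface `sin x¹ sin x²`. -/
noncomputable def sinSin : Plane → ℝ := fun x => Real.sin (x 0) * Real.sin (x 1)

lemma contDiff_sinSin : ContDiff ℝ ∞ sinSin := by
  unfold sinSin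
  fun_prop

lemma pd_zero_mul {a a' b : ℝ → ℝ} (ha : ∀ t, HasDerivAt a (a' t) t)
    (hb : ∀ t, DifferentiableAt ℝ b t) :
    pd 0 (fun x => a (x 0) * b (x 1)) = fun x => a' (x 0) * b (x 1) := by
  ext x
  have h0 := hasDerivAt_coord x 0 0
  refine pd_eq_of_hasDerivAt (((ha _).differentiableAt.comp x (by fun_prop)).mul
    ((hb _).comp x (by fun_prop))) ?_
  simp only [ex, Pi.add_apply, Pi.smul_apply, Pi.single_eq_same, ne_eq, one_ne_zero,
    not_false_eq_true, Pi.single_eq_of_ne, smul_eq_mul, mul_one, mul_zero, add_zero]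
  refine HasDerivAt.mul_const ?_ _
  have := (ha (x 0 + 0)).comp_const_add (x 0) 0
  simpa using this

lemma pd_one_mul {a b b' : ℝ → ℝ} (ha : ∀ t, DifferentiableAt ℝ a t)
    (hb : ∀ t, HasDerivAt b (b' t) t) :
    pd 1 (fun x => a (x 0) * b (x 1)) = fun x => a (x 0) * b' (x 1) := by
  ext x
  refine pd_eq_of_hasDerivAt (((ha _).comp x (by fun_prop)).mul
    ((hb _).differentiableAt.comp x (by fun_prop))) ?_
  simp only [ex, Pi.add_apply, Pi.smul_apply, Pi.single_eq_same, ne_eq, zero_ne_one,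
    not_false_eq_true, Pi.single_eq_of_ne, smul_eq_mul, mul_one, mul_zero, add_zero]
  refine HasDerivAt.const_mul _ ?_
  have := (hb (x 1 + 0)).comp_const_add (x 1) 0
  simpa using this

section SinSin

variable {S : Equations} (hS : S.f = sinSin)
include hS

lemma b_sinSin (x : Plane) :
    S.b x 0 0 = -(Real.sin (x 0) * Real.sin (x 1)) ∧ S.b x 1 1 = -(Real.sin (x 0) * Real.sin (x 1)) ∧
    S.b x 0 1 = Real.cos (x 0) * Real.cos (x 1) ∧ S.b x 1 0 = Real.cos (x 0) * Real.cos (x 1) := by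
  simp only [Equations.b, hess, hS, pdL]
  unfold sinSin
  rw [pd_zero_mul Real.hasDerivAt_sin fun t => Real.differentiableAt_sin,
    pd_one_mul (fun t => Real.differentiableAt_sin) Real.hasDerivAt_sin,
    pd_zero_mul Real.hasDerivAt_cos fun t => Real.differentiableAt_sin,
    pd_one_mul (fun t => Real.differentiableAt_sin) Real.hasDerivAt_cos,
    pd_one_mul (fun t => Real.differentiableAt_cos) Real.hasDerivAt_sin,
    pd_zero_mul Real.hasDerivAt_sin fun t => Real.differentiableAt_cos]
  simp

lemma pd_b_sinSin (x : Plane) :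
    (∀ α, pd 0 (fun y => S.b y α α) x = -(Real.cos (x 0) * Real.sin (x 1))) ∧
    (∀ α, pd 1 (fun y => S.b y α α) x = -(Real.sin (x 0) * Real.cos (x 1))) ∧
    pd 0 (fun y => S.b y 0 1) x = -(Real.sin (x 0) * Real.cos (x 1)) ∧
    pd 0 (fun y => S.b y 1 0) x = -(Real.sin (x 0) * Real.cos (x 1)) ∧
    pd 1 (fun y => S.b y 0 1) x = -(Real.cos (x 0) * Real.sin (x 1)) ∧
    pd 1 (fun y => S.b y 1 0) x = -(Real.cos (x 0) * Real.sin (x 1)) := by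
  have hb : ∀ α, (fun y => S.b y α α) = fun y => -Real.sin (y 0) * Real.sin (y 1) := fun α => by
    ext y
    fin_cases α
    · simp [(b_sinSin hS y).1]
    · simp [(b_sinSin hS y).2.1]
  simp only [hb, (b_sinSin hS _).2.2.1, (b_sinSin hS _).2.2.2]
  rw [pd_zero_mul (a := fun t => -Real.sin t) (fun t => (Real.hasDerivAt_sin t).neg)
      fun t => Real.differentiableAt_sin,
    pd_one_mul (a := fun t => -Real.sin t) (fun t => Real.differentiableAt_sin.neg)
      Real.hasDerivAt_sin,
    pd_zero_mul Real.hasDerivAt_cos fun t => Real.differentiableAt_cos,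
    pd_one_mul (fun t => Real.differentiableAt_cos) Real.hasDerivAt_cos]
  simp

/-- The bracket of a symmetric form with itself is twice its determinant, and sin² x¹ sin² x² − cos²
x¹ cos² x² = −½(cos 2x¹ + cos 2x²). -/
lemma altContr_b_sinSin (x : Plane) : 2 * altContr (S.b x) (S.b x) =
    -2 * (Real.cos (2 * x 0) + Real.cos (2 * x 1)) := by
  obtain ⟨h1, h2, h3, h4⟩ := b_sinSin hS x
  simp only [altContr_eq, h1, h2, h3, h4, Real.cos_two_mul]
  linear_combination 4 * (Real.sin (x 1) ^ 2) * Real.sin_sq_add_cos_sq (x 0)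
    + (4 - 4 * Real.cos (x 0) ^ 2) * Real.sin_sq_add_cos_sq (x 1)

lemma altContr_pd_b_sinSin (x : Plane) :
    altContr (fun α β => pd 0 (fun y => S.b y α β) x) (S.b x) = Real.sin (2 * x 0) ∧
    altContr (fun α β => pd 1 (fun y => S.b y α β) x) (S.b x) = Real.sin (2 * x 1) := by
  obtain ⟨h1, h2, h3, h4⟩ := b_sinSin hS x
  obtain ⟨k1, k2, k3, k4, k5, k6⟩ := pd_b_sinSin hS x
  simp only [altContr_eq, h1, h2, h3, h4, k1, k2, k3, k4, k5, k6, Real.sin_two_mul]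
  constructor
  · linear_combination 2 * Real.sin (x 0) * Real.cos (x 0) * Real.sin_sq_add_cos_sq (x 1)
  · linear_combination 2 * Real.sin (x 1) * Real.cos (x 1) * Real.sin_sq_add_cos_sq (x 0)

end SinSin

namespace Admissible

variable {S : Equations} {X : Space → Space} {M : Set Space} (h : Admissible S X M)
  (hS : S.f = sinSin)
include h hS

/-- On each horizontal slice of `M`, ξ is an infinitesimal similarity whose dilation and rotation
coefficients have zero gradient, and `xi_condition` is the relation required by
`similarity_eq_zero`. -/
lemma xi_eq_zero : ∀ z ∈ M, ∀ μ, xiC X μ z = 0 := by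
  have hf : ContDiff ℝ ∞ S.f := hS ▸ contDiff_sinSin
  intro z hz
  have hsl : ∀ (F : Space → ℝ), (∀ z ∈ M, SmoothAt F z) → ∀ y ∈ {y : Plane | (y, z.2) ∈ M}, ∀ α,
      DifferentiableAt ℝ (slice F z) y ∧ pd α (slice F z) y = dd (eX α) F (y, z.2) :=
    fun F hF y hy α => by
      have := SmoothAt.slice (hF _ hy)
      exact ⟨this.differentiableAt, (pd_slice (hF _ hy) α).eq_of_nhds⟩
  have hU : IsOpen {y : Plane | (y, z.2) ∈ M} := h.isOpen.preimage (by fun_prop)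
  refine similarity_eq_zero hU (ξ := fun μ => slice (xiC X μ) z)
    (c := slice (dd (eX 0) (xiC X 0)) z) (r := slice (dd (eX 1) (xiC X 0)) z)
    (fun y hy μ => (hsl _ (fun z hz => h.xi hz μ) y hy 0).1)
    (fun y hy => (hsl _ (fun z hz => (h.xi hz 0).dd _) y hy 0).1)
    (fun y hy => (hsl _ (fun z hz => (h.xi hz 0).dd _) y hy 0).1)
    (fun y hy => (hsl _ (fun z hz => h.xi hz 0) y hy 0).2)
    (fun y hy => (hsl _ (fun z hz => h.xi hz 1) y hy 1).2.trans (h.cauchyRiemann _ hy).1.symm)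
    (fun y hy => (hsl _ (fun z hz => h.xi hz 0) y hy 1).2)
    (fun y hy => (hsl _ (fun z hz => h.xi hz 1) y hy 0).2.trans (h.cauchyRiemann _ hy).2)
    (fun y hy α => (hsl _ (fun z hz => (h.xi hz 0).dd _) y hy α).2.trans
      (h.dd_dd_xi hf 0 α 0 _ hy))
    (fun y hy α => (hsl _ (fun z hz => (h.xi hz 0).dd _) y hy α).2.trans
      (h.dd_dd_xi hf 0 α 1 _ hy))
    (fun y hy => ?_) z.1 hz
  have e := h.xi_condition hf _ hy
  have e1 := altContr_b_sinSin hS y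
  obtain ⟨e2, e3⟩ := altContr_pd_b_sinSin hS y
  simp only [Fin.sum_univ_two] at e
  simp only [slice]
  linear_combination e - dd (eX 0) (xiC X 0) (y, z.2) * e1 - xiC X 0 (y, z.2) * e2
    - xiC X 1 (y, z.2) * e3

end Admissible

/-! ### From vanishing second derivatives to affine functions. -/

section Affine

variable {E : Type*} [NormedAddCommGroup E] [NormedSpace ℝ E]

lemma exists_eq_const_of_dd_eq_zero {ι : Type*} {e : ι → E} (he : Submodule.span ℝ (range e) = ⊤)
    {M : Set E} (hM : IsOpen M) (hMc : IsPreconnected M) {G : E → ℝ}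
    (hG : ∀ z ∈ M, DifferentiableAt ℝ G z) (hd : ∀ z ∈ M, ∀ i, dd (e i) G z = 0) :
    ∃ a, ∀ z ∈ M, G z = a := by
  refine hM.exists_is_const_of_fderiv_eq_zero hMc
    (fun z hz => (hG z hz).differentiableWithinAt) fun z hz => ?_
  have := LinearMap.ext_on_range (f := (fderiv ℝ G z).toLinearMap) (g := 0) he (hd z hz)
  ext v
  exact LinearMap.congr_fun this v

lemma span_ex : Submodule.span ℝ (range ex) = ⊤ := by
  rw [eq_top_iff]
  rintro v -
  have : v = v 0 • ex 0 + v 1 • ex 1 := by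
    ext i
    fin_cases i <;> simp [ex]
  rw [this]
  exact add_mem (Submodule.smul_mem _ _ (Submodule.subset_span ⟨0, rfl⟩))
    (Submodule.smul_mem _ _ (Submodule.subset_span ⟨1, rfl⟩))

lemma span_coordinate_vectors :
    Submodule.span ℝ (range (![eX 0, eX 1, eW, eP] : Fin 4 → Space)) = ⊤ := by
  rw [eq_top_iff]
  rintro ⟨v, a, b⟩ -
  have : ((v, a, b) : Space) = v 0 • eX 0 + v 1 • eX 1 + a • eW + b • eP := by
    refine Prod.ext ?_ (Prod.ext ?_ ?_)
    · ext i
      fin_cases i <;> simp [eX, eW, eP]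
    · simp [eX, eW, eP]
    · simp [eX, eW, eP]
  rw [this]
  exact add_mem (add_mem (add_mem
    (Submodule.smul_mem _ _ (Submodule.subset_span ⟨0, rfl⟩))
    (Submodule.smul_mem _ _ (Submodule.subset_span ⟨1, rfl⟩)))
    (Submodule.smul_mem _ _ (Submodule.subset_span ⟨2, rfl⟩)))
    (Submodule.smul_mem _ _ (Submodule.subset_span ⟨3, rfl⟩))

lemma exists_eq_affine_of_pd {U : Set Plane} (hU : IsOpen U) (hUc : IsPreconnected U)
    {g : Plane → ℝ} (hg : ∀ y ∈ U, SmoothAt g y)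
    (hd : ∀ y ∈ U, ∀ α β, pdL [α, β] g y = 0) :
    ∃ a b c : ℝ, ∀ y ∈ U, g y = a * y 0 + b * y 1 + c := by
  choose b hb using fun β => exists_eq_const_of_dd_eq_zero span_ex hU hUc
    (G := pd β g) (fun y hy => ((hg y hy).pd β).differentiableAt) (fun y hy α => hd y hy α β)
  have hcoord : ∀ β (y : Plane), SmoothAt (fun y : Plane => y β) y :=
    fun β y => ContDiff.contDiffAt (by fun_prop)
  have hp : ∀ (β : Fin 2) y, SmoothAt (fun y : Plane => b β * y β) y :=
    fun β y => contDiffAt_const.mul (hcoord β y)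
  obtain ⟨c, hc⟩ := exists_eq_const_of_dd_eq_zero span_ex hU hUc
    (G := fun y => g y - (b 0 * y 0 + b 1 * y 1))
    (fun y hy => SmoothAt.differentiableAt ((hg y hy).sub ((hp 0 y).add (hp 1 y)))) (fun y hy α => by
      have e : ∀ β, dd (ex α) (fun y : Plane => b β * y β) y = b β * delta α β := fun β => by
        rw [(dd_const_mul (b β) (hcoord β y) (ex α)).eq_of_nhds]
        congr 1
        exact pd_eq_of_hasDerivAt (hcoord β y).differentiableAt (hasDerivAt_coord y α β)
      rw [(dd_sub (hg y hy) ((hp 0 y).add (hp 1 y)) _).eq_of_nhds,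
        (dd_add (hp 0 y) (hp 1 y) _).eq_of_nhds, e, e]
      have := hb α y hy
      rw [pd_eq_dd] at this
      rw [this]
      fin_cases α <;> simp [delta])
  exact ⟨b 0, b 1, c, fun y hy => by linear_combination hc y hy⟩

/-- The derivatives `∂_β F` have zero derivative in all four directions, the vertical ones by
symmetry. They are therefore constant on the preconnected set `M`, and subtracting the corresponding
linear function leaves a constant. -/
lemma exists_eq_affine_of_dd {M : Set Space} (hM : IsOpen M) (hMc : IsPreconnected M)
    {F : Space → ℝ} (hF : ∀ z ∈ M, SmoothAt F z)
    (hW : ∀ z ∈ M, dd eW F z = 0) (hP : ∀ z ∈ M, dd eP F z = 0)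
    (hd : ∀ z ∈ M, ∀ α β, dd (eX α) (dd (eX β) F) z = 0) :
    ∃ a b c : ℝ, ∀ z ∈ M, F z = a + b * z.1 0 + c * z.1 1 := by
  have hcomm : ∀ v, (∀ z ∈ M, dd v F z = 0) → ∀ z ∈ M, ∀ β, dd v (dd (eX β) F) z = 0 :=
    fun v hv z hz β => by
      rw [(dd_comm (hF z hz) v (eX β)).eq_of_nhds]
      exact dd_eq_zero_of_eqOn hM hv _ z hz
  choose b hb using fun β => exists_eq_const_of_dd_eq_zero span_coordinate_vectors hM hMc
    (G := dd (eX β) F) (fun z hz => ((hF z hz).dd _).differentiableAt) (fun z hz i => by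
      fin_cases i
      exacts [hd z hz 0 β, hd z hz 1 β, hcomm _ hW z hz β, hcomm _ hP z hz β])
  have hcoord : ∀ β (z : Space), SmoothAt (fun z : Space => z.1 β) z :=
    fun β y => ContDiff.contDiffAt (by fun_prop)
  have hp : ∀ (β : Fin 2) z, SmoothAt (fun z : Space => b β * z.1 β) z :=
    fun β y => contDiffAt_const.mul (hcoord β y)
  obtain ⟨c, hc⟩ := exists_eq_const_of_dd_eq_zero span_coordinate_vectors hM hMc
    (G := fun z => F z - (b 0 * z.1 0 + b 1 * z.1 1))
    (fun z hz => SmoothAt.differentiableAt ((hF z hz).sub ((hp 0 z).add (hp 1 z)))) (fun z hz i => by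
      have e : ∀ v : Space, ∀ β, dd v (fun z : Space => b β * z.1 β) z = b β * v.1 β :=
        fun v β => by
        rw [(dd_const_mul (b β) (hcoord β z) v).eq_of_nhds]
        congr 1
        have : HasFDerivAt (fun z : Space => z.1 β)
          ((ContinuousLinearMap.proj β).comp (ContinuousLinearMap.fst ℝ Plane (ℝ × ℝ))) z :=
          ((ContinuousLinearMap.proj β).comp
            (ContinuousLinearMap.fst ℝ Plane (ℝ × ℝ))).hasFDerivAt
        rw [dd, this.fderiv]
        rfl
      rw [(dd_sub (hF z hz) ((hp 0 z).add (hp 1 z)) _).eq_of_nhds,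
        (dd_add (hp 0 z) (hp 1 z) _).eq_of_nhds, e, e]
      fin_cases i
      · simp [eX, ← hb 0 z hz]
      · simp [eX, ← hb 1 z hz]
      · simp [hW z hz, eW]
      · simp [hP z hz, eP])
  exact ⟨c, b 0, b 1, fun z hz => by linear_combination hc z hz⟩

end Affine

/-! ### The algebra `L₀` and the group `G₀` in coordinates. -/

/-- The vector field in `L₀` with coefficients `c`. -/
def affineField (c : Fin 6 → ℝ) : Space → Space := fun z =>
  (0, c 0 + c 1 * z.1 0 + c 2 * z.1 1, c 3 + c 4 * z.1 0 + c 5 * z.1 1)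

lemma sum_smul_kernelField (c : Fin 6 → ℝ) : ∑ i, c i • kernelField i = affineField c := by
  ext z
  · simp [Fin.sum_univ_six, kernelField, affineField]
  · simp [Fin.sum_univ_six, kernelField, affineField]
  · simp [Fin.sum_univ_six, kernelField, affineField]

lemma mem_kernelAlgebra_iff {X : Space → Space} : X ∈ kernelAlgebra ↔ ∃ c, affineField c = X := by
  simp only [kernelAlgebra, Submodule.mem_span_range_iff_exists_fun, sum_smul_kernelField]

/-- Once ξ = 0, the condition on η + ξ^μ f_{,μ} says that η itself has zero Hessian in `x`. -/
lemma Admissible.exists_eqOn_kernelAlgebra {S : Equations} {X : Space → Space} {M : Set Space}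
    (h : Admissible S X M) (hS : S.f = sinSin) (hMc : IsPreconnected M) :
    ∃ X₀ ∈ kernelAlgebra, EqOn X X₀ M := by
  have hf : ContDiff ℝ ∞ S.f := hS ▸ contDiff_sinSin
  have hξ := h.xi_eq_zero hS
  have hv := h.vertical_eq_zero hf
  have hs := h.slice_conditions hf
  have hη : ∀ z ∈ M, ∀ α β, dd (eX α) (dd (eX β) (etaC X)) z = 0 := fun z hz α β => by
    have e : (fun y => slice (etaC X) z y + ∑ μ, slice (xiC X μ) z y * pd μ S.f y)
        =ᶠ[𝓝 z.1] slice (etaC X) z := by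
      filter_upwards [h.eventually_slice hξ hz] with _ hy
      simp [slice, hy]
    have := (hs z hz).2.1 α β
    rw [(pdL_congr e _).eq_of_nhds, (pdL_slice (h.eta hz) _).eq_of_nhds] at this
    exact this
  obtain ⟨a, b, c, h1⟩ := exists_eq_affine_of_dd h.isOpen hMc (fun z hz => h.eta hz)
    (fun z hz => (hv z hz).1) (fun z hz => (hv z hz).2.1) hη
  obtain ⟨a', b', c', h2⟩ := exists_eq_affine_of_dd h.isOpen hMc (fun z hz => h.phi hz)
    (fun z hz => (hv z hz).2.2.1) (fun z hz => (hv z hz).2.2.2) fun z hz => (hs z hz).1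
  refine ⟨_, mem_kernelAlgebra_iff.2 ⟨![a, b, c, a', b', c'], rfl⟩, fun z hz => ?_⟩
  refine Prod.ext (funext fun μ => hξ z hz μ) (Prod.ext ((h1 z hz).trans ?_)
    ((h2 z hz).trans ?_)) <;> simp [affineField]

lemma pdL_eq_pdL_of_eqOn {U : Set Plane} (hU : IsOpen U) {g k : Plane → ℝ} (h : EqOn g k U)
    (J : List (Fin 2)) : EqOn (pdL J g) (pdL J k) U := fun _ hy =>
  (pdL_congr (h.eventuallyEq_of_mem (hU.mem_nhds hy)) J).eq_of_nhds

/-- Contracting the curvature equations with `b` and inserting the compatibility equation eliminates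
η. The rotation drops out of the contraction, and what remains is again 2c[b, b] + ξ^μ[b_{,μ}, b] =
0. -/
lemma Equations.DeterminingSystem.eq_affine {S : Equations} (hS : S.f = sinSin) {Ω : Set Plane}
    (hΩ : IsOpen Ω) (hΩc : IsPreconnected Ω) {ξ : Fin 2 → Plane → ℝ} {η φ : Plane → ℝ}
    (h : S.DeterminingSystem Ω ξ η φ) :
    ∃ A₁ A₂ A₃ B₁ B₂ B₃ : ℝ, ∀ x ∈ Ω, (∀ μ, ξ μ x = 0) ∧
      η x = A₁ * x 0 + A₂ * x 1 + A₃ ∧ φ x = B₁ * x 0 + B₂ * x 1 + B₃ := by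
  obtain ⟨C₁, C₂, C₃, C₄, hξ⟩ := h.xi
  obtain ⟨B₁, B₂, B₃, hφ⟩ := h.phi
  have hp : ∀ (a b c : ℝ) (x : Plane), pd 0 (fun y : Plane => a * y 0 + b * y 1 + c) x = a ∧
      pd 1 (fun y : Plane => a * y 0 + b * y 1 + c) x = b := fun a b c x => by
    have hd : DifferentiableAt ℝ (fun y : Plane => a * y 0 + b * y 1 + c) x := by fun_prop
    have e := fun α => (((hasDerivAt_coord x α 0).const_mul a).add
      ((hasDerivAt_coord x α 1).const_mul b)).add_const c
    exact ⟨by simpa [delta] using pd_eq_of_hasDerivAt hd (e 0),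
      by simpa [delta] using pd_eq_of_hasDerivAt hd (e 1)⟩
  have e0 : EqOn (ξ 0) (fun y => C₁ * y 0 + C₂ * y 1 + C₃) Ω := fun x hx => (hξ x hx).1
  have e1 : EqOn (ξ 1) (fun y => -C₂ * y 0 + C₁ * y 1 + C₄) Ω := fun x hx => (hξ x hx).2
  have d0 := fun α => pdL_eq_pdL_of_eqOn hΩ e0 [α]
  have d1 := fun α => pdL_eq_pdL_of_eqOn hΩ e1 [α]
  have p00 : ∀ x ∈ Ω, pd 0 (ξ 0) x = C₁ := fun x hx => (d0 0 hx).trans (hp _ _ _ x).1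
  have p10 : ∀ x ∈ Ω, pd 1 (ξ 0) x = C₂ := fun x hx => (d0 1 hx).trans (hp _ _ _ x).2
  have p01 : ∀ x ∈ Ω, pd 0 (ξ 1) x = -C₂ := fun x hx => (d1 0 hx).trans (hp _ _ _ x).1
  have p11 : ∀ x ∈ Ω, pd 1 (ξ 1) x = C₁ := fun x hx => (d1 1 hx).trans (hp _ _ _ x).2
  have hξ0 : ∀ x ∈ Ω, ∀ μ, ξ μ x = 0 := by
    refine similarity_eq_zero hΩ (c := fun _ => C₁) (r := fun _ => C₂) (fun x hx μ => ?_)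
      (fun x hx => by fun_prop) (fun x hx => by fun_prop) p00 p11 p10 p01
      (fun x _ α => by rw [pd_const]) (fun x _ α => by rw [pd_const]) fun x hx => ?_
    · have ha : ∀ a b c : ℝ, DifferentiableAt ℝ (fun y : Plane => a * y 0 + b * y 1 + c) x :=
        fun a b c => by fun_prop
      fin_cases μ
      · exact (ha _ _ _).congr_of_eventuallyEq (e0.eventuallyEq_of_mem (hΩ.mem_nhds hx))
      · exact (ha _ _ _).congr_of_eventuallyEq (e1.eventuallyEq_of_mem (hΩ.mem_nhds hx))
    · have a0 := altContr_b_sinSin hS x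
      obtain ⟨a1, a2⟩ := altContr_pd_b_sinSin hS x
      obtain ⟨b1, b2, b3, b4⟩ := b_sinSin hS x
      have hc := h.curvature x hx
      have hk := h.compat x hx
      have c00 := hc 0 0
      have c01 := hc 0 1
      have c10 := hc 1 0
      have c11 := hc 1 1
      simp only [Fin.sum_univ_two, p00 x hx, p01 x hx, p10 x hx, p11 x hx, b1, b2, b3, b4]
        at c00 c01 c10 c11
      simp only [altContr_eq, b1, b2, b3, b4] at hk a0 a1 a2
      linear_combination -(Real.sin (x 0) * Real.sin (x 1)) * (c00 + c11)
        - Real.cos (x 0) * Real.cos (x 1) * (c10 + c01) - hk - ξ 0 x * a1 - ξ 1 x * a2 - C₁ * a0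
  have hηs : ∀ x ∈ Ω, SmoothAt η x := fun x hx => h.eta.contDiffAt (hΩ.mem_nhds hx)
  obtain ⟨A₁, A₂, A₃, hη⟩ := exists_eq_affine_of_pd hΩ hΩc hηs fun x hx α β => by
    have hc := h.curvature x hx α β
    -- As ξ vanishes on `Ω`, so do its derivatives `C₁` and `C₂`; the curvature equation then
    -- reduces to `η_{,αβ} = 0`.
    have hC₁ : C₁ = 0 := by
      rw [← p00 x hx]
      exact (pdL_eq_pdL_of_eqOn hΩ (k := fun _ => 0) (fun x hx => hξ0 x hx 0) [0] hx).trans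
        (congrFun (pd_const 0 0) x)
    have hC₂ : C₂ = 0 := by
      rw [← p10 x hx]
      exact (pdL_eq_pdL_of_eqOn hΩ (k := fun _ => 0) (fun x hx => hξ0 x hx 0) [1] hx).trans
        (congrFun (pd_const 0 1) x)
    have hpd : ∀ μ ν, pd μ (ξ ν) x = 0 := fun μ ν => by
      fin_cases μ <;> fin_cases ν <;> simp [p00 x hx, p01 x hx, p10 x hx, p11 x hx, hC₁, hC₂]
    simp only [hpd, hξ0 x hx] at hc
    simpa [hess] using hc
  exact ⟨A₁, A₂, A₃, B₁, B₂, B₃, fun x hx => ⟨hξ0 x hx, hη x hx, hφ x hx⟩⟩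

/-- The transformation `(x, w, Φ) ↦ (x, w + c₀ + c₁ x¹ + c₂ x², Φ + c₃ + c₄ x¹ + c₅ x²)`. -/
def shift : Multiplicative (Fin 6 → ℝ) →* Equiv.Perm Space where
  toFun c :=
    { toFun := fun z => z + affineField c.toAdd z
      invFun := fun z => z - affineField c.toAdd z
      left_inv := fun z => by simp [affineField]
      right_inv := fun z => by simp [affineField] }
  map_one' := by
    ext z <;> simp [affineField]
  map_mul' c d := by
    ext z
    · simp [affineField]
    · simp only [affineField, toAdd_mul, Pi.add_apply, Equiv.coe_fn_mk, Prod.snd_add, Prod.fst_add,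
        Equiv.Perm.coe_mul, Function.comp_apply, Pi.zero_apply]
      ring
    · simp only [affineField, toAdd_mul, Pi.add_apply, Equiv.coe_fn_mk, Prod.snd_add, Prod.fst_add,
        Equiv.Perm.coe_mul, Function.comp_apply, Pi.zero_apply]
      ring

lemma shift_apply (c : Fin 6 → ℝ) (z : Space) :
    shift (Multiplicative.ofAdd c) z = z + affineField c z := rfl

lemma affineField_smul (t : ℝ) (c : Fin 6 → ℝ) (z : Space) :
    affineField (t • c) z = t • affineField c z := by
  refine Prod.ext ?_ (Prod.ext ?_ ?_)
  · simp [affineField]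
  · simp only [affineField, Pi.smul_apply, smul_eq_mul, Prod.smul_mk]
    ring
  · simp only [affineField, Pi.smul_apply, smul_eq_mul, Prod.smul_mk]
    ring

lemma affineField_congr {c : Fin 6 → ℝ} {z z' : Space} (h : z.1 = z'.1) :
    affineField c z = affineField c z' := by
  simp [affineField, h]

/-- Integral curves of the fields in `L₀`. -/
lemma integralCurve_eq {I : Set ℝ} (hI : IsOpen I) (hIc : I.OrdConnected) (h0 : (0 : ℝ) ∈ I)
    {γ : ℝ → Space} {c : Fin 6 → ℝ} (hγ : ∀ t ∈ I, HasDerivAt γ (affineField c (γ t)) t) :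
    ∀ t ∈ I, γ t = shift (Multiplicative.ofAdd (t • c)) (γ 0) := by
  have hconst : ∀ {F : Type} [NormedAddCommGroup F] [NormedSpace ℝ F] {g : ℝ → F},
      (∀ t ∈ I, HasDerivAt g 0 t) → ∀ t ∈ I, g t = g 0 := fun {F} _ _ {g} hg t ht =>
    hI.is_const_of_deriv_eq_zero hIc.isPreconnected
      (fun s hs => (hg s hs).differentiableAt.differentiableWithinAt)
      (fun s hs => (hg s hs).deriv) ht h0
  have h1 : ∀ t ∈ I, (γ t).1 = (γ 0).1 := hconst fun t ht =>
    (ContinuousLinearMap.fst ℝ Plane (ℝ × ℝ)).hasFDerivAt.comp_hasDerivAt t (hγ t ht)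
  -- The base point does not move and the field depends on it alone, so the velocity is constant.
  have h2 : ∀ t ∈ I, γ t - t • affineField c (γ 0) = γ 0 - (0 : ℝ) • affineField c (γ 0) :=
    hconst (g := fun t => γ t - t • affineField c (γ 0)) fun t ht => by
      have := (hγ t ht).sub ((hasDerivAt_id t).smul_const (affineField c (γ 0)))
      rwa [one_smul, affineField_congr (h1 t ht), sub_self] at this
  intro t ht
  rw [shift_apply, affineField_smul]
  have := h2 t ht
  rw [zero_smul, sub_zero, sub_eq_iff_eq_add] at this
  exact this

lemma isTimeOneMap_iff {c : Fin 6 → ℝ} {T : Equiv.Perm Space} :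
    IsTimeOneMap (affineField c) T ↔ T = shift (Multiplicative.ofAdd c) := by
  constructor
  · intro h
    ext1 z
    obtain ⟨γ, h0, hγ, h1⟩ := h z
    rw [← h1, integralCurve_eq isOpen_univ ordConnected_univ (mem_univ _) (fun t _ => hγ t) 1
      (mem_univ _), h0, one_smul]
  · rintro rfl z
    refine ⟨fun t => z + t • affineField c z, by simp, fun t => ?_, by simp [shift_apply]⟩
    have := ((hasDerivAt_id t).smul_const (affineField c z)).const_add z
    rw [one_smul] at this
    change HasDerivAt _ (affineField c (z + t • affineField c z)) t
    have e : affineField c (z + t • affineField c z) = affineField c z :=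
      affineField_congr (by simp [affineField])
    rwa [e]

/-- The time-one maps already form a group, the image of `shift`, so the closure adds nothing. -/
lemma kernelGroup_eq_range : kernelGroup = shift.range := by
  have : {T : Equiv.Perm Space | ∃ X ∈ kernelAlgebra, IsTimeOneMap X T} = shift.range := by
    ext T
    simp only [mem_ofPred_eq, mem_kernelAlgebra_iff, SetLike.mem_coe, MonoidHom.mem_range]
    constructor
    · rintro ⟨_, ⟨c, rfl⟩, hT⟩
      exact ⟨_, (isTimeOneMap_iff.1 hT).symm⟩
    · rintro ⟨c, rfl⟩
      exact ⟨_, ⟨c.toAdd, rfl⟩, isTimeOneMap_iff.2 rfl⟩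
  rw [kernelGroup, this, Subgroup.closure_eq]

lemma mem_kernelGroup_iff {T : Equiv.Perm Space} :
    T ∈ kernelGroup ↔ ∃ c, shift (Multiplicative.ofAdd c) = T := by
  rw [kernelGroup_eq_range]
  rfl

lemma affine_eq_zero {U : Set Plane} (hU : IsOpen U) (hne : U.Nonempty) {a b c : ℝ}
    (h : ∀ x ∈ U, a + b * x 0 + c * x 1 = 0) : a = 0 ∧ b = 0 ∧ c = 0 := by
  obtain ⟨x, hx⟩ := hne
  have e := fun α => hasDerivAt_eq_zero_of_forall hU h hx
    ((((hasDerivAt_coord x α 0).const_mul b).const_add a).add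
      ((hasDerivAt_coord x α 1).const_mul c))
  have hb : b = 0 := by simpa [delta] using e 0
  have hc : c = 0 := by simpa [delta] using e 1
  have := h x hx
  simp only [hb, hc] at this
  exact ⟨by linarith, hb, hc⟩

lemma eq_zero_of_affineField_eq_zero {U : Set Plane} (hU : IsOpen U) (hne : U.Nonempty)
    {c : Fin 6 → ℝ} (h : ∀ x ∈ U, affineField c (x, 0, 0) = 0) : c = 0 := by
  obtain ⟨h0, h1, h2⟩ := affine_eq_zero hU hne fun x hx => congrArg (fun z => z.2.1) (h x hx)
  obtain ⟨h3, h4, h5⟩ := affine_eq_zero hU hne fun x hx => congrArg (fun z => z.2.2) (h x hx)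
  ext i
  fin_cases i
  exacts [h0, h1, h2, h3, h4, h5]

lemma shift_injective : Function.Injective shift := by
  rw [injective_iff_map_eq_one]
  intro c hc
  refine eq_zero_of_affineField_eq_zero isOpen_univ univ_nonempty fun x _ => ?_
  have := DFunLike.congr_fun hc ((x, 0, 0) : Space)
  exact left_eq_add.1 this.symm

lemma exists_mulEquiv_kernelGroup :
    ∃ ρ : Multiplicative (Fin 6 → ℝ) ≃* kernelGroup, ∀ (c : Fin 6 → ℝ) (z : Space),
      (ρ (Multiplicative.ofAdd c) : Equiv.Perm Space) z =
        (z.1, z.2.1 + (c 0 + c 1 * z.1 0 + c 2 * z.1 1),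
          z.2.2 + (c 3 + c 4 * z.1 0 + c 5 * z.1 1)) := by
  refine ⟨(MonoidHom.ofInjective shift_injective).trans
    (MulEquiv.subgroupCongr kernelGroup_eq_range.symm), fun c z => ?_⟩
  change shift (Multiplicative.ofAdd c) z = _
  rw [shift_apply]
  refine Prod.ext ?_ rfl
  simp [affineField]

lemma linearIndependent_kernelField {Ω : Set Plane} (hΩ : IsOpen Ω) (hne : Ω.Nonempty) :
    LinearIndependent ℝ
      (fun i : Fin 6 => (Ω ×ˢ (univ : Set (ℝ × ℝ))).domRestrict (kernelField i)) := by
  rw [Fintype.linearIndependent_iff]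
  intro c hc
  refine congrFun (eq_zero_of_affineField_eq_zero hΩ hne fun x hx => ?_)
  rw [← sum_smul_kernelField]
  have := congrFun hc ⟨(x, 0, 0), hx, mem_univ _⟩
  simpa using this

/-! ### Local groups whose generator lies in `L₀`. -/

namespace LocalGroup

variable {M : Set Space} (G : LocalGroup M)

/-- By the group law, the motion after parameter `t` is the motion from parameter zero started at
`G.map t z`. -/
lemma hasDerivAt_map {t : ℝ} {z : Space} (ht : (t, z) ∈ G.dom) :
    HasDerivAt (fun t => G.map t z) (G.generator (G.map t z)) t := by
  have hz' := G.map_mem t z ht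
  have hd : DifferentiableAt ℝ (fun s => G.map s (G.map t z)) 0 := by
    have := (G.contDiffOn.contDiffAt (G.isOpen_dom.mem_nhds (G.zero_mem _ hz'))).differentiableAt
      (by simp)
    exact this.comp (0 : ℝ) (f := fun s : ℝ => (s, G.map t z)) (by fun_prop)
  have h1 : HasDerivAt (fun s => G.map (t + s) z) (G.generator (G.map t z)) 0 := by
    refine hd.hasDerivAt.congr_of_eventuallyEq ?_
    have hc : ContinuousAt (fun s : ℝ => (s, G.map t z)) 0 := by fun_prop
    have hc' : ContinuousAt (fun s : ℝ => (t + s, z)) 0 := by fun_prop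
    filter_upwards [hc.eventually (G.isOpen_dom.mem_nhds (G.zero_mem _ hz')),
      hc'.eventually (G.isOpen_dom.mem_nhds (by simpa using ht))] with s hs hs'
    exact (G.map_add t s z ht hs hs').symm
  have h2 := HasDerivAt.comp_add_const (x := t) (a := -t) (f := fun s => G.map (t + s) z)
    (f' := G.generator (G.map t z)) (by simpa using h1)
  simpa using h2

lemma map_eq_of_generator {c : Fin 6 → ℝ} (hc : EqOn G.generator (affineField c) M) {t : ℝ}
    {z : Space} (ht : (t, z) ∈ G.dom) :
    G.map t z = shift (Multiplicative.ofAdd (t • c)) z := by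
  have hz := G.mem_of_mem_dom t z ht
  have := integralCurve_eq (γ := fun t => G.map t z) (c := c)
    (G.isOpen_dom.preimage (f := fun t : ℝ => (t, z)) (by fun_prop)) (G.ordConnected z)
    (G.zero_mem z hz) (fun s hs => by
      have := G.hasDerivAt_map hs
      rwa [hc (G.map_mem s z hs)] at this) t ht
  rwa [G.map_zero z hz] at this

lemma inKernel_of_generator (h : ∃ X ∈ kernelAlgebra, EqOn G.generator X M) : G.InKernel := by
  refine ⟨h, fun t => ?_⟩
  obtain ⟨X, hX, hG⟩ := h
  obtain ⟨c, rfl⟩ := mem_kernelAlgebra_iff.1 hX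
  exact ⟨_, mem_kernelGroup_iff.2 ⟨t • c, rfl⟩, fun z hz => G.map_eq_of_generator hG hz⟩

end LocalGroup

/-! ### Invariance of the system under affine shifts. -/

/-- The affine function with coefficients `a, b, c`. -/
def affine (a b c : ℝ) : Plane → ℝ := fun x => a + b * x 0 + c * x 1

lemma contDiff_affine (a b c : ℝ) : ContDiff ℝ ∞ (affine a b c) := by
  unfold affine
  fun_prop

lemma pdL_pair_affine (a b c : ℝ) (α β : Fin 2) : pdL [α, β] (affine a b c) = fun _ => 0 := by
  have h : pd β (affine a b c) = fun _ => b * delta β 0 + c * delta β 1 := by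
    ext x
    exact pd_eq_of_hasDerivAt ((contDiff_affine a b c).differentiable (by simp) x)
      ((((hasDerivAt_coord x β 0).const_mul b).const_add a).add
        ((hasDerivAt_coord x β 1).const_mul c))
  simp only [pdL, h, pd_const]

lemma pdL_four_affine (a b c : ℝ) (α β γ δ : Fin 2) :
    pdL [α, β, γ, δ] (affine a b c) = fun _ => 0 := by
  change pd α (pd β (pdL [γ, δ] (affine a b c))) = _
  rw [pdL_pair_affine, pd_const, pd_const]

lemma hess_affine (a b c : ℝ) (x : Plane) (α β : Fin 2) : hess (affine a b c) x α β = 0 :=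
  congrFun (pdL_pair_affine a b c α β) x

lemma deltaContr_affine (a b c : ℝ) (x : Plane) :
    deltaContr (fun J => pdL J (affine a b c) x) = 0 := by
  simp [deltaContr_eq, pdL_four_affine]

lemma hess_add_affine {w : Plane → ℝ} {x : Plane} (hw : SmoothAt w x) (a b c : ℝ) :
    hess (fun y => w y + affine a b c y) x = hess w x := by
  ext α β
  have := (pdL_add hw (contDiff_affine a b c).contDiffAt [α, β]).eq_of_nhds
  rw [pdL_pair_affine, add_zero] at this
  exact this

lemma deltaContr_add_affine {w : Plane → ℝ} {x : Plane} (hw : SmoothAt w x) (a b c : ℝ) :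
    deltaContr (fun J => pdL J (fun y => w y + affine a b c y) x)
      = deltaContr (fun J => pdL J w x) := by
  refine deltaContr_congr fun α β γ δ => ?_
  have := (pdL_add hw (contDiff_affine a b c).contDiffAt [α, β, γ, δ]).eq_of_nhds
  rwa [pdL_four_affine, add_zero] at this

namespace Equations

variable {S : Equations}

lemma satisfiedAt_congr {w w' Φ Φ' : Plane → ℝ} {x : Plane} (hw : w =ᶠ[𝓝 x] w')
    (hΦ : Φ =ᶠ[𝓝 x] Φ') : S.SatisfiedAt w Φ x ↔ S.SatisfiedAt w' Φ' x := by
  have e := fun J => (pdL_congr hw J).eq_of_nhds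
  have e' := fun J => (pdL_congr hΦ J).eq_of_nhds
  have h1 : hess w x = hess w' x := funext₂ fun α β => e [α, β]
  have h2 : hess Φ x = hess Φ' x := funext₂ fun α β => e' [α, β]
  simp only [SatisfiedAt, eq1, eq2, h1, h2, e, e']

lemma satisfiedAt_add_affine {w Φ : Plane → ℝ} {x : Plane} (hw : SmoothAt w x)
    (hΦ : SmoothAt Φ x) (a b c a' b' c' : ℝ) :
    S.SatisfiedAt (fun y => w y + affine a b c y) (fun y => Φ y + affine a' b' c' y) x ↔
      S.SatisfiedAt w Φ x := by
  simp only [SatisfiedAt, eq1, eq2, hess_add_affine hw, hess_add_affine hΦ,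
    deltaContr_add_affine hw, deltaContr_add_affine hΦ]

lemma IsSolutionOn.add_affine {U : Set Plane} (hU : IsOpen U) {w Φ : Plane → ℝ}
    (h : S.IsSolutionOn U w Φ) (a b c a' b' c' : ℝ) :
    S.IsSolutionOn U (fun y => w y + affine a b c y) (fun y => Φ y + affine a' b' c' y) :=
  ⟨h.1.add (contDiff_affine _ _ _).contDiffOn, h.2.1.add (contDiff_affine _ _ _).contDiffOn,
    fun x hx => (satisfiedAt_add_affine (h.1.contDiffAt (hU.mem_nhds hx))
      (h.2.1.contDiffAt (hU.mem_nhds hx)) _ _ _ _ _ _).2 (h.2.2 x hx)⟩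

lemma isSolutionOn_add_affine {U : Set Plane} (hU : IsOpen U) {w Φ : Plane → ℝ}
    (a b c a' b' c' : ℝ) :
    S.IsSolutionOn U w Φ ↔
    S.IsSolutionOn U (fun y => w y + affine a b c y) (fun y => Φ y + affine a' b' c' y) := by
  refine ⟨fun h => h.add_affine hU _ _ _ _ _ _, fun h => ?_⟩
  have := h.add_affine hU (-a) (-b) (-c) (-a') (-b') (-c')
  convert this using 1 <;> ext y <;> simp only [affine] <;> ring

/-- Base points are fixed, so any germ representing the transformed graph is the old one plus an
affine function. Agreement with the shift near the points of `U` suffices, since invariance concerns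
jets. -/
lemma invariantUnder_of_shift {T : Space → Space} {U : Set Space} {c : Fin 6 → ℝ}
    (hT : ∀ z ∈ U, T =ᶠ[𝓝 z] shift (Multiplicative.ofAdd c)) : S.InvariantUnder T U := by
  intro x₀ w Φ w' Φ' hz hw hΦ _ _ htr hsat
  have hfst : ∀ z, (shift (Multiplicative.ofAdd c) z).1 = z.1 := fun z => by
    simp [shift_apply, affineField]
  have hx : (T (x₀, w x₀, Φ x₀)).1 = x₀ := by rw [(hT _ hz).eq_of_nhds, hfst]
  have hev : ∀ᶠ x in 𝓝 x₀, T (x, w x, Φ x) = shift (Multiplicative.ofAdd c) (x, w x, Φ x) :=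
    eventually_sec hw hΦ (hT _ hz)
  have hev2 : ∀ᶠ x in 𝓝 x₀, w' x = w x + affine (c 0) (c 1) (c 2) x ∧
      Φ' x = Φ x + affine (c 3) (c 4) (c 5) x := by
    filter_upwards [hev, htr.2] with x h1 h2
    have h3 : (T (x, w x, Φ x)).1 = x := by rw [h1, hfst]
    rw [h1] at h2
    rw [h1] at h3
    rw [h3] at h2
    exact ⟨(congrArg (fun z => z.2.1) h2).symm, (congrArg (fun z => z.2.2) h2).symm⟩
  rw [hx, satisfiedAt_congr (hev2.mono fun _ h => h.1) (hev2.mono fun _ h => h.2)]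
  exact (satisfiedAt_add_affine hw hΦ _ _ _ _ _ _).2 hsat

lemma admitsGroup_of_inKernel {M : Set Space} {G : LocalGroup M} (hG : G.InKernel) :
    S.AdmitsGroup G := by
  intro t
  obtain ⟨T, hT, h⟩ := hG.2 t
  obtain ⟨c, rfl⟩ := mem_kernelGroup_iff.1 hT
  refine invariantUnder_of_shift (c := c) fun z hz => ?_
  exact (G.isOpen_dom.preimage (f := fun z => (t, z)) (by fun_prop)).eventually_mem hz
    |>.mono fun y hy => h y hy

lemma admitsField_of_mem_kernelAlgebra {X : Space → Space} (hX : X ∈ kernelAlgebra)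
    (M : Set Space) : S.AdmitsField X M := by
  obtain ⟨c, rfl⟩ := mem_kernelAlgebra_iff.1 hX
  intro x w Φ _ _ _ _
  have hξ : ∀ μ y, xiAlong (affineField c) w Φ μ y = 0 := fun _ _ => rfl
  have hW : ∀ J, prW (affineField c) w Φ x J = pdL J (affine (c 0) (c 1) (c 2)) x := fun J => by
    simp only [prW, hξ, zero_mul, Finset.sum_const_zero, sub_zero, add_zero]
    rfl
  have hΦ : ∀ J, prΦ (affineField c) w Φ x J = pdL J (affine (c 3) (c 4) (c 5)) x := fun J => by
    simp only [prΦ, hξ, zero_mul, Finset.sum_const_zero, sub_zero, add_zero]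
    rfl
  simp [prEq1, prEq2, xib, hξ, altContr_eq, deltaContr_eq, hW, hΦ, pdL_pair_affine,
    pdL_four_affine]

lemma determiningSystem_affine (Ω : Set Plane) (A₁ A₂ A₃ B₁ B₂ B₃ : ℝ) :
    S.DeterminingSystem Ω (fun _ _ => 0) (fun x => A₁ * x 0 + A₂ * x 1 + A₃)
      (fun x => B₁ * x 0 + B₂ * x 1 + B₃) := by
  have e : (fun x : Plane => A₁ * x 0 + A₂ * x 1 + A₃) = affine A₃ A₁ A₂ := by
    ext x
    simp only [affine]
    ring
  refine ⟨⟨0, 0, 0, 0, fun x _ => by simp⟩, ?_, ⟨B₁, B₂, B₃, fun x _ => rfl⟩, ?_, ?_, ?_⟩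
  · rw [e]
    exact (contDiff_affine _ _ _).contDiffOn
  · intro x _ α β
    rw [e, hess_affine]
    simp [pd_const]
  · intro x _
    rw [e]
    simp [altContr_eq, hess_affine]
  · intro x _
    rw [e, deltaContr_affine]
    simp [pd_const]

end Equations

/-! ### From invariance under a group to the infinitesimal criterion. -/

section Families

/-- The direction of the parameter. -/
abbrev eT : ℝ × Plane := (1, 0)

/-- The coordinate directions of the plane in a one-parameter family. -/
noncomputable abbrev eY (α : Fin 2) : ℝ × Plane := (0, ex α)

lemma eventually_fiber {p : ℝ × Plane → Prop} {q : ℝ × Plane} (h : ∀ᶠ q in 𝓝 q, p q) :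
    ∀ᶠ y in 𝓝 q.2, p (q.1, y) :=
  (Continuous.prodMk_right q.1).continuousAt.eventually h

/-- Expresses derivatives at fixed parameter as directional derivatives in `ℝ × ℝ²`, where they
commute with the parameter derivative. -/
lemma pdL_fiber {F : ℝ × Plane → ℝ} {q₀ : ℝ × Plane} (hF : SmoothAt F q₀) (J : List (Fin 2)) :
    ∀ᶠ q in 𝓝 q₀, pdL J (fun y => F (q.1, y)) q.2 = ddL (J.map eY) F q := by
  induction J with
  | nil => exact Eventually.of_forall fun _ => rfl
  | cons α J ih =>
    filter_upwards [ih.eventually_nhds, (hF.ddL (J.map eY)).eventually_differentiableAt]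
      with q h1 h2
    have h3 : pdL J (fun y => F (q.1, y)) =ᶠ[𝓝 q.2] fun y => ddL (J.map eY) F (q.1, y) :=
      eventually_fiber h1
    rw [pdL, (pd_congr h3 α).eq_of_nhds]
    have h4 : HasFDerivAt (fun y : Plane => (q.1, y))
        (ContinuousLinearMap.inr ℝ ℝ Plane) q.2 := hasFDerivAt_prodMk_right q.1 q.2
    have h5 := (HasFDerivAt.comp q.2 (g := ddL (J.map eY) F) h2.hasFDerivAt h4).fderiv
    change fderiv ℝ (fun y => ddL (J.map eY) F (q.1, y)) q.2 (ex α) = _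
    change fderiv ℝ (fun y => ddL (J.map eY) F (q.1, y)) q.2 = _ at h5
    rw [h5]
    rfl

lemma clm_apply_eq (L : ℝ × Plane →L[ℝ] ℝ) (v : Plane) :
    L (1, v) = L eT + ∑ μ, v μ * L (eY μ) := by
  have : ((1, v) : ℝ × Plane) = eT + ∑ μ, v μ • eY μ := by
    refine Prod.ext ?_ ?_
    · simp
    · ext i
      fin_cases i <;> simp [Fin.sum_univ_two]
  rw [this, map_add, map_sum]
  simp only [map_smul, smul_eq_mul]

/-- Derivative of the jets of a family of functions along the moving base points. -/
lemma hasDerivAt_pdL_family {W Z : ℝ × Plane → ℝ} {χ : ℝ × Plane → Plane} {w : Plane → ℝ}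
    {x : Plane} (hW : SmoothAt W (0, x)) (hχ : ContDiffAt ℝ ∞ χ (0, x))
    (hW0 : ∀ᶠ y in 𝓝 x, W (0, y) = w y) (hχ0 : ∀ᶠ y in 𝓝 x, χ (0, y) = y)
    (hZ : ∀ᶠ q in 𝓝 ((0 : ℝ), x), W (q.1, χ q) = Z q) (J : List (Fin 2)) :
    HasDerivAt (fun t => pdL J (fun y => W (t, y)) (χ (t, x)))
      (pdL J (fun y => dd eT Z (0, y) - ∑ μ, fderiv ℝ χ (0, y) eT μ * pd μ w y) x
        + ∑ μ, fderiv ℝ χ (0, x) eT μ * pdL J (pd μ w) x) 0 := by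
  have hχx : χ (0, x) = x := hχ0.self_of_nhds
  have hχc : ∀ᶠ y in 𝓝 x, DifferentiableAt ℝ χ (0, y) := by
    have : ContDiffAt ℝ 1 χ (0, x) := hχ.of_le (by exact_mod_cast le_top)
    exact eventually_fiber (q := (0, x))
      ((this.eventually (by simp)).mono fun q hq => hq.differentiableAt (by simp))
  have hγ : ∀ {y : Plane}, DifferentiableAt ℝ χ (0, y) →
      HasDerivAt (fun t : ℝ => (t, χ (t, y))) ((1 : ℝ), fderiv ℝ χ (0, y) eT) 0 := fun {y} hy =>
    (hasDerivAt_id (0 : ℝ)).prodMk (hy.hasFDerivAt.comp_hasDerivAt (0 : ℝ)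
      ((hasDerivAt_id (0 : ℝ)).prodMk (hasDerivAt_const (0 : ℝ) y)))
  have hcomp : ∀ {K : ℝ × Plane → ℝ} {y : Plane}, DifferentiableAt ℝ K (0, y) → χ (0, y) = y →
      DifferentiableAt ℝ χ (0, y) → HasDerivAt (fun t => K (t, χ (t, y)))
        (dd eT K (0, y) + ∑ μ, fderiv ℝ χ (0, y) eT μ * dd (eY μ) K (0, y)) 0 :=
    fun {K y} hK hy hχy => by
      have := HasFDerivAt.comp_hasDerivAt (0 : ℝ) (f := fun t : ℝ => (t, χ (t, y))) (l := K)
        (by rw [hy]; exact hK.hasFDerivAt) (hγ hχy)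
      rw [clm_apply_eq] at this
      exact this
  have hWd : ∀ᶠ y in 𝓝 x, DifferentiableAt ℝ W (0, y) :=
    eventually_fiber (q := (0, x)) hW.eventually_differentiableAt
  have hfib : ∀ J : List (Fin 2), ∀ᶠ y in 𝓝 x,
      ddL (J.map eY) W (0, y) = pdL J (fun y => W (0, y)) y := fun J =>
    (eventually_fiber (q := (0, x)) (pdL_fiber hW J)).mono fun y hy => hy.symm
  have hJ0 : ∀ J : List (Fin 2), pdL J (fun y => W (0, y)) =ᶠ[𝓝 x] pdL J w :=
    fun J => pdL_congr hW0 J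
  have hw : SmoothAt w x := by
    have h1 : SmoothAt (fun y => W (0, y)) x :=
      ContDiffAt.comp (f := fun y : Plane => ((0 : ℝ), y)) x hW
        (contDiffAt_const.prodMk contDiffAt_id)
    exact h1.congr_of_eventuallyEq (hW0.mono fun y hy => hy.symm)
  -- Differentiating `W (t, χ (t, y)) = Z (t, y)` at `t = 0` identifies the parameter derivative of
  -- the family with the characteristic.
  have hZy : ∀ᶠ y in 𝓝 x, dd eT W (0, y)
      = dd eT Z (0, y) - ∑ μ, fderiv ℝ χ (0, y) eT μ * pd μ w y := by
    filter_upwards [hWd, hχ0, hχc, eventually_fiber (q := (0, x)) hZ.eventually_nhds,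
      hfib [0], hfib [1], hJ0 [0], hJ0 [1]] with y h1 h2 h3 h4 h5 h6 h7 h8
    have e1 := hcomp h1 h2 h3
    have hdZ : DifferentiableAt ℝ Z (0, y) := by
      have : DifferentiableAt ℝ (fun q : ℝ × Plane => W (q.1, χ q)) (0, y) :=
        DifferentiableAt.comp ((0 : ℝ), y) (g := W) (by rw [h2]; exact h1)
          (differentiableAt_fst.prodMk h3)
      exact this.congr_of_eventuallyEq (h4.mono fun q hq => hq.symm)
    have e2 : HasDerivAt (fun t => Z (t, y)) (dd eT Z (0, y)) 0 :=
      hdZ.hasFDerivAt.comp_hasDerivAt (0 : ℝ)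
        ((hasDerivAt_id (0 : ℝ)).prodMk (hasDerivAt_const (0 : ℝ) y))
    have e3 : (fun t => W (t, χ (t, y))) =ᶠ[𝓝 0] fun t => Z (t, y) :=
      (Continuous.prodMk_left y).continuousAt.eventually h4
    have e4 := (e2.congr_of_eventuallyEq e3).unique e1
    have e5 : ∀ μ, dd (eY μ) W (0, y) = pd μ w y := by
      intro μ
      fin_cases μ
      exacts [h5.trans h7, h6.trans h8]
    simp only [e5] at e4
    linear_combination -e4
  have hK := hcomp (K := ddL (J.map eY) W) (hW.ddL _).differentiableAt hχx hχc.self_of_nhds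
  have hev : (fun t => pdL J (fun y => W (t, y)) (χ (t, x)))
      =ᶠ[𝓝 0] fun t => ddL (J.map eY) W (t, χ (t, x)) := by
    have hc : ContinuousAt (fun t : ℝ => (t, χ (t, x))) 0 :=
      (hγ hχc.self_of_nhds).continuousAt
    have := hc.eventually (p := fun q => pdL J (fun y => W (q.1, y)) q.2 = ddL (J.map eY) W q)
      (by beta_reduce; rw [hχx]; exact pdL_fiber hW J)
    exact this
  refine (hK.congr_of_eventuallyEq hev).congr_deriv ?_
  congr 1
  -- Parameter and space derivatives are exchanged, so the spatial derivatives of the characteristic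
  -- appear.
  · rw [← (ddL_dd hW eT _).eq_of_nhds, ← (pdL_fiber (hW.dd eT) J).self_of_nhds]
    exact (pdL_congr hZy J).eq_of_nhds
  · refine Finset.sum_congr rfl fun μ _ => ?_
    congr 1
    rw [(pd_pdL hw μ J).eq_of_nhds, ← (pd_congr (hJ0 J) μ).eq_of_nhds]
    exact (pdL_fiber hW (μ :: J)).self_of_nhds.symm

/-- A family of base point transformations through the identity is invertible as a map of
`ℝ × ℝ²`. -/
lemma exists_family_inverse {χ : ℝ × Plane → Plane} {x : Plane}
    (hχ : ∀ᶠ q in 𝓝 ((0 : ℝ), x), ContDiffAt ℝ ∞ χ q) (hχ0 : ∀ᶠ y in 𝓝 x, χ (0, y) = y) :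
    ∃ ψ : ℝ × Plane → ℝ × Plane, ∀ᶠ q in 𝓝 ((0 : ℝ), x),
      ψ (q.1, χ q) = q ∧ ContDiffAt ℝ ∞ ψ (q.1, χ q) := by
  set θ : ℝ × Plane → ℝ × Plane := fun q => (q.1, χ q) with hθdef
  have hθ : ∀ᶠ q in 𝓝 ((0 : ℝ), x), ContDiffAt ℝ ∞ θ q :=
    hχ.mono fun q hq => contDiffAt_fst.prodMk hq
  have hθ0 := hθ.self_of_nhds
  have hd : DifferentiableAt ℝ θ (0, x) := hθ0.differentiableAt (by simp)
  -- The derivative of `θ` is block triangular: it preserves the parameter component and is the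
  -- identity on `{0} × ℝ²`, because `χ (0, ·)` is the identity.
  have hinj : Function.Injective (fderiv ℝ θ (0, x)) := by
    rw [injective_iff_map_eq_zero]
    rintro ⟨s, v⟩ hsv
    have h1 : fderiv ℝ θ (0, x) = (ContinuousLinearMap.fst ℝ ℝ Plane).prod
        (fderiv ℝ χ (0, x)) :=
      (hasFDerivAt_fst.prodMk (hχ.self_of_nhds.differentiableAt (by simp)).hasFDerivAt).fderiv
    have hs : s = 0 := by
      rw [h1] at hsv
      exact congrArg Prod.fst hsv
    subst hs
    have h2 : HasFDerivAt (fun y : Plane => θ (0, y))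
        ((fderiv ℝ θ (0, x)).comp (ContinuousLinearMap.inr ℝ ℝ Plane)) x :=
      HasFDerivAt.comp x (g := θ) hd.hasFDerivAt (hasFDerivAt_prodMk_right (0 : ℝ) x)
    have h3 : HasFDerivAt (fun y : Plane => θ (0, y)) (ContinuousLinearMap.inr ℝ ℝ Plane) x := by
      refine (hasFDerivAt_prodMk_right (0 : ℝ) x).congr_of_eventuallyEq ?_
      filter_upwards [hχ0] with y hy
      simp [hθdef, hy]
    have h4 := DFunLike.congr_fun (h2.unique h3) v
    exact h4.symm.trans hsv
  obtain ⟨L, hL⟩ : ∃ L : (ℝ × Plane) ≃L[ℝ] ℝ × Plane,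
      (L : ℝ × Plane →L[ℝ] ℝ × Plane) = fderiv ℝ θ (0, x) :=
    ⟨(LinearEquiv.ofInjectiveEndo (fderiv ℝ θ (0, x)).toLinearMap hinj).toContinuousLinearEquiv,
      ContinuousLinearMap.ext fun _ => rfl⟩
  have hL' : HasFDerivAt θ (L : ℝ × Plane →L[ℝ] ℝ × Plane) (0, x) := hL ▸ hd.hasFDerivAt
  let e := hθ0.toOpenPartialHomeomorph θ hL' (by simp)
  -- The inverse has to be smooth at all nearby points; this follows because invertibility of the
  -- derivative is an open condition.
  have hinv : ∀ᶠ q in 𝓝 ((0 : ℝ), x), fderiv ℝ θ q ∈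
      range ((↑) : ((ℝ × Plane) ≃L[ℝ] ℝ × Plane) → _) := by
    have hc : ContinuousAt (fderiv ℝ θ) (0, x) :=
      (hθ0.fderiv_right (m := 0) (by simp)).continuousAt
    exact hc.eventually (ContinuousLinearEquiv.isOpen.mem_nhds ⟨L, hL⟩)
  refine ⟨e.symm, ?_⟩
  filter_upwards [hθ, hinv, e.open_source.mem_nhds
    (hθ0.mem_toOpenPartialHomeomorph_source hL' (by simp))] with q h1 h2 h3
  obtain ⟨K, hK⟩ := h2
  have h4 : e.symm (θ q) = q := e.left_inv h3
  refine ⟨h4, e.contDiffAt_symm (f₀' := K) (e.map_source h3) ?_ ?_⟩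
  · rw [hK]
    change HasFDerivAt θ _ (e.symm (θ q))
    rw [h4]
    exact (h1.differentiableAt (by simp)).hasFDerivAt
  · change ContDiffAt ℝ ∞ θ (e.symm (θ q))
    rwa [h4]

end Families

lemma hasDerivAt_altContr {a c : ℝ → Fin 2 → Fin 2 → ℝ} {a' c' : Fin 2 → Fin 2 → ℝ} {t : ℝ}
    (ha : ∀ α β, HasDerivAt (fun t => a t α β) (a' α β) t)
    (hc : ∀ α β, HasDerivAt (fun t => c t α β) (c' α β) t) :
    HasDerivAt (fun t => altContr (a t) (c t)) (altContr a' (c t) + altContr (a t) c') t := by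
  simp only [altContr_eq]
  exact (((((ha 0 0).mul (hc 1 1)).add ((ha 1 1).mul (hc 0 0))).sub
    ((ha 0 1).mul (hc 1 0))).sub ((ha 1 0).mul (hc 0 1))).congr_deriv (by ring)

lemma hasDerivAt_deltaContr {a : ℝ → List (Fin 2) → ℝ} {a' : List (Fin 2) → ℝ} {t : ℝ}
    (ha : ∀ J, HasDerivAt (fun t => a t J) (a' J) t) :
    HasDerivAt (fun t => deltaContr (a t)) (deltaContr a') t := by
  simp only [deltaContr_eq]
  exact ((ha _).add (ha _)).add ((ha _).add (ha _))

lemma hasDerivAt_comp_curve {g : Plane → ℝ} {γ : ℝ → Plane} {v x : Plane}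
    (hg : DifferentiableAt ℝ g x) (hγ : HasDerivAt γ v 0) (h0 : γ 0 = x) :
    HasDerivAt (fun t => g (γ t)) (∑ μ, v μ * pd μ g x) 0 := by
  have h1 := HasFDerivAt.comp_hasDerivAt (0 : ℝ) (f := γ) (l := g)
    (by rw [h0]; exact hg.hasFDerivAt) hγ
  refine h1.congr_deriv ?_
  have : v = ∑ μ, v μ • ex μ := by
    ext i
    fin_cases i <;> simp [Fin.sum_univ_two]
  conv_lhs => rw [this]
  rw [map_sum]
  simp only [map_smul, smul_eq_mul]
  rfl

namespace LocalGroup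

variable {M : Set Space} (G : LocalGroup M)

lemma generator_eq {z : Space} (hz : z ∈ M) :
    G.generator z = fderiv ℝ (fun q : ℝ × Space => G.map q.1 q.2) (0, z) (1, 0) := by
  have h1 := (G.contDiffOn.contDiffAt (G.isOpen_dom.mem_nhds (G.zero_mem z hz))).differentiableAt
    (by simp)
  have h2 := h1.hasFDerivAt.comp_hasDerivAt (0 : ℝ)
    ((hasDerivAt_id (0 : ℝ)).prodMk (hasDerivAt_const (0 : ℝ) z))
  exact h2.deriv

lemma contDiffOn_generator : ContDiffOn ℝ ∞ G.generator M := by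
  have h1 : ContDiffOn ℝ ∞ (fun z => fderiv ℝ (fun q : ℝ × Space => G.map q.1 q.2) (0, z) (1, 0))
      M := fun z hz => by
    have h2 := (G.contDiffOn.contDiffAt
      (G.isOpen_dom.mem_nhds (G.zero_mem z hz))).fderiv_right (m := ∞) (by simp)
    have h3 := ContDiffAt.comp (f := fun z : Space => ((0 : ℝ), z)) z h2
      (contDiffAt_const.prodMk contDiffAt_id)
    exact (h3.clm_apply contDiffAt_const).contDiffWithinAt
  exact h1.congr fun z hz => G.generator_eq hz

variable {S : Equations}

/-- The flow moves the graph of a section, which for small `t` is again a graph. Its jet over the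
moved base point satisfies the system, and the `t`-derivative of the equations at `t = 0` is the
prolonged generator applied to them, by `hasDerivAt_pdL_family`. -/
lemma admitsOnSmooth_generator (hM : IsOpen M) (hf : ∀ z ∈ M, SmoothAt S.f z.1)
    (hp : ∀ z ∈ M, SmoothAt S.p z.1) (hG : S.AdmitsGroup G) :
    S.AdmitsOnSmooth G.generator M := by
  intro x w Φ hw hΦ hz hsat
  have hsec : Continuous (sec w Φ) :=
    continuous_id.prodMk (hw.continuous.prodMk hΦ.continuous)
  set A : ℝ × Plane → Space := fun q => G.map q.1 (sec w Φ q.2) with hAdef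
  have hdom : IsOpen {q : ℝ × Plane | (q.1, sec w Φ q.2) ∈ G.dom} :=
    G.isOpen_dom.preimage (continuous_fst.prodMk (hsec.comp continuous_snd))
  have hAd : ∀ q : ℝ × Plane, (q.1, sec w Φ q.2) ∈ G.dom → ContDiffAt ℝ ∞ A q := fun q hq =>
    ContDiffAt.comp (f := fun q : ℝ × Plane => (q.1, sec w Φ q.2)) q
      (G.contDiffOn.contDiffAt (G.isOpen_dom.mem_nhds hq))
      (contDiffAt_fst.prodMk (ContDiffAt.comp q (contDiffAt_sec hw.contDiffAt hΦ.contDiffAt)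
        contDiffAt_snd))
  have hdx : ((0 : ℝ), sec w Φ x) ∈ G.dom := G.zero_mem _ hz
  have hdev : ∀ᶠ q in 𝓝 ((0 : ℝ), x), (q.1, sec w Φ q.2) ∈ G.dom :=
    hdom.eventually_mem (x := ((0 : ℝ), x)) hdx
  have hMx : ∀ᶠ y in 𝓝 x, sec w Φ y ∈ M := hsec.continuousAt.eventually (hM.mem_nhds hz)
  have hA : ∀ᶠ q in 𝓝 ((0 : ℝ), x), ContDiffAt ℝ ∞ A q := hdev.mono hAd
  have hA0 : ∀ y, sec w Φ y ∈ M → A (0, y) = sec w Φ y := fun y hy => G.map_zero _ hy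
  set χ : ℝ × Plane → Plane := fun q => (A q).1 with hχdef
  set Z₁ : ℝ × Plane → ℝ := fun q => (A q).2.1 with hZ₁
  set Z₂ : ℝ × Plane → ℝ := fun q => (A q).2.2 with hZ₂
  have hχ : ∀ᶠ q in 𝓝 ((0 : ℝ), x), ContDiffAt ℝ ∞ χ q :=
    hA.mono fun q hq => contDiffAt_fst.comp q hq
  have hχ0 : ∀ᶠ y in 𝓝 x, χ (0, y) = y := hMx.mono fun y hy => by
    rw [hχdef]
    exact congrArg Prod.fst (hA0 y hy)
  have hχx : χ (0, x) = x := hχ0.self_of_nhds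
  obtain ⟨ψ, hψ⟩ := exists_family_inverse hχ hχ0
  -- The transported values of `w` and `Φ`, re-expressed as functions of the new base point.
  set W : ℝ × Plane → ℝ := fun q => Z₁ (ψ q) with hWdef
  set P : ℝ × Plane → ℝ := fun q => Z₂ (ψ q) with hPdef
  have hWP : ∀ᶠ q in 𝓝 ((0 : ℝ), x), (SmoothAt W (q.1, χ q) ∧ SmoothAt P (q.1, χ q)) ∧
      W (q.1, χ q) = Z₁ q ∧ P (q.1, χ q) = Z₂ q := by
    filter_upwards [hA, hψ] with q h1 h2
    refine ⟨⟨?_, ?_⟩, congrArg Z₁ h2.1, congrArg Z₂ h2.1⟩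
    · refine ContDiffAt.comp (q.1, χ q) (g := Z₁) ?_ h2.2
      rw [h2.1]
      exact contDiffAt_fst.comp q (contDiffAt_snd.comp q h1)
    · refine ContDiffAt.comp (q.1, χ q) (g := Z₂) ?_ h2.2
      rw [h2.1]
      exact contDiffAt_snd.comp q (contDiffAt_snd.comp q h1)
  have hW0 : ∀ᶠ y in 𝓝 x, W (0, y) = w y ∧ P (0, y) = Φ y := by
    filter_upwards [eventually_fiber (q := ((0 : ℝ), x)) hWP, hχ0, hMx] with y h1 h2 h3
    have h4 := h1.2
    rw [h2] at h4
    exact ⟨h4.1.trans (congrArg (fun z => z.2.1) (hA0 y h3)),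
      h4.2.trans (congrArg (fun z => z.2.2) (hA0 y h3))⟩
  have hgen : ∀ y, sec w Φ y ∈ M → fderiv ℝ A (0, y) eT = G.generator (sec w Φ y) := by
    intro y hy
    have h1 := (hAd (0, y) (G.zero_mem _ hy)).differentiableAt (by simp)
    exact (h1.hasFDerivAt.comp_hasDerivAt (0 : ℝ)
      ((hasDerivAt_id (0 : ℝ)).prodMk (hasDerivAt_const (0 : ℝ) y))).deriv.symm
  have hcomp : ∀ y, sec w Φ y ∈ M →
      fderiv ℝ χ (0, y) eT = (G.generator (sec w Φ y)).1 ∧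
      dd eT Z₁ (0, y) = (G.generator (sec w Φ y)).2.1 ∧
      dd eT Z₂ (0, y) = (G.generator (sec w Φ y)).2.2 := by
    intro y hy
    have h1 := ((hAd (0, y) (G.zero_mem _ hy)).differentiableAt (by simp)).hasFDerivAt
    rw [← hgen y hy]
    exact ⟨congrArg (fun L => L eT) h1.fst.fderiv, congrArg (fun L => L eT) h1.snd.fst.fderiv,
      congrArg (fun L => L eT) h1.snd.snd.fderiv⟩
  have hχ1 := (hcomp x hz).1
  have smW : SmoothAt W (0, x) := by
    have := hWP.self_of_nhds.1.1
    rwa [hχx] at this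
  have smP : SmoothAt P (0, x) := by
    have := hWP.self_of_nhds.1.2
    rwa [hχx] at this
  have kW : ∀ J, HasDerivAt (fun t => pdL J (fun y => W (t, y)) (χ (t, x)))
      (prW G.generator w Φ x J) 0 := fun J => by
    refine (hasDerivAt_pdL_family smW hχ.self_of_nhds (hW0.mono fun y h => h.1) hχ0
      (hWP.mono fun q h => h.2.1) J).congr_deriv ?_
    rw [prW, hχ1]
    congr 1
    refine (pdL_congr (hMx.mono fun y hy => ?_) J).eq_of_nhds
    rw [(hcomp y hy).1, (hcomp y hy).2.1]
    rfl
  have kP : ∀ J, HasDerivAt (fun t => pdL J (fun y => P (t, y)) (χ (t, x)))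
      (prΦ G.generator w Φ x J) 0 := fun J => by
    refine (hasDerivAt_pdL_family smP hχ.self_of_nhds (hW0.mono fun y h => h.2) hχ0
      (hWP.mono fun q h => h.2.2) J).congr_deriv ?_
    rw [prΦ, hχ1]
    congr 1
    refine (pdL_congr (hMx.mono fun y hy => ?_) J).eq_of_nhds
    rw [(hcomp y hy).1, (hcomp y hy).2.2]
    rfl
  have hpar : Continuous fun t : ℝ => (t, x) := Continuous.prodMk_left x
  -- Transversality of the moved graph: the base point map is the identity at `t = 0`, and
  -- invertible maps form an open set.
  have hinv : ∀ᶠ t in 𝓝 (0 : ℝ), (fderiv ℝ (fun y => χ (t, y)) x).IsInvertible := by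
    have h1 : ∀ᶠ t in 𝓝 (0 : ℝ), (fderiv ℝ χ (t, x)).comp (ContinuousLinearMap.inr ℝ ℝ Plane)
        = fderiv ℝ (fun y => χ (t, y)) x :=
      (hpar.continuousAt.eventually hχ).mono fun t ht =>
        (HasFDerivAt.comp x (ht.differentiableAt (by simp)).hasFDerivAt
          (hasFDerivAt_prodMk_right t x)).fderiv.symm
    have h2 : ContinuousAt (fun t => (fderiv ℝ χ (t, x)).comp
        (ContinuousLinearMap.inr ℝ ℝ Plane)) 0 :=
      (ContinuousAt.comp (f := fun t : ℝ => (t, x)) (x := 0)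
        (hχ.self_of_nhds.fderiv_right (m := 0) (by simp)).continuousAt
        hpar.continuousAt).clm_comp continuousAt_const
    have h3 : (fderiv ℝ χ (0, x)).comp (ContinuousLinearMap.inr ℝ ℝ Plane)
        = ((ContinuousLinearEquiv.refl ℝ Plane : Plane ≃L[ℝ] Plane) : Plane →L[ℝ] Plane) := by
      rw [h1.self_of_nhds, (show (fun y => χ (0, y)) =ᶠ[𝓝 x] id from hχ0).fderiv_eq, fderiv_id]
      rfl
    filter_upwards [h1, h2.eventually (ContinuousLinearEquiv.isOpen.mem_nhds ⟨_, h3.symm⟩)]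
      with t ht1 ht2
    rwa [ht1] at ht2
  have hsol : ∀ᶠ t in 𝓝 (0 : ℝ),
      S.SatisfiedAt (fun y => W (t, y)) (fun y => P (t, y)) (χ (t, x)) := by
    filter_upwards [hinv, hpar.continuousAt.eventually hdev,
      hpar.continuousAt.eventually hWP.eventually_nhds] with t h1 h2 h3
    have hc : ∀ {F : ℝ × Plane → ℝ}, SmoothAt F (t, χ (t, x)) →
        SmoothAt (fun y => F (t, y)) (χ (t, x)) := fun hF =>
      ContDiffAt.comp (f := fun y : Plane => (t, y)) (χ (t, x)) hF
        (contDiffAt_const.prodMk contDiffAt_id)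
    refine hG t x w Φ _ _ h2 hw.contDiffAt hΦ.contDiffAt (hc h3.self_of_nhds.1.1)
      (hc h3.self_of_nhds.1.2) ⟨h1, ?_⟩ hsat
    filter_upwards [eventually_fiber (q := (t, x)) h3] with y hy
    exact Prod.ext rfl (Prod.ext hy.2.1.symm hy.2.2.symm)
  have hcurve : HasDerivAt (fun t => χ (t, x)) (G.generator (sec w Φ x)).1 0 := by
    rw [← hχ1]
    exact (hχ.self_of_nhds.differentiableAt (by simp)).hasFDerivAt.comp_hasDerivAt (0 : ℝ)
      ((hasDerivAt_id (0 : ℝ)).prodMk (hasDerivAt_const (0 : ℝ) x))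
  have kb : ∀ α β, HasDerivAt (fun t => S.b (χ (t, x)) α β)
      (S.xib G.generator w Φ x α β) 0 := fun α β =>
    hasDerivAt_comp_curve (g := fun y => S.b y α β)
      (SmoothAt.differentiableAt (SmoothAt.pdL (hf _ hz) [α, β])) hcurve hχx
  have kp : HasDerivAt (fun t => S.p (χ (t, x))) (∑ l, xiAlong G.generator w Φ l x * pd l S.p x) 0 :=
    hasDerivAt_comp_curve (hp _ hz).differentiableAt hcurve hχx
  have hw0 : ∀ J, pdL J (fun y => W (0, y)) x = pdL J w x := fun J =>
    (pdL_congr (hW0.mono fun y h => h.1) J).eq_of_nhds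
  have hΦ0 : ∀ J, pdL J (fun y => P (0, y)) x = pdL J Φ x := fun J =>
    (pdL_congr (hW0.mono fun y h => h.2) J).eq_of_nhds
  have h0w : hess (fun y => W (0, y)) (χ (0, x)) = hess w x := by
    rw [hχx]
    exact funext₂ fun α β => hw0 [α, β]
  have h0Φ : hess (fun y => P (0, y)) (χ (0, x)) = hess Φ x := by
    rw [hχx]
    exact funext₂ fun α β => hΦ0 [α, β]
  have hzero : ∀ {g : ℝ → ℝ} {d : ℝ}, HasDerivAt g d 0 → (∀ᶠ t in 𝓝 0, g t = 0) → d = 0 :=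
    fun hd hg => hd.unique ((hasDerivAt_const (0 : ℝ) (0 : ℝ)).congr_of_eventuallyEq hg)
  have khW := fun α β => kW [α, β]
  have khP := fun α β => kP [α, β]
  constructor
  · have := hzero (((((hasDerivAt_deltaContr kW).const_mul S.D).sub
      (hasDerivAt_altContr khW khP)).sub (hasDerivAt_altContr kb khP)).sub kp)
      (hsol.mono fun t ht => ht.1)
    -- The product rule leaves the undifferentiated factors at `t = 0`; they are the jets of the
    -- original section at `x`.
    change _ - (altContr _ (hess (fun y => P (0, y)) (χ (0, x)))
      + altContr (hess (fun y => W (0, y)) (χ (0, x))) _) - (altContr _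
      (hess (fun y => P (0, y)) (χ (0, x))) + altContr (S.b (χ (0, x))) _) - _ = 0 at this
    rw [h0w, h0Φ, hχx] at this
    exact this
  · have := hzero ((((hasDerivAt_deltaContr kP).const_mul (1 / (S.E * S.h))).add
      ((hasDerivAt_altContr khW khW).const_mul (1 / 2))).add (hasDerivAt_altContr kb khW))
      (hsol.mono fun t ht => ht.2)
    change _ + 1 / 2 * (altContr _ (hess (fun y => W (0, y)) (χ (0, x)))
      + altContr (hess (fun y => W (0, y)) (χ (0, x))) _) + (altContr _
      (hess (fun y => W (0, y)) (χ (0, x))) + altContr (S.b (χ (0, x))) _) = 0 at this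
    rw [h0w, hχx] at this
    exact this

end LocalGroup

end Marguerre

/-! ### The theorem. -/

open Marguerre in
theorem mainTheorem1 (D E h : ℝ) (hD : 0 < D) (hE : 0 < E) (hh : 0 < h)
    (Ω : Set Plane) (hΩ : IsOpen Ω) (hΩc : IsConnected Ω) :
    -- `G₀` is a group with six parameters and the six fields are a basis of `L₀`
    (LinearIndependent ℝ
        (fun i : Fin 6 => (Ω ×ˢ (univ : Set (ℝ × ℝ))).domRestrict (kernelField i)) ∧
      ∃ ρ : Multiplicative (Fin 6 → ℝ) ≃* kernelGroup, ∀ (c : Fin 6 → ℝ) (z : Space),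
        (ρ (Multiplicative.ofAdd c) : Equiv.Perm Space) z =
          (z.1, z.2.1 + (c 0 + c 1 * z.1 0 + c 2 * z.1 1),
            z.2.2 + (c 3 + c 4 * z.1 0 + c 5 * z.1 1))) ∧
    -- `G₀` is admitted for every arbitrary element
    (∀ f p : Plane → ℝ, ContDiffOn ℝ ∞ f Ω → ContDiffOn ℝ ∞ p Ω →
      (∀ T ∈ kernelGroup,
        (⟨D, E, h, f, p⟩ : Equations).InvariantUnder T (Ω ×ˢ univ) ∧
        ∀ w Φ : Plane → ℝ, ∃ w' Φ' : Plane → ℝ,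
          (∀ x, T (x, w x, Φ x) = (x, w' x, Φ' x)) ∧
          ∀ U ⊆ Ω, IsOpen U →
            ((⟨D, E, h, f, p⟩ : Equations).IsSolutionOn U w Φ ↔
              (⟨D, E, h, f, p⟩ : Equations).IsSolutionOn U w' Φ')) ∧
      (∀ M ⊆ Ω ×ˢ (univ : Set (ℝ × ℝ)), IsOpen M → ∀ G : LocalGroup M, G.InKernel →
        (⟨D, E, h, f, p⟩ : Equations).AdmitsGroup G) ∧
      (∀ X ∈ kernelAlgebra, (⟨D, E, h, f, p⟩ : Equations).AdmitsField X (Ω ×ˢ univ)) ∧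
      (∀ A₁ A₂ A₃ B₁ B₂ B₃ : ℝ, (⟨D, E, h, f, p⟩ : Equations).DeterminingSystem Ω
        (fun _ _ => 0) (fun x => A₁ * x 0 + A₂ * x 1 + A₃)
        (fun x => B₁ * x 0 + B₂ * x 1 + B₃))) ∧
    -- for `f = sin x¹ sin x²` nothing else is admitted
    (∀ p : Plane → ℝ, ContDiffOn ℝ ∞ p Ω →
      (∀ M ⊆ Ω ×ˢ (univ : Set (ℝ × ℝ)), IsOpen M → IsPreconnected M →
        (∀ G : LocalGroup M,
          (⟨D, E, h, fun x => Real.sin (x 0) * Real.sin (x 1), p⟩ : Equations).AdmitsGroup G →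
            G.InKernel) ∧
        (∀ X : Space → Space, ContDiffOn ℝ ∞ X M →
          (⟨D, E, h, fun x => Real.sin (x 0) * Real.sin (x 1), p⟩ : Equations).AdmitsField X M →
            ∃ X₀ ∈ kernelAlgebra, EqOn X X₀ M)) ∧
      (∀ (ξ : Fin 2 → Plane → ℝ) (η φ : Plane → ℝ),
        (⟨D, E, h, fun x => Real.sin (x 0) * Real.sin (x 1), p⟩ : Equations).DeterminingSystem
            Ω ξ η φ →
          ∃ A₁ A₂ A₃ B₁ B₂ B₃ : ℝ, ∀ x ∈ Ω, (∀ μ, ξ μ x = 0) ∧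
            η x = A₁ * x 0 + A₂ * x 1 + A₃ ∧ φ x = B₁ * x 0 + B₂ * x 1 + B₃)) ∧
    -- hence `G₀` is the largest group admitted for all arbitrary elements
    (∀ M ⊆ Ω ×ˢ (univ : Set (ℝ × ℝ)), IsOpen M → IsPreconnected M → ∀ G : LocalGroup M,
      (∀ f p : Plane → ℝ, ContDiffOn ℝ ∞ f Ω → ContDiffOn ℝ ∞ p Ω →
        (⟨D, E, h, f, p⟩ : Equations).AdmitsGroup G) ↔ G.InKernel) := by
  have hsub : ∀ {M : Set Space}, M ⊆ Ω ×ˢ (univ : Set (ℝ × ℝ)) → ∀ {g : Plane → ℝ},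
      ContDiffOn ℝ ∞ g Ω → ∀ z ∈ M, SmoothAt g z.1 := fun hM _ hg z hz =>
    hg.contDiffAt (hΩ.mem_nhds (hM hz).1)
  have hgroup : ∀ p : Plane → ℝ, ContDiffOn ℝ ∞ p Ω → ∀ M ⊆ Ω ×ˢ (univ : Set (ℝ × ℝ)),
      IsOpen M → IsPreconnected M → ∀ G : LocalGroup M,
      (⟨D, E, h, sinSin, p⟩ : Equations).AdmitsGroup G → G.InKernel := by
    intro p hp M hM hMo hMc G hG
    refine G.inKernel_of_generator (Admissible.exists_eqOn_kernelAlgebra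
      (S := ⟨D, E, h, sinSin, p⟩) ⟨hMo, hD.ne', (mul_pos hE hh).ne', G.contDiffOn_generator, ?_⟩
      rfl hMc)
    exact G.admitsOnSmooth_generator hMo (hsub hM contDiff_sinSin.contDiffOn) (hsub hM hp) hG
  refine ⟨⟨linearIndependent_kernelField hΩ hΩc.nonempty, exists_mulEquiv_kernelGroup⟩,
    fun f p hf hp => ⟨fun T hT => ?_, fun M _ _ G hG => Equations.admitsGroup_of_inKernel hG,
      fun X hX => Equations.admitsField_of_mem_kernelAlgebra hX _,
      Equations.determiningSystem_affine Ω⟩,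
    fun p hp => ⟨fun M hM hMo hMc => ⟨hgroup p hp M hM hMo hMc, fun X hX hXa =>
      Admissible.exists_eqOn_kernelAlgebra (S := ⟨D, E, h, sinSin, p⟩)
        ⟨hMo, hD.ne', (mul_pos hE hh).ne', hX, hXa.admitsOnSmooth⟩ rfl hMc⟩,
      fun ξ η φ hs => hs.eq_affine rfl hΩ hΩc.isPreconnected⟩,
    -- A single choice of arbitrary elements, f = sin x¹ sin x² and p = 0, already excludes all
    -- other groups.
    fun M hM hMo hMc G => ⟨fun hG => hgroup (fun _ => 0) contDiffOn_const M hM hMo hMc G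
      (hG sinSin (fun _ => 0) contDiff_sinSin.contDiffOn contDiffOn_const),
      fun hG f p _ _ => Equations.admitsGroup_of_inKernel hG⟩⟩
  obtain ⟨c, rfl⟩ := mem_kernelGroup_iff.1 hT
  refine ⟨Equations.invariantUnder_of_shift fun z _ => EventuallyEq.rfl, fun w Φ =>
    ⟨fun y => w y + affine (c 0) (c 1) (c 2) y, fun y => Φ y + affine (c 3) (c 4) (c 5) y,
      fun x => ?_, fun U _ hU => Equations.isSolutionOn_add_affine hU _ _ _ _ _ _⟩⟩
  exact Prod.ext (add_zero x) rfl
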